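/- Let $s\in(0,2)$. Let $W_1,W_2,\dots$ be exponential random variables with mean $1$, let $U_1,U_2,\dots$ and $V_1,V_2,\dots$ be uniform on $[0,1]$, all of these independent. Put $M_k=(W_1+\dots+W_k)^{-1/s}$ and $Y_k=(\min(U_k,V_k),\max(U_k,V_k))$ for $k\ge 1$. Call two intervals $(i,j)$ and $(i',j')$ compatible if $j\le i'$ or $j'\le i$, and let $\mathcal C$ be the collection of all sets $A\subseteq\{1,2,\dots\}$ such that $Y_i$ and $Y_j$ are compatible for all distinct $i,j\in A$. Define the continuous long-range last-passage time $$w=\sup_{A\in\mathcal C}\ \sum_{i\in A}M_i\in[0,\infty].$$ Then $w$ is almost surely finite. Moreover, let $F$ be the distribution function of a positive random variable such that $\frac{1-F(tx)}{1-F(x)}\to t^{-s}$ as $x\to\infty$ for every $t>0$. Let $(v_{i,j})_{i<j\in\mathbb Z}$ be i.i.d. with distribution function $F$, placed on the edges of the complete directed graph on $\mathbb Z$, in which every edge $(i,j)$ with $i<j$ is present (edge probability $p=1$), and let $$w_{0,n}=\max_{0=i_0<i_1<\dots<i_l=n}\ \sum_{k=1}^{l}v_{i_{k-1},i_k}$$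 be the maximal weight of an increasing path from $0$ to $n$. Put $b_n=F^{(-1)}\bigl(1-1/\binom{n+1}{2}\bigr)$, where $F^{(-1)}(y)=\inf\{x:F(x)\ge y\}$. Then $w_{0,n}/b_n\to w$ in distribution as $n\to\infty$. -/

import Mathlib

open Filter Topology MeasureTheory ProbabilityTheory
open scoped ENNReal

noncomputable section

namespace LongRangeLPP

/-! ### The discrete model on `ℤ` (every edge `(i, j)` with `i < j` is present) -/

/-- The edges of the complete directed graph on `ℤ`: pairs `(i, j)` with `i < j`. -/
abbrev Edge : Type := {e : ℤ × ℤ // e.1 < e.2}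

/-- An increasing path from `a` to `b` with `len ≥ 0` edges, given by its successive vertices
`a = vertex 0 < vertex 1 < ⋯ < vertex len = b`. -/
structure IncreasingPath (a b : ℤ) where
  len : ℕ
  vertex : Fin (len + 1) → ℤ
  strictMono : StrictMono vertex
  start : vertex 0 = a
  finish : vertex (Fin.last len) = b

/-- The `k`-th edge of an increasing path. -/
def IncreasingPath.edge {a b : ℤ} (π : IncreasingPath a b) (k : Fin π.len) : Edge :=
  ⟨(π.vertex k.castSucc, π.vertex k.succ), π.strictMono k.castSucc_lt_succ⟩

/-- The weight of a path: the sum of the weights of its edges. -/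
def IncreasingPath.weight {a b : ℤ} (π : IncreasingPath a b) (v : Edge → ℝ) : ℝ :=
  ∑ k : Fin π.len, v (π.edge k)

/-- The passage time `w_{a,b}`: the maximal weight of an increasing path from `a` to `b`.
For `a ≤ b` the set of such paths is finite and nonempty, so that the supremum is a maximum. -/
def passageTime (v : Edge → ℝ) (a b : ℤ) : ℝ :=
  ⨆ π : IncreasingPath a b, π.weight v

/-! ### The tail of the weight distribution and the normalisation -/

/-- `1 - F` is regularly varying with index `s`, in the sense that
`(1 - F (t x)) / (1 - F x) → t ^ (-s)` as `x → ∞`, for every `t > 0`. -/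
def RegularlyVaryingTail (F : ℝ → ℝ) (s : ℝ) : Prop :=
  ∀ t : ℝ, 0 < t → Tendsto (fun x : ℝ => (1 - F (t * x)) / (1 - F x)) atTop (𝓝 (t ^ (-s)))

/-- The generalized inverse `F⁽⁻¹⁾(y) = inf {x : F x ≥ y}`. -/
def generalizedInverse (F : ℝ → ℝ) (y : ℝ) : ℝ := sInf {x : ℝ | y ≤ F x}

/-- `b_n = F⁽⁻¹⁾(1 - 1 / (n+1 choose 2))`. Only large `n` matter. -/
def scale (F : ℝ → ℝ) (n : ℕ) : ℝ :=
  generalizedInverse F (1 - 1 / ((n + 1).choose 2 : ℝ))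

/-! ### The continuous model on `[0, 1]`

The sequences are indexed from `0`, so that index `k` here is index `k + 1` in the usual
enumeration. -/

/-- Two edges `(i, j)` and `(i', j')` are compatible if `j ≤ i'` or `j' ≤ i`. -/
def Compatible (x y : ℝ × ℝ) : Prop := x.2 ≤ y.1 ∨ y.2 ≤ x.1

/-- The weights `M_{k+1} = (W_1 + ⋯ + W_{k+1}) ^ (-1 / s)`. -/
def contWeight (s : ℝ) (W : ℕ → ℝ) (k : ℕ) : ℝ :=
  (∑ i ∈ Finset.range (k + 1), W i) ^ (-1 / s)

/-- The edges `Y_k = (min (U_k, V_k), max (U_k, V_k))`. -/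
def contEdge (U V : ℕ → ℝ) (k : ℕ) : ℝ × ℝ := (min (U k) (V k), max (U k) (V k))

/-- The admissible index sets: any two distinct members carry compatible edges. -/
def admissible (U V : ℕ → ℝ) : Set (Set ℕ) :=
  {A | A.Pairwise fun i j => Compatible (contEdge U V i) (contEdge U V j)}

/-- The continuous last-passage time `w = sup_{A admissible} ∑_{i ∈ A} M_i`, in `[0, ∞]`. -/
def contPassageTime (s : ℝ) (W U V : ℕ → ℝ) : ℝ≥0∞ :=
  ⨆ A ∈ admissible U V, ∑' i : A, ENNReal.ofReal (contWeight s W i)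

/-- The random input of the continuous model on a probability space `(Ω, P)`: `W_k` are
exponential with mean `1`, `U_k` and `V_k` are uniform on `[0, 1]`, and all of these random
variables are independent. -/
structure IsContinuousModelInput {Ω : Type*} [MeasurableSpace Ω] (P : Measure Ω)
    (W U V : ℕ → Ω → ℝ) : Prop where
  law_W : ∀ k, HasLaw (W k) (expMeasure 1) P
  law_U : ∀ k, HasLaw (U k) (volume.restrict (Set.Icc (0 : ℝ) 1)) P
  law_V : ∀ k, HasLaw (V k) (volume.restrict (Set.Icc (0 : ℝ) 1)) P
  indep : iIndepFun (Sum.elim W (Sum.elim U V)) P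

end LongRangeLPP

end

noncomputable section

namespace LongRangeLPP

/-! ### Compatible sets of edges and increasing paths -/

/-! Only the largest weights matter, and the largest weights of the discrete model, together with
their positions, behave in the limit like the pairs `(M_k, Y_k)`. Write each weight as `G(u_e)`,
where `G` is the tail quantile of `F` and the marks `u_e` are i.i.d. uniform; small marks are large
weights. With `N` the number of edges in `{0, …, n}`, the rescaled marks `N u_e`, listed in
increasing order, approach the partial sums of exponential variables, and regular variation gives
`G(y / N) / G(1 / N) → y ^ (-1 / s)` with `G(1 / N) = b_n`. Since weights are nonnegative, a maximal
path is the same as a maximal set of pairwise compatible edges (`exists_passageTime_eq`), so both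
models optimise over the same kind of sets.

Head. The joint law of the `K + 1` smallest marks and their edges is written exactly as an integral
over the continuous model (`sum_lintegral_isTop`): the marks become exponential partial sums with an
explicit likelihood ratio, and the edges become the grid cells of the points `(U_k, V_k)`. No
coupling is needed: the likelihood ratio tends to `1` under an integrable bound, compatibility on
the grid eventually agrees with compatibility of the intervals, and dominated convergence gives the
limit of the truncated passage times (`tendsto_sum_lintegral_isTop`).

Tail. The generating function of compatible sets is at most `exp (√x n)` (`compatGen_le`), so the
largest number of compatible edges with mark at most `t / N` has mean of order `√t`, uniformly in
`n` (`IsUniformField.lintegral_maxCompat_le`). Edges with rescaled mark of order `2 ^ j` have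
normalised weight at most `C r ^ j` with `r` equal to or slightly above `2 ^ (-1 / s)`, and
contribute about `(r √2) ^ j`. This is summable because `s < 2` allows `r √2 < 1`. Markov's
inequality for the number of small marks then controls everything beyond the first `K` ranks
(`IsUniformField.lintegral_truncError_le`).

The continuous tail inherits the discrete bound by passing to the limit
(`lintegral_min_contTail_le`). This gives almost sure finiteness, and an approximation argument with
bounded Lipschitz test functions gives convergence in distribution
(`tendsto_lintegral_passageTime`). -/

/-- Compatibility of two integer intervals. -/
def EdgeCompat (x y : ℤ × ℤ) : Prop := x.2 ≤ y.1 ∨ y.2 ≤ x.1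

/-- The edges with both end points in `{0, …, n}`. -/
def edges (n : ℕ) : Finset Edge :=
  (Finset.Icc (0 : ℤ) n ×ˢ Finset.Icc (0 : ℤ) n).subtype (fun e => e.1 < e.2)

lemma mem_edges {n : ℕ} {e : Edge} : e ∈ edges n ↔ 0 ≤ e.1.1 ∧ e.1.2 ≤ n := by
  have := e.2
  simp only [edges, Finset.mem_subtype, Finset.mem_product, Finset.mem_Icc]
  constructor
  · rintro ⟨⟨h1, h2⟩, h3, h4⟩; exact ⟨h1, h4⟩
  · rintro ⟨h1, h2⟩; exact ⟨⟨h1, by omega⟩, by omega, h2⟩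

/-- The edge `(i, j)` between natural numbers. -/
def natEdge (i j : ℕ) (h : i < j) : Edge := ⟨((i : ℤ), (j : ℤ)), Int.ofNat_lt.2 h⟩

lemma card_edges_eq_sum (n : ℕ) : (edges n).card = ∑ j ∈ Finset.range (n + 1), j := by
  have : (edges n).card
      = ((Finset.range (n + 1)).sigma (fun j => Finset.range j)).card := by
    refine Finset.card_bij' (fun e _ => ⟨e.1.2.toNat, e.1.1.toNat⟩)
      (fun p hp => natEdge p.2 p.1 (by simpa using (Finset.mem_sigma.1 hp).2)) ?_ ?_ ?_ ?_
    · intro e he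
      have := e.2
      rw [mem_edges] at he
      simp only [Finset.mem_sigma, Finset.mem_range]
      omega
    · intro p hp
      simp only [Finset.mem_sigma, Finset.mem_range] at hp
      simp only [mem_edges, natEdge]
      omega
    · intro e he
      have := e.2
      rw [mem_edges] at he
      apply Subtype.ext
      simp only [natEdge]
      ext <;> simp <;> omega
    · intro p hp
      simp [natEdge]
  rw [this, Finset.card_sigma]
  simp

lemma card_edges (n : ℕ) : (edges n).card = (n + 1).choose 2 := by
  rw [card_edges_eq_sum, Finset.sum_range_id, Nat.choose_two_right]

/-- The sets of pairwise compatible edges in `{0, …, n}`. -/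
def compatSets (n : ℕ) : Finset (Finset Edge) :=
  open Classical in (edges n).powerset.filter
    (fun A => (A : Set Edge).Pairwise fun x y => EdgeCompat x.1 y.1)

lemma mem_compatSets {n : ℕ} {A : Finset Edge} :
    A ∈ compatSets n ↔ A ⊆ edges n ∧ (A : Set Edge).Pairwise fun x y => EdgeCompat x.1 y.1 := by
  simp [compatSets]

lemma empty_mem_compatSets (n : ℕ) : ∅ ∈ compatSets n := by
  simp [mem_compatSets]

lemma compatSets_of_subset {n : ℕ} {A B : Finset Edge} (hB : B ∈ compatSets n) (h : A ⊆ B) :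
    A ∈ compatSets n := by
  rw [mem_compatSets] at hB ⊢
  exact ⟨h.trans hB.1, hB.2.mono (by exact_mod_cast h)⟩

lemma edges_zero : edges 0 = ∅ := by
  ext e
  have := e.2
  simp only [mem_edges, Finset.notMem_empty, iff_false]
  push_cast
  omega

lemma compatSets_zero : compatSets 0 = {∅} := by
  ext A
  simp only [mem_compatSets, edges_zero, Finset.subset_empty, Finset.mem_singleton]
  constructor
  · exact fun h => h.1
  · rintro rfl; simp

/-- A set of compatible edges in `{0, …, n + 1}` either misses the vertex `n + 1`, or consists of an
edge `(i, n + 1)` and of compatible edges in `{0, …, i}`. -/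
lemma compatSets_succ_cases {n : ℕ} {A : Finset Edge} (hA : A ∈ compatSets (n + 1)) :
    A ∈ compatSets n ∨ ∃ (i : ℕ) (hi : i < n + 1), ∃ B ∈ compatSets i,
      natEdge i (n + 1) hi ∉ B ∧ A = insert (natEdge i (n + 1) hi) B := by
  rw [mem_compatSets] at hA
  obtain ⟨hsub, hpair⟩ := hA
  by_cases h : ∃ e ∈ A, e.1.2 = ((n + 1 : ℕ) : ℤ)
  · right
    obtain ⟨e, heA, he⟩ := h
    have he0 := mem_edges.1 (hsub heA)
    have hlt := e.2
    have hi : e.1.1.toNat < n + 1 := by omega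
    have hee : natEdge e.1.1.toNat (n + 1) hi = e := by
      apply Subtype.ext
      simp only [natEdge]
      ext <;> simp <;> omega
    refine ⟨e.1.1.toNat, hi, A.erase e, ?_, ?_, ?_⟩
    · rw [mem_compatSets]
      refine ⟨fun x hx => ?_, hpair.mono (by simp)⟩
      have hxA := Finset.mem_of_mem_erase hx
      have hx0 := mem_edges.1 (hsub hxA)
      have hxlt := x.2
      rw [mem_edges]
      refine ⟨hx0.1, ?_⟩
      rcases hpair hxA heA (Finset.ne_of_mem_erase hx) with h | h
      · omega
      · omega
    · rw [hee]; simp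
    · rw [hee, Finset.insert_erase heA]
  · left
    push Not at h
    rw [mem_compatSets]
    refine ⟨fun x hx => ?_, hpair⟩
    have hx0 := mem_edges.1 (hsub hx)
    have := h x hx
    rw [mem_edges]
    refine ⟨hx0.1, ?_⟩
    omega

/-! ### Counting compatible sets -/

/-- The generating function of the sizes of the compatible sets. -/
def compatGen (n : ℕ) (x : ℝ) : ℝ := ∑ A ∈ compatSets n, x ^ A.card

/-- Classify a compatible set by its edge into the last vertex: without one it lives in `{0, …, n}`,
and an edge `(i, n + 1)` costs a factor `x` and confines the rest to `{0, …, i}`. Covering by these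
cases suffices, since all terms are nonnegative. -/
lemma compatGen_succ_le (n : ℕ) {x : ℝ} (hx : 0 ≤ x) :
    compatGen (n + 1) x ≤ compatGen n x + x * ∑ i ∈ Finset.range (n + 1), compatGen i x := by
  classical
  let S := (Finset.univ : Finset (Fin (n + 1))).sigma (fun i => compatSets i)
  let g : (Σ _ : Fin (n + 1), Finset Edge) → Finset Edge :=
    fun p => insert (natEdge p.1 (n + 1) p.1.2) p.2
  let S' := S.filter (fun p => natEdge p.1 (n + 1) p.1.2 ∉ p.2)
  have hS' : S' ⊆ S := Finset.filter_subset _ _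
  have hsub : compatSets (n + 1) ⊆ compatSets n ∪ S'.image g := by
    intro A hA
    rw [Finset.mem_union]
    rcases compatSets_succ_cases hA with h | ⟨i, hi, B, hB, hnB, rfl⟩
    · exact Or.inl h
    · refine Or.inr (Finset.mem_image.2 ⟨⟨⟨i, hi⟩, B⟩, ?_, rfl⟩)
      simp only [S', S, Finset.mem_filter, Finset.mem_sigma, Finset.mem_univ, true_and]
      exact ⟨hB, hnB⟩
  have h0 : ∀ A : Finset Edge, 0 ≤ x ^ A.card := fun A => by positivity
  calc compatGen (n + 1) x ≤ ∑ A ∈ compatSets n ∪ S'.image g, x ^ A.card :=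
        Finset.sum_le_sum_of_subset_of_nonneg hsub fun A _ _ => h0 A
    _ ≤ compatGen n x + ∑ A ∈ S'.image g, x ^ A.card := by
        have := Finset.sum_union_inter (s₁ := compatSets n) (s₂ := S'.image g)
          (f := fun A : Finset Edge => x ^ A.card)
        have h3 : 0 ≤ ∑ A ∈ compatSets n ∩ S'.image g, x ^ A.card :=
          Finset.sum_nonneg fun A _ => h0 A
        simp only [compatGen]
        linarith
    _ ≤ compatGen n x + ∑ p ∈ S', x ^ (g p).card := by
        gcongr
        exact Finset.sum_image_le_of_nonneg fun p _ => h0 _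
    _ = compatGen n x + ∑ p ∈ S', x * x ^ p.2.card := by
        congr 1
        refine Finset.sum_congr rfl fun p hp => ?_
        have : natEdge p.1 (n + 1) p.1.2 ∉ p.2 := (Finset.mem_filter.1 hp).2
        simp only [g]
        rw [Finset.card_insert_of_notMem this, pow_succ, mul_comm]
    _ ≤ compatGen n x + ∑ p ∈ S, x * x ^ p.2.card := by
        gcongr
    _ = _ := by
        rw [Finset.sum_sigma, Finset.mul_sum, ← Fin.sum_univ_eq_sum_range
          (fun i => x * compatGen i x)]
        simp only [compatGen, Finset.mul_sum]

/-- This is `l / 2 ≤ sinh (l / 2)` multiplied by `2 exp (l / 2)`. -/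
lemma mul_exp_half_le {l : ℝ} (hl : 0 ≤ l) : l * Real.exp (l / 2) ≤ Real.exp l - 1 := by
  have h := Real.self_le_sinh_iff.2 (by positivity : 0 ≤ l / 2)
  rw [Real.sinh_eq] at h
  have h1 : Real.exp l = Real.exp (l / 2) * Real.exp (l / 2) := by
    rw [← Real.exp_add]; congr 1; ring
  have h2 : Real.exp (-(l / 2)) * Real.exp (l / 2) = 1 := by
    rw [← Real.exp_add]; simp
  have h3 := Real.exp_pos (l / 2)
  nlinarith

/-- With `l = √x`, the sequence `exp (l n)` is a supersolution of the recursion in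
`compatGen_succ_le`. Summing the geometric series with ratio `q = exp l` reduces the claim to `l ^ 2
q ≤ (q - 1) ^ 2`, the square of `mul_exp_half_le`. -/
lemma exp_add_sum_exp_le {l : ℝ} (hl : 0 ≤ l) (n : ℕ) :
    Real.exp (l * n) + l ^ 2 * ∑ i ∈ Finset.range (n + 1), Real.exp (l * i)
      ≤ Real.exp (l * (n + 1 : ℕ)) := by
  rcases hl.eq_or_lt with rfl | hl'
  · simp
  set q := Real.exp l with hq
  have hq1 : 1 < q := Real.one_lt_exp_iff.2 hl'
  have hpow : ∀ i : ℕ, Real.exp (l * i) = q ^ i := fun i => by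
    rw [hq, ← Real.exp_nat_mul, mul_comm]
  simp only [hpow]
  have hgeom := geom_sum_mul q (n + 1)
  have hkey : l ^ 2 * q ≤ (q - 1) ^ 2 := by
    have h1 := mul_exp_half_le hl
    have h2 : Real.exp (l / 2) ^ 2 = q := by
      rw [hq, ← Real.exp_nat_mul]; congr 1; push_cast; ring
    rw [← h2, ← mul_pow, h2]
    exact pow_le_pow_left₀ (by positivity) h1 2
  have hqn : 0 < q ^ n := by positivity
  have : (l ^ 2 * ∑ i ∈ Finset.range (n + 1), q ^ i) * (q - 1) ≤ (q ^ (n + 1) - q ^ n) * (q - 1) := by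
    rw [mul_assoc, hgeom, pow_succ q n]
    nlinarith [mul_le_mul_of_nonneg_left hkey hqn.le, sq_nonneg l]
  have := le_of_mul_le_mul_right this (by linarith)
  linarith

lemma compatGen_le (n : ℕ) {x : ℝ} (hx : 0 ≤ x) : compatGen n x ≤ Real.exp (√x * n) := by
  induction n using Nat.strong_induction_on with
  | _ n ih =>
    rcases n with _ | n
    · simp [compatGen, compatSets_zero]
    · calc compatGen (n + 1) x
          ≤ compatGen n x + x * ∑ i ∈ Finset.range (n + 1), compatGen i x :=
            compatGen_succ_le n hx
        _ ≤ Real.exp (√x * n) + x * ∑ i ∈ Finset.range (n + 1), Real.exp (√x * i) := by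
            gcongr with i hi
            · exact ih n (by omega)
            · exact ih i (by simpa using hi)
        _ = Real.exp (√x * n) + √x ^ 2 * ∑ i ∈ Finset.range (n + 1), Real.exp (√x * i) := by
            rw [Real.sq_sqrt hx]
        _ ≤ _ := exp_add_sum_exp_le (Real.sqrt_nonneg x) n

/-! ### Passage times as maxima over compatible sets -/

/-- The path without edges. -/
def trivialPath (a : ℤ) : IncreasingPath a a where
  len := 0
  vertex := fun _ => a
  strictMono := fun i j h => absurd h (by simp [Subsingleton.elim (α := Fin 1) i j])
  start := rfl
  finish := rfl

/-- A path extended by one edge. -/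
def IncreasingPath.snoc {a b : ℤ} (π : IncreasingPath a b) (c : ℤ) (h : b < c) :
    IncreasingPath a c where
  len := π.len + 1
  vertex := Fin.snoc (α := fun _ => ℤ) π.vertex c
  strictMono := by
    rw [Fin.strictMono_iff_lt_succ]
    intro i
    refine Fin.lastCases ?_ (fun j => ?_) i
    · rw [Fin.snoc_castSucc, Fin.succ_last, Fin.snoc_last, π.finish]
      exact h
    · rw [Fin.snoc_castSucc, Fin.succ_castSucc, Fin.snoc_castSucc]
      exact π.strictMono j.castSucc_lt_succ
  start := by
    have : (0 : Fin (π.len + 1 + 1)) = Fin.castSucc (0 : Fin (π.len + 1)) := rfl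
    rw [this, Fin.snoc_castSucc, π.start]
  finish := by rw [Fin.snoc_last]

lemma IncreasingPath.weight_snoc {a b : ℤ} (π : IncreasingPath a b) (c : ℤ) (h : b < c)
    (v : Edge → ℝ) : (π.snoc c h).weight v = π.weight v + v ⟨(b, c), h⟩ := by
  unfold IncreasingPath.weight
  change ∑ k : Fin (π.len + 1), v ((π.snoc c h).edge k) = _
  rw [Fin.sum_univ_castSucc]
  congr 1
  · refine Finset.sum_congr rfl fun k _ => ?_
    congr 1
    apply Subtype.ext
    simp only [IncreasingPath.edge, IncreasingPath.snoc]
    rw [Fin.snoc_castSucc, Fin.succ_castSucc, Fin.snoc_castSucc]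
  · congr 1
    apply Subtype.ext
    simp only [IncreasingPath.edge, IncreasingPath.snoc]
    rw [Fin.snoc_castSucc, Fin.succ_last, Fin.snoc_last, π.finish]

/-- The gaps between compatible edges are filled by unit steps, whose weights are nonnegative and so
can only help. -/
lemma exists_path_of_compatSets {v : Edge → ℝ} (hv : ∀ e, 0 ≤ v e) (n : ℕ) :
    ∀ A ∈ compatSets n, ∃ π : IncreasingPath 0 n, ∑ e ∈ A, v e ≤ π.weight v := by
  induction n using Nat.strong_induction_on with
  | _ n ih =>
    intro A hA
    rcases n with _ | n
    · rw [compatSets_zero, Finset.mem_singleton] at hA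
      subst hA
      refine ⟨trivialPath 0, ?_⟩
      change _ ≤ ∑ k : Fin 0, _
      simp
    · rcases compatSets_succ_cases hA with h | ⟨i, hi, B, hB, hnB, rfl⟩
      · obtain ⟨π, hπ⟩ := ih n (by omega) A h
        refine ⟨π.snoc ((n + 1 : ℕ) : ℤ) (by push_cast; omega), ?_⟩
        rw [IncreasingPath.weight_snoc]
        exact hπ.trans (le_add_of_nonneg_right (hv _))
      · obtain ⟨π, hπ⟩ := ih i hi B hB
        refine ⟨π.snoc ((n + 1 : ℕ) : ℤ) (by exact_mod_cast hi), ?_⟩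
        rw [IncreasingPath.weight_snoc, Finset.sum_insert hnB, add_comm]
        exact add_le_add hπ le_rfl

lemma exists_compatSets_of_path (v : Edge → ℝ) {n : ℕ} (π : IncreasingPath 0 n) :
    ∃ A ∈ compatSets n, π.weight v = ∑ e ∈ A, v e := by
  classical
  have hinj : Function.Injective π.edge := by
    intro k l h
    have h1 : π.vertex k.castSucc = π.vertex l.castSucc := congrArg (fun e : Edge => e.1.1) h
    exact Fin.castSucc_injective _ (π.strictMono.injective h1)
  refine ⟨Finset.univ.image π.edge, ?_, ?_⟩
  · rw [mem_compatSets]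
    constructor
    · intro e he
      obtain ⟨k, -, rfl⟩ := Finset.mem_image.1 he
      rw [mem_edges]
      constructor
      · exact π.start.symm.le.trans (π.strictMono.monotone (Fin.zero_le _))
      · exact (π.strictMono.monotone (Fin.le_last _)).trans π.finish.le
    · intro x hx y hy hxy
      simp only [Finset.coe_image, Finset.coe_univ, Set.image_univ, Set.mem_range] at hx hy
      obtain ⟨k, rfl⟩ := hx
      obtain ⟨l, rfl⟩ := hy
      have hkl : k ≠ l := fun h => hxy (by rw [h])
      rcases lt_or_gt_of_ne hkl with h | h
      · left
        exact π.strictMono.monotone (by simpa [Fin.le_def] using h)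
      · right
        exact π.strictMono.monotone (by simpa [Fin.le_def] using h)
  · rw [Finset.sum_image fun a _ b _ h => hinj h]
    rfl

lemma bddAbove_weight (v : Edge → ℝ) (n : ℕ) :
    BddAbove (Set.range fun π : IncreasingPath 0 n => π.weight v) := by
  refine ((compatSets n).image fun A => ∑ e ∈ A, v e).finite_toSet.bddAbove.mono ?_
  rintro _ ⟨π, rfl⟩
  obtain ⟨A, hA, h⟩ := exists_compatSets_of_path v π
  simp only [Finset.coe_image, Set.mem_image]
  exact ⟨A, hA, h.symm⟩

lemma sum_le_passageTime {v : Edge → ℝ} (hv : ∀ e, 0 ≤ v e) {n : ℕ} {A : Finset Edge}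
    (hA : A ∈ compatSets n) : ∑ e ∈ A, v e ≤ passageTime v 0 n := by
  obtain ⟨π, hπ⟩ := exists_path_of_compatSets hv n A hA
  exact hπ.trans (le_ciSup (bddAbove_weight v n) π)

lemma exists_passageTime_eq {v : Edge → ℝ} (hv : ∀ e, 0 ≤ v e) (n : ℕ) :
    ∃ A ∈ compatSets n, passageTime v 0 n = ∑ e ∈ A, v e := by
  obtain ⟨A, hA, hmax⟩ := (compatSets n).exists_max_image (fun A => ∑ e ∈ A, v e)
    ⟨∅, empty_mem_compatSets n⟩
  refine ⟨A, hA, le_antisymm ?_ (sum_le_passageTime hv hA)⟩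
  obtain ⟨π₀, -⟩ := exists_path_of_compatSets hv n ∅ (empty_mem_compatSets n)
  have : Nonempty (IncreasingPath 0 (n : ℤ)) := ⟨π₀⟩
  refine ciSup_le fun π => ?_
  obtain ⟨B, hB, h⟩ := exists_compatSets_of_path v π
  rw [h]
  exact hmax B hB

instance (a b : ℤ) : Countable (IncreasingPath a b) := by
  have : Function.Injective
      (fun π : IncreasingPath a b => (⟨π.len, π.vertex⟩ : Σ l : ℕ, Fin (l + 1) → ℤ)) := by
    rintro ⟨l, v, h1, h2, h3⟩ ⟨l', v', h1', h2', h3'⟩ h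
    simp only [Sigma.mk.injEq] at h
    obtain ⟨rfl, h⟩ := h
    obtain rfl := eq_of_heq h
    rfl
  exact this.countable

lemma measurable_passageTime (a b : ℤ) : Measurable fun v : Edge → ℝ => passageTime v a b := by
  unfold passageTime IncreasingPath.weight
  exact Measurable.iSup fun π => by fun_prop

/-! ### Independent uniform marks on the edges -/

/-- The uniform distribution on `[0, 1]`. -/
abbrev uniformLaw : Measure ℝ := volume.restrict (Set.Icc (0 : ℝ) 1)

instance : IsProbabilityMeasure uniformLaw := ⟨by simp⟩

/-- Independent uniform marks on the edges. -/
structure IsUniformField {Ω : Type*} [MeasurableSpace Ω] (Q : Measure Ω)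
    (u : Edge → Ω → ℝ) : Prop where
  meas : ∀ e, Measurable (u e)
  law : ∀ e, HasLaw (u e) uniformLaw Q
  indep : iIndepFun u Q

lemma uniformLaw_Iic_le (x : ℝ) : uniformLaw (Set.Iic x) ≤ ENNReal.ofReal x := by
  rw [Measure.restrict_apply measurableSet_Iic]
  calc volume (Set.Iic x ∩ Set.Icc 0 1) ≤ volume (Set.Icc 0 x) :=
        measure_mono fun y hy => ⟨hy.2.1, hy.1⟩
    _ = ENNReal.ofReal x := by simp

/-! ### Counting compatible edges with small marks, and the resulting truncation error -/

section Tail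

variable {Ω : Type*} [MeasurableSpace Ω] {Q : Measure Ω} {u : Edge → Ω → ℝ}

lemma IsUniformField.measure_le (h : IsUniformField Q u) (e : Edge) (x : ℝ) :
    Q {ω | u e ω ≤ x} ≤ ENNReal.ofReal x := by
  rw [(h.law e).measure_eq (p := fun y => y ≤ x) measurableSet_Iic]
  exact uniformLaw_Iic_le x

lemma IsUniformField.measure_forall_le (h : IsUniformField Q u) (A : Finset Edge) {x : ℝ}
    (hx : 0 ≤ x) : Q {ω | ∀ e ∈ A, u e ω ≤ x} ≤ ENNReal.ofReal (x ^ A.card) := by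
  have h1 : {ω | ∀ e ∈ A, u e ω ≤ x} = ⋂ e ∈ A, u e ⁻¹' Set.Iic x := by
    ext ω; simp
  rw [h1, h.indep.measure_inter_preimage_eq_mul A (fun e _ => measurableSet_Iic),
    ENNReal.ofReal_pow hx]
  calc ∏ e ∈ A, Q (u e ⁻¹' Set.Iic x) ≤ ∏ _e ∈ A, ENNReal.ofReal x :=
        Finset.prod_le_prod' fun e _ => h.measure_le e x
    _ = _ := by rw [Finset.prod_const]

/-- The largest number of compatible edges in `{0, …, n}` whose marks are at most `x`. -/
def maxCompat (n : ℕ) (x : ℝ) (ξ : Edge → ℝ) : ℕ :=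
  open Classical in ((compatSets n).filter (fun A => ∀ e ∈ A, ξ e ≤ x)).sup Finset.card

lemma card_le_maxCompat {n : ℕ} {x : ℝ} {ξ : Edge → ℝ} {A : Finset Edge}
    (hA : A ∈ compatSets n) (h : ∀ e ∈ A, ξ e ≤ x) : A.card ≤ maxCompat n x ξ := by
  classical
  unfold maxCompat
  exact Finset.le_sup (f := Finset.card)
    (by rw [Finset.mem_filter]; exact ⟨hA, h⟩)

/-- Every subset of an optimal set is itself compatible with all marks at most `x`, so an optimum of
size `L` forces at least `2 ^ L` terms to be `1`. This gives an exponential moment of the maximum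
from the expected number of such sets. -/
lemma two_pow_maxCompat_le (n : ℕ) (x : ℝ) (ξ : Edge → ℝ) :
    (2 : ℝ≥0∞) ^ maxCompat n x ξ ≤
      ∑ A ∈ compatSets n, {ζ : Edge → ℝ | ∀ e ∈ A, ζ e ≤ x}.indicator (fun _ => 1) ξ := by
  classical
  obtain ⟨A, hA, hmax⟩ := Finset.exists_mem_eq_sup
    ((compatSets n).filter (fun A => ∀ e ∈ A, ξ e ≤ x))
    ⟨∅, by simp [empty_mem_compatSets]⟩ Finset.card
  have hmax' : maxCompat n x ξ = A.card := by
    unfold maxCompat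
    convert hmax
  rw [Finset.mem_filter] at hA
  rw [hmax']
  calc (2 : ℝ≥0∞) ^ A.card = ∑ B ∈ A.powerset, 1 := by
        simp [Finset.card_powerset]
    _ = ∑ B ∈ A.powerset, {ζ : Edge → ℝ | ∀ e ∈ B, ζ e ≤ x}.indicator (fun _ => 1) ξ := by
        refine Finset.sum_congr rfl fun B hB => ?_
        rw [Set.indicator_of_mem]
        exact fun e he => hA.2 e (Finset.mem_powerset.1 hB he)
    _ ≤ _ := Finset.sum_le_sum_of_subset fun B hB =>
        compatSets_of_subset hA.1 (Finset.mem_powerset.1 hB)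

lemma measurableSet_forall_le (A : Finset Edge) (x : ℝ) :
    MeasurableSet {ζ : Edge → ℝ | ∀ e ∈ A, ζ e ≤ x} := by
  have : {ζ : Edge → ℝ | ∀ e ∈ A, ζ e ≤ x} = ⋂ e ∈ A, (fun ζ : Edge → ℝ => ζ e) ⁻¹' Set.Iic x := by
    ext; simp
  rw [this]
  exact Finset.measurableSet_biInter _ fun e _ => measurable_pi_apply e measurableSet_Iic

lemma measurable_maxCompat (n : ℕ) (x : ℝ) : Measurable (maxCompat n x) := by
  classical
  have : maxCompat n x = fun ξ => (compatSets n).sup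
      (fun A => if ξ ∈ {ζ : Edge → ℝ | ∀ e ∈ A, ζ e ≤ x} then A.card else 0) := by
    ext ξ
    unfold maxCompat
    apply le_antisymm
    · refine Finset.sup_le fun A hA => ?_
      rw [Finset.mem_filter] at hA
      refine le_trans ?_ (Finset.le_sup hA.1)
      rw [if_pos]
      exact hA.2
    · refine Finset.sup_le fun A hA => ?_
      split_ifs with h
      · exact Finset.le_sup (f := Finset.card) (Finset.mem_filter.2 ⟨hA, h⟩)
      · exact Nat.zero_le _
  rw [this]
  have hne : (compatSets n).Nonempty := ⟨∅, empty_mem_compatSets n⟩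
  have h := Finset.measurable_sup' hne (f := fun A ξ =>
    if ξ ∈ {ζ : Edge → ℝ | ∀ e ∈ A, ζ e ≤ x} then A.card else 0) (fun A _ =>
      Measurable.ite (measurableSet_forall_le A x) measurable_const measurable_const)
  convert h using 1
  ext ξ
  rw [Finset.sup'_apply, Finset.sup'_eq_sup]

lemma IsUniformField.measurable (h : IsUniformField Q u) : Measurable fun ω e => u e ω :=
  measurable_pi_lambda _ h.meas

lemma IsUniformField.lintegral_two_pow_le (h : IsUniformField Q u) (n : ℕ) {x : ℝ} (hx : 0 ≤ x) :
    ∫⁻ ω, (2 : ℝ≥0∞) ^ maxCompat n x (u · ω) ∂Q ≤ ENNReal.ofReal (Real.exp (√x * n)) := by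
  calc ∫⁻ ω, (2 : ℝ≥0∞) ^ maxCompat n x (u · ω) ∂Q
      ≤ ∫⁻ ω, ∑ A ∈ compatSets n, {ω | ∀ e ∈ A, u e ω ≤ x}.indicator (fun _ => 1) ω ∂Q :=
        lintegral_mono fun ω => two_pow_maxCompat_le n x (u · ω)
    _ = ∑ A ∈ compatSets n, Q {ω | ∀ e ∈ A, u e ω ≤ x} := by
        have hm : ∀ A : Finset Edge, MeasurableSet {ω | ∀ e ∈ A, u e ω ≤ x} := fun A =>
          h.measurable (measurableSet_forall_le A x)
        rw [lintegral_finsetSum _ fun A _ => measurable_const.indicator (hm A)]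
        refine Finset.sum_congr rfl fun A _ => ?_
        rw [lintegral_indicator (hm A)]
        simp
    _ ≤ ∑ A ∈ compatSets n, ENNReal.ofReal (x ^ A.card) :=
        Finset.sum_le_sum fun A _ => h.measure_forall_le A hx
    _ = ENNReal.ofReal (compatGen n x) := by
        rw [compatGen, ENNReal.ofReal_sum_of_nonneg fun A _ => by positivity]
    _ ≤ _ := ENNReal.ofReal_le_ofReal (compatGen_le n hx)

/-- Comes from `1 + y ≤ exp y` at `y = L log 2 - a`, with `log 2 > 1 / 2`. It turns a bound `exp a`
on the moment of `2 ^ L` into a bound of order `a` on the mean of `L`. -/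
lemma natCast_le_two_pow (L : ℕ) {a : ℝ} (ha : 0 ≤ a) :
    (L : ℝ≥0∞) ≤ 2 * (2 ^ L * ENNReal.ofReal (Real.exp (-a)) + ENNReal.ofReal a) := by
  have hlog : 1 / 2 < Real.log 2 := by linarith [Real.log_two_gt_d9]
  have h1 : (L : ℝ) * Real.log 2 - a + 1 ≤ 2 ^ L * Real.exp (-a) := by
    have := Real.add_one_le_exp ((L : ℝ) * Real.log 2 - a)
    rw [sub_eq_add_neg, Real.exp_add, mul_comm (L : ℝ), Real.exp_mul, Real.exp_log two_pos,
      Real.rpow_natCast] at this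
    linarith
  have h2 : (L : ℝ) ≤ 2 * (2 ^ L * Real.exp (-a) + a) := by
    have : (0 : ℝ) ≤ L := L.cast_nonneg
    nlinarith
  calc (L : ℝ≥0∞) = ENNReal.ofReal L := by simp
    _ ≤ ENNReal.ofReal (2 * (2 ^ L * Real.exp (-a) + a)) := ENNReal.ofReal_le_ofReal h2
    _ = _ := by
        rw [ENNReal.ofReal_mul (by norm_num), ENNReal.ofReal_add (by positivity) ha,
          ENNReal.ofReal_mul (by positivity), ENNReal.ofReal_pow (by norm_num)]
        simp

/-- The number of edges in `{0, …, n}`. -/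
def numEdges (n : ℕ) : ℝ := ((n + 1).choose 2 : ℝ)

lemma numEdges_eq (n : ℕ) : numEdges n = n * (n + 1) / 2 := by
  rw [numEdges, Nat.cast_choose_two]
  push_cast
  ring

lemma numEdges_pos {n : ℕ} (hn : 1 ≤ n) : 0 < numEdges n := by
  rw [numEdges_eq]
  have : (1 : ℝ) ≤ n := by exact_mod_cast hn
  positivity

lemma card_edges_eq_numEdges (n : ℕ) : ((edges n).card : ℝ) = numEdges n := by
  rw [card_edges, numEdges]

lemma IsUniformField.lintegral_maxCompat_le (h : IsUniformField Q u) {n : ℕ} (hn : 1 ≤ n) {t : ℝ}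
    (ht : 1 ≤ t) :
    ∫⁻ ω, (maxCompat n (t / numEdges n) (u · ω) : ℝ≥0∞) ∂Q ≤ ENNReal.ofReal (4 * √(2 * t)) := by
  have hprob : IsProbabilityMeasure Q := h.indep.isProbabilityMeasure
  have hN := numEdges_pos hn
  have hn1 : (1 : ℝ) ≤ n := by exact_mod_cast hn
  set a := √(2 * t) with ha
  have ha1 : 1 ≤ a := Real.one_le_sqrt.2 (by linarith)
  -- Here `(t / N) n ^ 2 = 2 t n / (n + 1) ≤ 2 t`, which explains the choice of `a`.
  have hexp : √(t / numEdges n) * n ≤ a := by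
    have h1 : (n : ℝ) = √((n : ℝ) ^ 2) := (Real.sqrt_sq (by positivity)).symm
    rw [h1, ← Real.sqrt_mul (by positivity), ha]
    apply Real.sqrt_le_sqrt
    rw [div_mul_eq_mul_div, div_le_iff₀ hN, numEdges_eq]
    nlinarith
  have hm : Measurable fun ω => (2 : ℝ≥0∞) ^ maxCompat n (t / numEdges n) (u · ω) :=
    (Measurable.of_discrete (f := fun k : ℕ => (2 : ℝ≥0∞) ^ k)).comp
      ((measurable_maxCompat n _).comp h.measurable)
  calc ∫⁻ ω, (maxCompat n (t / numEdges n) (u · ω) : ℝ≥0∞) ∂Q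
      ≤ ∫⁻ ω, 2 * (2 ^ maxCompat n (t / numEdges n) (u · ω) * ENNReal.ofReal (Real.exp (-a))
          + ENNReal.ofReal a) ∂Q :=
        lintegral_mono fun ω => natCast_le_two_pow _ (by linarith)
    _ = 2 * ((∫⁻ ω, 2 ^ maxCompat n (t / numEdges n) (u · ω) ∂Q) * ENNReal.ofReal (Real.exp (-a))
          + ENNReal.ofReal a) := by
        rw [lintegral_const_mul _ (by fun_prop), lintegral_add_right _ measurable_const,
          lintegral_mul_const _ hm]
        simp
    _ ≤ 2 * (ENNReal.ofReal (Real.exp a) * ENNReal.ofReal (Real.exp (-a)) + ENNReal.ofReal a) := by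
        gcongr
        refine (h.lintegral_two_pow_le n (by positivity)).trans ?_
        exact ENNReal.ofReal_le_ofReal (Real.exp_le_exp.2 hexp)
    _ = ENNReal.ofReal (2 * (1 + a)) := by
        rw [← ENNReal.ofReal_mul (Real.exp_pos _).le, ← Real.exp_add, add_neg_cancel, Real.exp_zero,
          ← ENNReal.ofReal_add (by norm_num) (by linarith), ENNReal.ofReal_mul (by norm_num)]
        simp
    _ ≤ _ := ENNReal.ofReal_le_ofReal (by linarith)

/-- A bound for the contribution of the edges whose mark exceeds `2 ^ J / N`. -/
def tailSum (C r : ℝ) (J n : ℕ) (ξ : Edge → ℝ) : ℝ≥0∞ :=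
  ∑' j : ℕ, ENNReal.ofReal (C * r ^ (j + J)) *
    (maxCompat n (2 ^ (j + J + 1) / numEdges n) ξ : ℝ≥0∞)

lemma measurable_tailSum (C r : ℝ) (J n : ℕ) : Measurable (tailSum C r J n) := by
  unfold tailSum
  refine Measurable.tsum fun j => Measurable.const_mul ?_ _
  exact (Measurable.of_discrete (f := fun k : ℕ => (k : ℝ≥0∞))).comp (measurable_maxCompat n _)

/-- The bound for the expected tail. -/
def tailBound (C r : ℝ) (J : ℕ) : ℝ≥0∞ := ∑' j : ℕ, ENNReal.ofReal (8 * C * (r * √2) ^ (j + J))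

lemma tendsto_tailBound {C r : ℝ} (hC : 0 ≤ C) (hr : 0 ≤ r) (hr2 : r * √2 < 1) :
    Tendsto (tailBound C r) atTop (𝓝 0) := by
  refine ENNReal.tendsto_sum_nat_add (fun j => ENNReal.ofReal (8 * C * (r * √2) ^ j)) ?_
  have hs : Summable fun j : ℕ => 8 * C * (r * √2) ^ j :=
    (summable_geometric_of_lt_one (by positivity) hr2).mul_left _
  rw [← ENNReal.ofReal_tsum_of_nonneg (fun j => by positivity) hs]
  exact ENNReal.ofReal_ne_top

lemma IsUniformField.lintegral_tailSum_le (h : IsUniformField Q u) {n : ℕ} (hn : 1 ≤ n) {C r : ℝ}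
    (hC : 0 ≤ C) (hr : 0 ≤ r) (J : ℕ) :
    ∫⁻ ω, tailSum C r J n (u · ω) ∂Q ≤ tailBound C r J := by
  unfold tailSum tailBound
  have hm : ∀ j : ℕ, Measurable fun ω =>
      (maxCompat n (2 ^ (j + J + 1) / numEdges n) (u · ω) : ℝ≥0∞) := fun j =>
    (Measurable.of_discrete (f := fun k : ℕ => (k : ℝ≥0∞))).comp
      ((measurable_maxCompat n _).comp h.measurable)
  rw [lintegral_tsum fun j => ((hm j).const_mul _).aemeasurable]
  refine ENNReal.tsum_le_tsum fun j => ?_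
  rw [lintegral_const_mul _ (hm j)]
  calc _ ≤ ENNReal.ofReal (C * r ^ (j + J)) * ENNReal.ofReal (4 * √(2 * 2 ^ (j + J + 1))) := by
        gcongr
        exact h.lintegral_maxCompat_le hn (one_le_pow₀ (by norm_num))
    _ = _ := by
        rw [← ENNReal.ofReal_mul (by positivity)]
        congr 1
        -- The square root in the count becomes `2 √2 ^ (j + J)`; together with the factor `4` this
        -- is the constant `8` in `tailBound`.
        have : (2 : ℝ) * 2 ^ (j + J + 1) = (2 * √2 ^ (j + J)) ^ 2 := by
          rw [mul_pow, ← pow_mul, mul_comm (j + J) 2, pow_mul, Real.sq_sqrt (by norm_num)]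
          ring
        rw [this, Real.sqrt_sq (by positivity), mul_pow]
        ring

/-- Each edge is charged to its dyadic scale, the least `j` with `N ξ e ≤ 2 ^ (j + J + 1)`. The
edges of `A` below a given level form a compatible set, so their number is at most `maxCompat`. -/
lemma sum_le_tailSum {C r : ℝ} {J n : ℕ} (hn : 1 ≤ n) {ξ h : Edge → ℝ} {A : Finset Edge}
    (hA : A ∈ compatSets n) (hJ : ∀ e ∈ A, 2 ^ J < numEdges n * ξ e)
    (hh : ∀ e ∈ A, ∀ j : ℕ, 2 ^ j < numEdges n * ξ e → h e ≤ C * r ^ j) :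
    ∑ e ∈ A, ENNReal.ofReal (h e) ≤ tailSum C r J n ξ := by
  classical
  have hN := numEdges_pos hn
  have h1 : ∀ e ∈ A, ENNReal.ofReal (h e) ≤ ∑' j : ℕ, ENNReal.ofReal (C * r ^ (j + J)) *
      (if ξ e ≤ 2 ^ (j + J + 1) / numEdges n then 1 else 0) := by
    intro e he
    have hex : ∃ j : ℕ, numEdges n * ξ e ≤ 2 ^ (j + J + 1) := by
      obtain ⟨k, hk⟩ := pow_unbounded_of_one_lt (numEdges n * ξ e) (one_lt_two (α := ℝ))
      exact ⟨k, hk.le.trans (pow_le_pow_right₀ (by norm_num) (by omega))⟩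
    have hspec := Nat.find_spec hex
    -- Minimality of the scale gives the lower bound, except at scale `0`, where it is the
    -- hypothesis `hJ`.
    have hlow : 2 ^ (Nat.find hex + J) < numEdges n * ξ e := by
      rcases hj : Nat.find hex with _ | k
      · simpa using hJ e he
      · have := Nat.find_min hex (m := k) (by omega)
        rw [not_le] at this
        have e1 : k + 1 + J = k + J + 1 := by omega
        rw [e1]
        exact this
    refine le_trans ?_ (ENNReal.le_tsum (Nat.find hex))
    rw [if_pos, mul_one]
    · exact ENNReal.ofReal_le_ofReal (hh e he _ hlow)
    · rw [le_div_iff₀ hN, mul_comm]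
      exact hspec
  calc ∑ e ∈ A, ENNReal.ofReal (h e)
      ≤ ∑ e ∈ A, ∑' j : ℕ, ENNReal.ofReal (C * r ^ (j + J)) *
        (if ξ e ≤ 2 ^ (j + J + 1) / numEdges n then 1 else 0) := Finset.sum_le_sum h1
    _ = ∑' j : ℕ, ∑ e ∈ A, ENNReal.ofReal (C * r ^ (j + J)) *
        (if ξ e ≤ 2 ^ (j + J + 1) / numEdges n then 1 else 0) :=
        (Summable.tsum_finsetSum fun _ _ => ENNReal.summable).symm
    _ ≤ _ := by
        refine ENNReal.tsum_le_tsum fun j => ?_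
        rw [← Finset.mul_sum, Finset.sum_boole]
        gcongr
        exact card_le_maxCompat (compatSets_of_subset hA (Finset.filter_subset _ _))
          fun e he => (Finset.mem_filter.1 he).2

/-- The number of edges in `{0, …, n}` whose mark is at most `2 ^ J / N`. -/
def lowCount (J n : ℕ) (ξ : Edge → ℝ) : ℕ :=
  ((edges n).filter (fun e => ξ e ≤ 2 ^ J / numEdges n)).card

lemma measurable_lowCount (J n : ℕ) :
    Measurable fun ξ => (lowCount J n ξ : ℝ≥0∞) := by
  simp only [lowCount, Finset.natCast_card_filter]
  refine Finset.measurable_sum _ fun e _ => Measurable.ite ?_ measurable_const measurable_const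
  exact measurable_pi_apply e measurableSet_Iic

lemma IsUniformField.lintegral_lowCount_le (h : IsUniformField Q u) (J : ℕ) {n : ℕ} (hn : 1 ≤ n) :
    ∫⁻ ω, (lowCount J n (u · ω) : ℝ≥0∞) ∂Q ≤ 2 ^ J := by
  simp only [lowCount, Finset.natCast_card_filter]
  have hs : ∀ e, MeasurableSet {ω | u e ω ≤ 2 ^ J / numEdges n} := fun e =>
    h.meas e measurableSet_Iic
  rw [lintegral_finsetSum _ fun e _ => Measurable.ite (hs e) measurable_const measurable_const]
  calc _ ≤ ∑ _e ∈ edges n, ENNReal.ofReal (2 ^ J / numEdges n) := by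
        refine Finset.sum_le_sum fun e _ => ?_
        have : (fun ω => if u e ω ≤ 2 ^ J / numEdges n then (1 : ℝ≥0∞) else 0) =
            {ω | u e ω ≤ 2 ^ J / numEdges n}.indicator fun _ => 1 := by
          ext ω; simp [Set.indicator_apply]
        rw [this, lintegral_indicator (hs e)]
        simpa using h.measure_le e _
    _ = ENNReal.ofReal (numEdges n * (2 ^ J / numEdges n)) := by
        rw [Finset.sum_const, nsmul_eq_mul, ENNReal.ofReal_mul (numEdges_pos hn).le,
          ← card_edges_eq_numEdges, ENNReal.ofReal_natCast]
    _ = 2 ^ J := by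
        rw [mul_div_cancel₀ _ (numEdges_pos hn).ne', ENNReal.ofReal_pow (by norm_num)]
        simp

/-- The random variable controlling the error of a truncation to the `a` smallest marks. -/
def truncError (C r : ℝ) (J a n : ℕ) (ξ : Edge → ℝ) : ℝ≥0∞ :=
  lowCount J n ξ / a + tailSum C r J n ξ

lemma measurable_truncError (C r : ℝ) (J a n : ℕ) : Measurable (truncError C r J a n) :=
  ((measurable_lowCount J n).div_const _).add (measurable_tailSum C r J n)

lemma IsUniformField.lintegral_truncError_le (h : IsUniformField Q u) {n : ℕ} (hn : 1 ≤ n) {C r : ℝ}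
    (hC : 0 ≤ C) (hr : 0 ≤ r) (J a : ℕ) :
    ∫⁻ ω, truncError C r J a n (u · ω) ∂Q ≤ 2 ^ J / a + tailBound C r J := by
  unfold truncError
  have hm : Measurable fun ω => (lowCount J n (u · ω) : ℝ≥0∞) :=
    (measurable_lowCount J n).comp h.measurable
  rw [lintegral_add_left (hm.div_const _)]
  simp only [div_eq_mul_inv]
  rw [lintegral_mul_const _ hm]
  gcongr
  · exact h.lintegral_lowCount_le J hn
  · exact h.lintegral_tailSum_le hn hC hr J

end Tail

/-! ### Order statistics of uniform variables and partial sums of exponential variables -/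

lemma lintegral_pi_prod {n : ℕ} (μ : Measure ℝ) [SigmaFinite μ] (f : Fin n → ℝ → ℝ≥0∞)
    (hf : ∀ i, Measurable (f i)) :
    ∫⁻ x, ∏ i, f i (x i) ∂(Measure.pi fun _ : Fin n => μ) = ∏ i, ∫⁻ x, f i x ∂μ := by
  induction n with
  | zero => simp
  | succ n ih =>
    have h := (measurePreserving_piFinSuccAbove (fun _ : Fin (n + 1) => μ) 0)
    have hm : Measurable fun y : Fin n → ℝ => ∏ i : Fin n, f i.succ (y i) :=
      Finset.measurable_prod _ fun i _ => (hf i.succ).comp (measurable_pi_apply i)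
    calc ∫⁻ x, ∏ i, f i (x i) ∂(Measure.pi fun _ : Fin (n + 1) => μ)
        = ∫⁻ x, (fun p : ℝ × (Fin n → ℝ) => f 0 p.1 * ∏ i : Fin n, f i.succ (p.2 i))
            (MeasurableEquiv.piFinSuccAbove (fun _ => ℝ) 0 x)
            ∂(Measure.pi fun _ : Fin (n + 1) => μ) := by
          refine lintegral_congr fun x => ?_
          rw [Fin.prod_univ_succ]
          rfl
      _ = ∫⁻ p : ℝ × (Fin n → ℝ), f 0 p.1 * ∏ i : Fin n, f i.succ (p.2 i)
            ∂(μ.prod (Measure.pi fun _ : Fin n => μ)) := by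
          exact h.lintegral_comp (((hf 0).comp measurable_fst).mul (hm.comp measurable_snd))
      _ = (∫⁻ x, f 0 x ∂μ) * ∏ i : Fin n, ∫⁻ x, f i.succ x ∂μ := by
          rw [lintegral_prod_mul (f := f 0) (hf 0).aemeasurable hm.aemeasurable,
            ih _ fun i => hf i.succ]
      _ = _ := by rw [Fin.prod_univ_succ]

lemma pi_withDensity {n : ℕ} (f : ℝ → ℝ≥0∞) (hf : Measurable f)
    [SigmaFinite ((volume : Measure ℝ).withDensity f)] :
    (Measure.pi fun _ : Fin n => (volume : Measure ℝ).withDensity f)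
      = (volume : Measure (Fin n → ℝ)).withDensity fun x => ∏ i, f (x i) := by
  refine Measure.pi_eq fun s hs => ?_
  rw [withDensity_apply _ (MeasurableSet.univ_pi hs), ← lintegral_indicator (MeasurableSet.univ_pi hs)]
  have : ∀ x : Fin n → ℝ, (Set.univ.pi s).indicator (fun x => ∏ i, f (x i)) x
      = ∏ i, (s i).indicator f (x i) := by
    intro x
    by_cases hx : x ∈ Set.univ.pi s
    · rw [Set.indicator_of_mem hx]
      exact Finset.prod_congr rfl fun i _ => (Set.indicator_of_mem (hx i trivial) _).symm
    · rw [Set.indicator_of_notMem hx]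
      simp only [Set.mem_pi, Set.mem_univ, true_implies, not_forall] at hx
      obtain ⟨i, hi⟩ := hx
      exact (Finset.prod_eq_zero (Finset.mem_univ i) (Set.indicator_of_notMem hi _)).symm
  simp_rw [this]
  rw [volume_pi, lintegral_pi_prod _ _ fun i => hf.indicator (hs i)]
  exact Finset.prod_congr rfl fun i _ => by
    rw [lintegral_indicator (hs i), withDensity_apply _ (hs i)]

instance : IsProbabilityMeasure (expMeasure 1) := isProbabilityMeasure_expMeasure one_pos

lemma expMeasure_eq : expMeasure 1 = (volume : Measure ℝ).withDensity (exponentialPDF 1) := rfl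

lemma measurable_exponentialPDF : Measurable (exponentialPDF 1) :=
  (measurable_exponentialPDFReal 1).ennreal_ofReal

/-- The partial sums of a finite sequence. -/
def partialSums {K : ℕ} (w : Fin (K + 1) → ℝ) (i : Fin (K + 1)) : ℝ := ∑ j ∈ Finset.Iic i, w j

lemma measurable_partialSums {K : ℕ} : Measurable (partialSums (K := K)) := by
  unfold partialSums
  fun_prop

lemma partialSums_zero {K : ℕ} (w : Fin (K + 1) → ℝ) : partialSums w 0 = w 0 := by
  have : Finset.Iic (0 : Fin (K + 1)) = {0} := by
    ext i; simp
  simp [partialSums, this]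

lemma partialSums_last {K : ℕ} (w : Fin (K + 1) → ℝ) :
    partialSums w (Fin.last K) = ∑ i, w i := by
  have : Finset.Iic (Fin.last K) = Finset.univ := by
    ext i; simp [Fin.le_last]
  simp [partialSums, this]

lemma partialSums_succ {K : ℕ} (w : Fin (K + 1) → ℝ) (i : Fin K) :
    partialSums w i.succ = partialSums w i.castSucc + w i.succ := by
  have : Finset.Iic i.succ = insert i.succ (Finset.Iic i.castSucc) := by
    ext j
    simp only [Finset.mem_Iic, Finset.mem_insert, Fin.le_def, Fin.ext_iff, Fin.val_succ,
      Fin.val_castSucc]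
    omega
  rw [partialSums, this, Finset.sum_insert (by simp [Fin.le_def]), add_comm]
  rfl

lemma strictMono_partialSums {K : ℕ} {w : Fin (K + 1) → ℝ} (hw : ∀ i, 0 < w i) :
    StrictMono (partialSums w) := by
  rw [Fin.strictMono_iff_lt_succ]
  intro i
  rw [partialSums_succ]
  linarith [hw i.succ]

lemma partialSums_pos {K : ℕ} {w : Fin (K + 1) → ℝ} (hw : ∀ i, 0 < w i) (i : Fin (K + 1)) :
    0 < partialSums w i :=
  Finset.sum_pos (fun j _ => hw j) ⟨i, by simp⟩

/-- The matrix of the map `w ↦ (partial sums of w) / N`. -/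
def partialSumMatrix (K : ℕ) (N : ℝ) : Matrix (Fin (K + 1)) (Fin (K + 1)) ℝ :=
  Matrix.of fun i j => if j ≤ i then N⁻¹ else 0

lemma toLin'_partialSumMatrix (K : ℕ) (N : ℝ) (w : Fin (K + 1) → ℝ) :
    Matrix.toLin' (partialSumMatrix K N) w = fun i => partialSums w i / N := by
  ext i
  rw [Matrix.toLin'_apply, Matrix.mulVec, dotProduct]
  simp only [partialSumMatrix, Matrix.of_apply, ite_mul, zero_mul, partialSums]
  rw [← Finset.sum_filter, Finset.sum_div]
  refine Finset.sum_congr (by ext; simp) fun j _ => by rw [div_eq_inv_mul]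

lemma det_partialSumMatrix (K : ℕ) (N : ℝ) : (partialSumMatrix K N).det = N⁻¹ ^ (K + 1) := by
  rw [Matrix.det_of_isLowerTriangular]
  · simp [partialSumMatrix]
  · intro i j hij
    simp only [partialSumMatrix, Matrix.of_apply]
    rw [if_neg]
    simpa using hij

lemma measurableSet_strictMono (K : ℕ) : MeasurableSet {x : Fin (K + 1) → ℝ | StrictMono x} := by
  have : {x : Fin (K + 1) → ℝ | StrictMono x} =
      ⋂ i : Fin K, {x | x i.castSucc < x i.succ} := by
    ext x
    simp [Fin.strictMono_iff_lt_succ]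
  rw [this]
  exact MeasurableSet.iInter fun i =>
    measurableSet_lt (measurable_pi_apply _) (measurable_pi_apply _)

/-- Increasingly ordered uniform variables are rescaled partial sums of exponential variables, up
to a change of measure. -/
lemma lintegral_strictMono_uniform {K : ℕ} {N : ℝ} (hN : 0 < N) {Ξ : (Fin (K + 1) → ℝ) → ℝ≥0∞}
    (hΞ : Measurable Ξ) :
    ∫⁻ x, {x | StrictMono x}.indicator Ξ x ∂(Measure.pi fun _ : Fin (K + 1) => uniformLaw)
      = ENNReal.ofReal (N⁻¹ ^ (K + 1)) *
        ∫⁻ w, {w | partialSums w (Fin.last K) ≤ N}.indicator (fun w =>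
          ENNReal.ofReal (Real.exp (partialSums w (Fin.last K))) *
            Ξ (fun i => partialSums w i / N)) w ∂(Measure.pi fun _ : Fin (K + 1) => expMeasure 1) := by
  set F : (Fin (K + 1) → ℝ) → ℝ≥0∞ :=
    (Set.univ.pi fun _ : Fin (K + 1) => Set.Icc (0 : ℝ) 1).indicator
      ({x | StrictMono x}.indicator Ξ) with hF
  have hIcc : MeasurableSet (Set.univ.pi fun _ : Fin (K + 1) => Set.Icc (0 : ℝ) 1) :=
    MeasurableSet.univ_pi fun _ => measurableSet_Icc
  have hFm : Measurable F := (hΞ.indicator (measurableSet_strictMono K)).indicator hIcc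
  have hlhs : ∫⁻ x, {x | StrictMono x}.indicator Ξ x ∂(Measure.pi fun _ : Fin (K + 1) => uniformLaw)
      = ∫⁻ x, F x := by
    rw [hF, lintegral_indicator hIcc, volume_pi, Measure.restrict_pi_pi]
  have hpsm : Measurable fun w : Fin (K + 1) → ℝ => partialSums w (Fin.last K) :=
    (measurable_pi_apply _).comp measurable_partialSums
  have hgm : Measurable ({w | partialSums w (Fin.last K) ≤ N}.indicator (fun w =>
          ENNReal.ofReal (Real.exp (partialSums w (Fin.last K))) *
            Ξ (fun i : Fin (K + 1) => partialSums w i / N))) := by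
    refine Measurable.indicator (Measurable.mul ?_ (hΞ.comp ?_)) ?_
    · exact (Real.measurable_exp.comp hpsm).ennreal_ofReal
    · exact measurable_pi_lambda _ fun i =>
        ((measurable_pi_apply i).comp measurable_partialSums).div_const _
    · exact hpsm measurableSet_Iic
  have hprobd : IsProbabilityMeasure ((volume : Measure ℝ).withDensity (exponentialPDF 1)) :=
    isProbabilityMeasure_expMeasure one_pos
  have hdet : (partialSumMatrix K N).det ≠ 0 := by
    rw [det_partialSumMatrix]; positivity
  have hmap := Real.map_matrix_volume_pi_eq_smul_volume_pi hdet
  have hLm : Measurable (Matrix.toLin' (partialSumMatrix K N)) :=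
    (LinearMap.continuous_on_pi _).measurable
  -- Linear change of variables: the matrix is triangular with diagonal `N⁻¹`, so its determinant is
  -- `N⁻¹ ^ (K + 1)`.
  have h1 : ∫⁻ w, F (fun i => partialSums w i / N) = ENNReal.ofReal (N ^ (K + 1)) * ∫⁻ x, F x := by
    have := lintegral_map (μ := volume) hFm hLm
    rw [hmap, lintegral_smul_measure, det_partialSumMatrix] at this
    simp only [toLin'_partialSumMatrix] at this
    rw [← this, smul_eq_mul]
    congr 2
    rw [← inv_pow, inv_inv, abs_of_pos (by positivity)]
  have hpm : Measurable fun x : Fin (K + 1) → ℝ => ∏ i, exponentialPDF 1 (x i) :=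
    Finset.measurable_prod _ fun i _ => measurable_exponentialPDF.comp (measurable_pi_apply i)
  rw [expMeasure_eq, pi_withDensity _ measurable_exponentialPDF,
    lintegral_withDensity_eq_lintegral_mul _ hpm hgm, hlhs]
  have hne : ∀ᵐ w : Fin (K + 1) → ℝ, ∀ i, w i ≠ 0 := by
    rw [ae_all_iff]
    intro i
    have : (volume : Measure (Fin (K + 1) → ℝ)) {w | w i = 0} = 0 := by
      rw [volume_pi]
      exact Measure.pi_hyperplane _ i 0
    exact measure_mono_null (fun w hw => by simpa using hw) this
  -- Where all increments are positive, the product density `exp (-∑ w)` cancels the factor `exp (∑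
  -- w)`, and the cube constraint amounts to the last sum being at most `N`. If some increment is
  -- negative the density vanishes, and so does the other side: a negative `w 0` leaves the cube and
  -- a negative later increment destroys monotonicity. The hyperplanes `w i = 0` are null.
  have h2 : ∫⁻ w, ((fun x : Fin (K + 1) → ℝ => ∏ i, exponentialPDF 1 (x i)) *
      ({w | partialSums w (Fin.last K) ≤ N}.indicator (fun w =>
          ENNReal.ofReal (Real.exp (partialSums w (Fin.last K))) *
            Ξ (fun i => partialSums w i / N)))) w = ∫⁻ w, F (fun i => partialSums w i / N) := by
    refine lintegral_congr_ae (hne.mono fun w hw => ?_)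
    simp only [Pi.mul_apply]
    by_cases hpos : ∀ i, 0 < w i
    · have hprod : ∏ i, exponentialPDF 1 (w i)
          = ENNReal.ofReal (Real.exp (-(partialSums w (Fin.last K)))) := by
        rw [partialSums_last, ← Finset.sum_neg_distrib, Real.exp_sum,
          ENNReal.ofReal_prod_of_nonneg fun i _ => (Real.exp_pos _).le]
        refine Finset.prod_congr rfl fun i _ => ?_
        rw [exponentialPDF_of_nonneg (hpos i).le]
        simp
      have hsm : StrictMono fun i => partialSums w i / N := fun i j hij =>
        div_lt_div_of_pos_right (strictMono_partialSums hpos hij) hN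
      by_cases hl : partialSums w (Fin.last K) ≤ N
      · rw [Set.indicator_of_mem (by exact hl), hF, Set.indicator_of_mem,
          Set.indicator_of_mem (by exact hsm), hprod, ← mul_assoc,
          ← ENNReal.ofReal_mul (Real.exp_pos _).le, ← Real.exp_add]
        · simp
        · intro i _
          refine ⟨div_nonneg (partialSums_pos hpos i).le hN.le, (div_le_one hN).2 (le_trans ?_ hl)⟩
          exact (strictMono_partialSums hpos).monotone (Fin.le_last i)
      · rw [Set.indicator_of_notMem (by exact hl), hF, Set.indicator_of_notMem, mul_zero]
        intro hmem
        exact hl ((div_le_one hN).1 (hmem (Fin.last K) trivial).2)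
    · push Not at hpos
      obtain ⟨i, hi⟩ := hpos
      have hi' : w i < 0 := lt_of_le_of_ne hi (hw i)
      rw [Finset.prod_eq_zero (Finset.mem_univ i) (exponentialPDF_of_neg hi'), zero_mul, hF]
      symm
      rcases Fin.eq_zero_or_eq_succ i with rfl | ⟨j, rfl⟩
      · rw [Set.indicator_of_notMem]
        intro hmem
        have := (hmem 0 trivial).1
        simp only [partialSums_zero] at this
        have := div_neg_of_neg_of_pos hi' hN
        linarith
      · have hns : ¬ StrictMono fun i => partialSums w i / N := by
          intro hsm
          have h3 := hsm (Fin.castSucc_lt_succ (i := j))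
          simp only [partialSums_succ] at h3
          have := (div_lt_div_iff_of_pos_right hN).1 h3
          linarith
        by_cases hmem : (fun i => partialSums w i / N) ∈
            Set.univ.pi fun _ : Fin (K + 1) => Set.Icc (0 : ℝ) 1
        · rw [Set.indicator_of_mem hmem, Set.indicator_of_notMem (by exact hns)]
        · rw [Set.indicator_of_notMem hmem]
  rw [h2, h1, ← mul_assoc, ← ENNReal.ofReal_mul (by positivity), ← mul_pow, inv_mul_cancel₀ hN.ne']
  simp

/-! ### The edges with the smallest marks -/

/-- The injective `K + 1`-tuples of edges in `{0, …, n}`. -/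
def tuples (K n : ℕ) : Finset (Fin (K + 1) → Edge) :=
  open Classical in (Fintype.piFinset fun _ => edges n).filter Function.Injective

lemma mem_tuples {K n : ℕ} {e : Fin (K + 1) → Edge} :
    e ∈ tuples K n ↔ (∀ k, e k ∈ edges n) ∧ Function.Injective e := by
  simp [tuples]

/-- The tuple `e` lists the edges with the `K + 1` smallest marks in increasing order. -/
def IsTop {K : ℕ} (n : ℕ) (e : Fin (K + 1) → Edge) (ξ : Edge → ℝ) : Prop :=
  StrictMono (fun k => ξ (e k)) ∧ ∀ x ∈ edges n, x ∉ Set.range e → ξ (e (Fin.last K)) < ξ x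

lemma exists_isTop {K n : ℕ} (hK : K + 1 ≤ (edges n).card) {ξ : Edge → ℝ}
    (hξ : Set.InjOn ξ (edges n)) : ∃ e ∈ tuples K n, IsTop n e ξ := by
  classical
  have hcard : ((edges n).image ξ).card = (edges n).card := Finset.card_image_of_injOn hξ
  let f := ((edges n).image ξ).orderEmbOfFin hcard
  have hf : ∀ i, ∃ x ∈ edges n, ξ x = f i := fun i => by
    have := Finset.orderEmbOfFin_mem ((edges n).image ξ) hcard i
    exact Finset.mem_image.1 this
  choose g hg hgf using hf
  have hsm : StrictMono fun k : Fin (K + 1) => ξ (g (Fin.castLE hK k)) := by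
    intro i j hij
    simp only [hgf]
    exact f.strictMono (by simpa using hij)
  refine ⟨fun k => g (Fin.castLE hK k), mem_tuples.2 ⟨fun k => hg _, ?_⟩, hsm, ?_⟩
  · intro i j hij
    exact hsm.injective (congrArg ξ hij)
  · intro x hx hxr
    have hmem : ξ x ∈ Set.range f := by
      rw [Finset.range_orderEmbOfFin]
      exact Finset.mem_coe.2 (Finset.mem_image_of_mem ξ hx)
    obtain ⟨i, hi⟩ := hmem
    have hxg : x = g i := hξ hx (hg i) (by rw [hgf, hi])
    simp only [hgf, ← hi]
    apply f.strictMono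
    by_contra hle
    apply hxr
    have hiK : (i : ℕ) < K + 1 := by
      have : (i : ℕ) ≤ K := by simpa [Fin.le_def] using hle
      omega
    exact ⟨⟨i, hiK⟩, by rw [hxg]; rfl⟩

/-- Induct on the rank. If the two lists agree before rank `k`, then `e k` is either outside the
second list or at rank at least `k` in it, so its mark cannot be below that of `e' k`. By symmetry
the marks agree, and marks determine edges. -/
lemma IsTop.eq {K n : ℕ} {e e' : Fin (K + 1) → Edge} {ξ : Edge → ℝ} (hξ : Set.InjOn ξ (edges n))
    (he : e ∈ tuples K n) (he' : e' ∈ tuples K n) (h : IsTop n e ξ) (h' : IsTop n e' ξ) :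
    e = e' := by
  rw [mem_tuples] at he he'
  have key : ∀ e e' : Fin (K + 1) → Edge, (∀ k, e k ∈ edges n) → Function.Injective e →
      IsTop n e ξ → IsTop n e' ξ → ∀ k, (∀ j < k, e j = e' j) → ¬ ξ (e k) < ξ (e' k) := by
    intro e e' hm hinj h h' k hlt hk
    by_cases hr : e k ∈ Set.range e'
    · obtain ⟨j, hj⟩ := hr
      rcases lt_or_ge j k with hjk | hjk
      · rw [← hlt j hjk] at hj
        exact hjk.ne (hinj hj)
      · have := h'.1.monotone hjk
        simp only [hj] at this
        exact absurd hk this.not_gt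
    · have h1 := h'.2 (e k) (hm k) hr
      have h2 := h'.1.monotone (Fin.le_last k)
      exact absurd (h2.trans_lt h1) hk.not_gt
  funext k
  induction k using WellFoundedLT.induction with
  | ind k ih =>
    apply hξ (he.1 _) (he'.1 _)
    have h1 := key e e' he.1 he.2 h h' k ih
    have h2 := key e' e he'.1 he'.2 h' h k fun j hj => (ih j hj).symm
    exact le_antisymm (not_lt.1 h2) (not_lt.1 h1)

lemma measurableSet_isTop {K : ℕ} (n : ℕ) (e : Fin (K + 1) → Edge) :
    MeasurableSet {ξ : Edge → ℝ | IsTop n e ξ} := by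
  have : {ξ : Edge → ℝ | IsTop n e ξ} =
      (fun ξ k => ξ (e k)) ⁻¹' {x : Fin (K + 1) → ℝ | StrictMono x} ∩
      ⋂ x ∈ edges n, {ξ | x ∉ Set.range e → ξ (e (Fin.last K)) < ξ x} := by
    ext ξ
    simp [IsTop]
  rw [this]
  refine MeasurableSet.inter ?_ (Finset.measurableSet_biInter _ fun x _ => ?_)
  · exact (measurable_pi_lambda _ fun k => measurable_pi_apply _) (measurableSet_strictMono K)
  · by_cases hx : x ∈ Set.range e
    · simp [hx]
    · simp only [hx, not_false_eq_true, forall_const]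
      exact measurableSet_lt (measurable_pi_apply _) (measurable_pi_apply _)

lemma ae_ne_of_indepFun {Ω : Type*} [MeasurableSpace Ω] {P : Measure Ω} [IsProbabilityMeasure P]
    {X Y : Ω → ℝ} (hX : HasLaw X uniformLaw P) (hY : HasLaw Y uniformLaw P) (h : IndepFun X Y P) :
    ∀ᵐ ω ∂P, X ω ≠ Y ω := by
  have hmap := (indepFun_iff_map_prod_eq_prod_map_map hX.aemeasurable hY.aemeasurable).1 h
  rw [hX.map_eq, hY.map_eq] at hmap
  have hdiag : MeasurableSet {p : ℝ × ℝ | p.1 = p.2} :=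
    measurableSet_eq_fun measurable_fst measurable_snd
  have h0 : (uniformLaw.prod uniformLaw) {p : ℝ × ℝ | p.1 = p.2} = 0 := by
    rw [Measure.prod_apply hdiag, lintegral_eq_zero_iff (measurable_measure_prodMk_left hdiag)]
    refine Eventually.of_forall fun x => ?_
    have : Prod.mk x ⁻¹' {p : ℝ × ℝ | p.1 = p.2} = {x} := by
      ext y; simp [eq_comm]
    simp only [this]
    simp
  rw [← hmap, Measure.map_apply_of_aemeasurable (hX.aemeasurable.prodMk hY.aemeasurable) hdiag] at h0
  exact measure_mono_null (fun ω hω => by simpa using hω) h0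

section

variable {Ω : Type*} [MeasurableSpace Ω] {Q : Measure Ω} {u : Edge → Ω → ℝ}

lemma IsUniformField.ae_injective (h : IsUniformField Q u) :
    ∀ᵐ ω ∂Q, Function.Injective (u · ω) := by
  have hprob : IsProbabilityMeasure Q := h.indep.isProbabilityMeasure
  have h1 : ∀ e e' : Edge, ∀ᵐ ω ∂Q, e ≠ e' → u e ω ≠ u e' ω := by
    intro e e'
    by_cases hee : e = e'
    · simp [hee]
    · exact (ae_ne_of_indepFun (h.law e) (h.law e') (h.indep.indepFun hee)).mono
        fun ω hω _ => hω
  have h2 : ∀ᵐ ω ∂Q, ∀ e e' : Edge, e ≠ e' → u e ω ≠ u e' ω :=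
    ae_all_iff.2 fun e => ae_all_iff.2 fun e' => h1 e e'
  exact h2.mono fun ω hω e e' hee => by_contra fun hne => hω e e' hne hee

/-- Almost surely there are no ties, so the events `IsTop` partition the sample space and the sum
keeps exactly one term. Sums over tuples thereby become expectations at the actual ranking. -/
lemma IsUniformField.ae_sum_indicator (h : IsUniformField Q u) {K n : ℕ}
    (hK : K + 1 ≤ (edges n).card) (φ : (Fin (K + 1) → Edge) → Ω → ℝ≥0∞) :
    ∀ᵐ ω ∂Q, ∃ e ∈ tuples K n, IsTop n e (u · ω) ∧
      ∑ e' ∈ tuples K n, {ω | IsTop n e' (u · ω)}.indicator (φ e') ω = φ e ω := by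
  filter_upwards [h.ae_injective] with ω hω
  obtain ⟨e, he, hte⟩ := exists_isTop hK (ξ := (u · ω)) hω.injOn
  refine ⟨e, he, hte, ?_⟩
  rw [Finset.sum_eq_single_of_mem e he]
  · exact Set.indicator_of_mem (by exact hte) _
  · intro e' he' hne
    exact Set.indicator_of_notMem (fun hmem => hne (hmem.eq hω.injOn he' he hte)) _

lemma uniformLaw_Ioi {x : ℝ} (hx : 0 ≤ x) : uniformLaw (Set.Ioi x) = ENNReal.ofReal (1 - x) := by
  rw [Measure.restrict_apply measurableSet_Ioi]
  have : Set.Ioi x ∩ Set.Icc 0 1 = Set.Ioc x 1 := by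
    ext y
    simp only [Set.mem_inter_iff, Set.mem_Ioi, Set.mem_Icc, Set.mem_Ioc]
    constructor
    · rintro ⟨h1, h2, h3⟩; exact ⟨h1, h3⟩
    · rintro ⟨h1, h2⟩; exact ⟨h1, by linarith, h2⟩
  rw [this, Real.volume_Ioc]

/-- Split the marks into those of `e` and the `N - (K + 1)` others. The others are independent of
the first, and each exceeds the largest of them with probability `1 - x (Fin.last K)`, whence the
power. -/
lemma IsUniformField.lintegral_isTop (h : IsUniformField Q u) {K n : ℕ}
    {e : Fin (K + 1) → Edge} (he : e ∈ tuples K n) {Ξ : (Fin (K + 1) → ℝ) → ℝ≥0∞}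
    (hΞ : Measurable Ξ) :
    ∫⁻ ω, {ω | IsTop n e (u · ω)}.indicator (fun ω => Ξ fun k => u (e k) ω) ω ∂Q
      = ∫⁻ x, {x | StrictMono x}.indicator
          (fun x => Ξ x * ENNReal.ofReal (1 - x (Fin.last K)) ^ ((edges n).card - (K + 1))) x
          ∂(Measure.pi fun _ : Fin (K + 1) => uniformLaw) := by
  classical
  have hprob : IsProbabilityMeasure Q := h.indep.isProbabilityMeasure
  rw [mem_tuples] at he
  let R : Finset Edge := edges n \ Finset.univ.image e
  have hR : R.card = (edges n).card - (K + 1) := by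
    rw [Finset.card_sdiff_of_subset, Finset.card_image_of_injective _ he.2, Finset.card_univ,
      Fintype.card_fin]
    intro x hx
    obtain ⟨k, -, rfl⟩ := Finset.mem_image.1 hx
    exact he.1 k
  let idx : Fin (K + 1) ⊕ R → Edge := Sum.elim e (fun x => x)
  have hidx : Function.Injective idx := by
    refine Function.Injective.sumElim he.2 Subtype.val_injective fun k x hkx => ?_
    have := x.2
    simp only [R, Finset.mem_sdiff] at this
    exact this.2 (hkx ▸ Finset.mem_image_of_mem _ (Finset.mem_univ k))
  have hind := h.indep.precomp hidx
  have hmap := hind.map_fun_eq_pi_map fun i => (h.meas (idx i)).aemeasurable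
  simp only [(h.law _).map_eq] at hmap
  have hsplit := measurePreserving_sumPiEquivProdPi (fun _ : Fin (K + 1) ⊕ R => uniformLaw)
  let G : (Fin (K + 1) → ℝ) × (R → ℝ) → ℝ≥0∞ := fun p =>
    {x : Fin (K + 1) → ℝ | StrictMono x}.indicator Ξ p.1 *
      {p : (Fin (K + 1) → ℝ) × (R → ℝ) | ∀ i, p.1 (Fin.last K) < p.2 i}.indicator 1 p
  have hset : MeasurableSet {p : (Fin (K + 1) → ℝ) × (R → ℝ) | ∀ i, p.1 (Fin.last K) < p.2 i} := by
    rw [Set.ofPred_forall]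
    exact MeasurableSet.iInter fun i => measurableSet_lt (by fun_prop) (by fun_prop)
  have hG : Measurable G :=
    ((hΞ.indicator (measurableSet_strictMono K)).comp measurable_fst).mul
      (measurable_one.indicator hset)
  have h1 : ∀ ω, {ω | IsTop n e (u · ω)}.indicator (fun ω => Ξ fun k => u (e k) ω) ω
      = G (MeasurableEquiv.sumPiEquivProdPi (fun _ => ℝ) (fun i => u (idx i) ω)) := by
    intro ω
    have hfst : (MeasurableEquiv.sumPiEquivProdPi (fun _ : Fin (K + 1) ⊕ R => ℝ)
      (fun i => u (idx i) ω)).1 = fun k => u (e k) ω := rfl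
    have hsnd : (MeasurableEquiv.sumPiEquivProdPi (fun _ : Fin (K + 1) ⊕ R => ℝ)
      (fun i => u (idx i) ω)).2 = fun x : R => u x ω := rfl
    simp only [G, hfst]
    by_cases hs : StrictMono fun k => u (e k) ω
    · rw [Set.indicator_of_mem (a := fun k => u (e k) ω) (by exact hs)]
      by_cases ho : ∀ x : R, u (e (Fin.last K)) ω < u x ω
      · rw [Set.indicator_of_mem, Set.indicator_of_mem]
        · simp
        · intro i
          exact ho i
        · refine ⟨hs, fun x hx hxr => ho ⟨x, ?_⟩⟩
          simp only [R, Finset.mem_sdiff, hx, true_and]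
          simpa using hxr
      · rw [Set.indicator_of_notMem, Set.indicator_of_notMem, mul_zero]
        · exact fun hmem => ho hmem
        · rintro ⟨-, hmem⟩
          refine ho fun x => hmem x ?_ ?_
          · exact (Finset.mem_sdiff.1 x.2).1
          · have := (Finset.mem_sdiff.1 x.2).2
            simpa using this
    · rw [Set.indicator_of_notMem, Set.indicator_of_notMem (a := fun k => u (e k) ω), zero_mul]
      · exact hs
      · exact fun hmem => hs hmem.1
  simp_rw [h1]
  have hm1 : Measurable fun ω => (fun i => u (idx i) ω) := measurable_pi_lambda _ fun i => h.meas _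
  calc ∫⁻ ω, G (MeasurableEquiv.sumPiEquivProdPi (fun _ => ℝ) (fun i => u (idx i) ω)) ∂Q
      = ∫⁻ z, G (MeasurableEquiv.sumPiEquivProdPi (fun _ => ℝ) z)
          ∂(Measure.pi fun _ : Fin (K + 1) ⊕ R => uniformLaw) := by
        rw [← hmap]
        exact (lintegral_map (f := fun z => G (MeasurableEquiv.sumPiEquivProdPi (fun _ => ℝ) z))
          (hG.comp (MeasurableEquiv.measurable _)) hm1).symm
    _ = ∫⁻ p, G p ∂((Measure.pi fun _ : Fin (K + 1) => uniformLaw).prod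
          (Measure.pi fun _ : R => uniformLaw)) := hsplit.lintegral_comp hG
    _ = ∫⁻ x, {x | StrictMono x}.indicator Ξ x * (uniformLaw (Set.Ioi (x (Fin.last K)))) ^ R.card
          ∂(Measure.pi fun _ : Fin (K + 1) => uniformLaw) := by
        rw [lintegral_prod _ hG.aemeasurable]
        refine lintegral_congr fun x => ?_
        have hx : MeasurableSet {y : R → ℝ | ∀ i, x (Fin.last K) < y i} :=
          measurable_prodMk_left hset
        have h2 : ∀ y : R → ℝ, G (x, y) = {x | StrictMono x}.indicator Ξ x *
            {y : R → ℝ | ∀ i, x (Fin.last K) < y i}.indicator 1 y := fun y => rfl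
        simp_rw [h2]
        rw [lintegral_const_mul _ (measurable_one.indicator hx), lintegral_indicator_one hx]
        congr 1
        have h3 : {y : R → ℝ | ∀ i, x (Fin.last K) < y i}
            = Set.univ.pi fun _ => Set.Ioi (x (Fin.last K)) := by
          ext y; simp
        rw [h3, Measure.pi_pi, Finset.prod_const, Finset.card_univ, Fintype.card_coe]
    _ = _ := by
        have hae : ∀ᵐ x ∂(Measure.pi fun _ : Fin (K + 1) => uniformLaw), 0 ≤ x (Fin.last K) := by
          have h4 : ∀ᵐ y ∂uniformLaw, 0 ≤ y :=
            (ae_restrict_mem measurableSet_Icc).mono fun y hy => hy.1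
          exact (measurePreserving_eval (fun _ : Fin (K + 1) => uniformLaw)
            (Fin.last K)).quasiMeasurePreserving.ae h4
        refine lintegral_congr_ae (hae.mono fun x hx => ?_)
        simp only
        rw [uniformLaw_Ioi hx, hR]
        by_cases hs : StrictMono x
        · rw [Set.indicator_of_mem (by exact hs), Set.indicator_of_mem (by exact hs)]
        · rw [Set.indicator_of_notMem (by exact hs), Set.indicator_of_notMem (by exact hs), zero_mul]

/-- The likelihood ratio between the rescaled smallest marks and the partial sums of exponential
variables. -/
def densityRatio (K n : ℕ) (w : Fin (K + 1) → ℝ) : ℝ≥0∞ :=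
  {w : Fin (K + 1) → ℝ | partialSums w (Fin.last K) ≤ numEdges n}.indicator (fun w =>
    ENNReal.ofReal (Real.exp (partialSums w (Fin.last K))) *
      ENNReal.ofReal (1 - partialSums w (Fin.last K) / numEdges n) ^ ((edges n).card - (K + 1))) w

lemma measurable_partialSums_apply {K : ℕ} (i : Fin (K + 1)) :
    Measurable fun w : Fin (K + 1) → ℝ => partialSums w i :=
  (measurable_pi_apply i).comp measurable_partialSums

lemma measurable_densityRatio (K n : ℕ) : Measurable (densityRatio K n) := by
  have := measurable_partialSums_apply (Fin.last K)
  exact Measurable.indicator (by fun_prop) (this measurableSet_Iic)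

/-- The right-hand side does not depend on `e`: the ranked edges are a uniform injective tuple,
independent of the ranked marks. This lets positions and marks be treated separately. -/
lemma IsUniformField.lintegral_isTop_eq (h : IsUniformField Q u) {K n : ℕ} (hn : 1 ≤ n)
    {e : Fin (K + 1) → Edge} (he : e ∈ tuples K n) {φ : (Fin (K + 1) → ℝ) → ℝ≥0∞}
    (hφ : Measurable φ) :
    ∫⁻ ω, {ω | IsTop n e (u · ω)}.indicator (fun ω => φ fun k => numEdges n * u (e k) ω) ω ∂Q
      = ENNReal.ofReal ((numEdges n)⁻¹ ^ (K + 1)) *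
        ∫⁻ w, densityRatio K n w * φ (partialSums w)
          ∂(Measure.pi fun _ : Fin (K + 1) => expMeasure 1) := by
  have hN := numEdges_pos hn
  have hφ' : Measurable fun x : Fin (K + 1) → ℝ => φ fun k => numEdges n * x k :=
    hφ.comp (by fun_prop)
  rw [h.lintegral_isTop he hφ', lintegral_strictMono_uniform hN]
  · congr 1
    refine lintegral_congr fun w => ?_
    unfold densityRatio
    by_cases hl : partialSums w (Fin.last K) ≤ numEdges n
    · rw [Set.indicator_of_mem (by exact hl), Set.indicator_of_mem (by exact hl)]
      have : (fun k => numEdges n * (partialSums w k / numEdges n)) = partialSums w := by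
        ext k
        field_simp
      rw [this]
      ring
    · rw [Set.indicator_of_notMem (by exact hl), Set.indicator_of_notMem (by exact hl), zero_mul]
  · exact hφ'.mul (by fun_prop)

end

/-! ### The input of the continuous model and the locations of the edges -/

/-- The joint law of the first `K + 1` weights and end points. -/
abbrev inputLaw (K : ℕ) : Measure ((Fin (K + 1) → ℝ) × (Fin (K + 1) → ℝ × ℝ)) :=
  (Measure.pi fun _ => expMeasure 1).prod (Measure.pi fun _ => uniformLaw.prod uniformLaw)

section

variable {Ω : Type*} [MeasurableSpace Ω] {P : Measure Ω} {W U V : ℕ → Ω → ℝ}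

lemma IsContinuousModelInput.hasLaw (h : IsContinuousModelInput P W U V) (K : ℕ) :
    HasLaw (fun ω => ((fun k : Fin (K + 1) => W k ω), fun k : Fin (K + 1) => (U k ω, V k ω)))
      (inputLaw K) P := by
  have hprob : IsProbabilityMeasure P := h.indep.isProbabilityMeasure
  let idx : Fin (K + 1) ⊕ (Fin (K + 1) ⊕ Fin (K + 1)) → ℕ ⊕ (ℕ ⊕ ℕ) :=
    Sum.map Fin.val (Sum.map Fin.val Fin.val)
  have hidx : Function.Injective idx :=
    Fin.val_injective.sumMap (Fin.val_injective.sumMap Fin.val_injective)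
  let μ : Fin (K + 1) ⊕ (Fin (K + 1) ⊕ Fin (K + 1)) → Measure ℝ :=
    Sum.elim (fun _ => expMeasure 1) (Sum.elim (fun _ => uniformLaw) (fun _ => uniformLaw))
  have hlaw : ∀ i, HasLaw (fun ω => Sum.elim W (Sum.elim U V) (idx i) ω) (μ i) P := by
    rintro (i | i | i)
    · exact h.law_W i
    · exact h.law_U i
    · exact h.law_V i
  have : ∀ i, IsProbabilityMeasure (μ i) := by
    rintro (i | i | i) <;> simp only [μ, Sum.elim_inl, Sum.elim_inr] <;> infer_instance
  have hmap := (h.indep.precomp hidx).map_fun_eq_pi_map fun i => (hlaw i).aemeasurable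
  simp only [(hlaw _).map_eq] at hmap
  have h0 : HasLaw (fun ω i => Sum.elim W (Sum.elim U V) (idx i) ω) (Measure.pi μ) P :=
    ⟨aemeasurable_pi_lambda _ fun i => (hlaw i).aemeasurable, hmap⟩
  have h1 := measurePreserving_sumPiEquivProdPi μ
  have h2 := measurePreserving_sumPiEquivProdPi fun i => μ (.inr i)
  have h3 := (measurePreserving_arrowProdEquivProdArrow ℝ ℝ (Fin (K + 1))
    (fun _ => uniformLaw) (fun _ => uniformLaw)).symm
  have h4 := ((MeasurePreserving.id (Measure.pi fun i => μ (.inl i))).prod (h3.comp h2)).comp h1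
  have := h4.hasLaw.comp h0
  exact this

lemma IsContinuousModelInput.indep_UV (h : IsContinuousModelInput P W U V) :
    iIndepFun (Sum.elim U V) P := by
  have := h.indep.precomp (g := Sum.inr) Sum.inr_injective
  exact this

/-- The endpoints of all edges are distinct and lie in `[0, 1)`, and the weights are positive. -/
def IsGeneric (W U V : ℕ → ℝ) : Prop :=
  (∀ k, 0 < W k) ∧ (∀ i, 0 ≤ Sum.elim U V i ∧ Sum.elim U V i < 1) ∧
    Function.Injective (Sum.elim U V)

lemma IsContinuousModelInput.ae_isGeneric (h : IsContinuousModelInput P W U V) :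
    ∀ᵐ ω ∂P, IsGeneric (W · ω) (U · ω) (V · ω) := by
  have hprob : IsProbabilityMeasure P := h.indep.isProbabilityMeasure
  have hexp : ∀ᵐ x ∂(expMeasure 1), 0 < x := by
    rw [expMeasure_eq, ae_withDensity_iff measurable_exponentialPDF]
    have h0 : ∀ᵐ x : ℝ, x ≠ 0 := by simp [ae_iff]
    filter_upwards [h0] with x hx hpdf
    rcases lt_or_gt_of_ne hx with hx' | hx'
    · exact absurd (exponentialPDF_of_neg hx') hpdf
    · exact hx'
  have hunif : ∀ᵐ x ∂uniformLaw, 0 ≤ x ∧ x < 1 := by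
    have h0 : ∀ᵐ x ∂uniformLaw, x ≠ 1 := ae_restrict_of_ae (by simp [ae_iff])
    filter_upwards [h0, ae_restrict_mem measurableSet_Icc] with x h1 h2
    exact ⟨h2.1, lt_of_le_of_ne h2.2 h1⟩
  have hlawUV : ∀ i, HasLaw (Sum.elim U V i) uniformLaw P := by
    rintro (i | i)
    · exact h.law_U i
    · exact h.law_V i
  have hsum : ∀ ω, (fun i => Sum.elim U V i ω) = Sum.elim (U · ω) (V · ω) := by
    intro ω
    ext i
    rcases i with i | i <;> rfl
  have a1 : ∀ᵐ ω ∂P, ∀ k, 0 < W k ω := ae_all_iff.2 fun k => by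
    have := hexp
    rw [← (h.law_W k).map_eq] at this
    exact ae_of_ae_map (h.law_W k).aemeasurable this
  have a2 : ∀ᵐ ω ∂P, ∀ i, 0 ≤ Sum.elim U V i ω ∧ Sum.elim U V i ω < 1 := ae_all_iff.2 fun i => by
    have := hunif
    rw [← (hlawUV i).map_eq] at this
    exact ae_of_ae_map (hlawUV i).aemeasurable this
  have a3 : ∀ᵐ ω ∂P, ∀ i j, i ≠ j → Sum.elim U V i ω ≠ Sum.elim U V j ω :=
    ae_all_iff.2 fun i => ae_all_iff.2 fun j => by
      by_cases hij : i = j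
      · simp [hij]
      · exact (ae_ne_of_indepFun (hlawUV i) (hlawUV j) (h.indep_UV.indepFun hij)).mono
          fun ω hω _ => hω
  filter_upwards [a1, a2, a3] with ω h1 h2 h3
  refine ⟨h1, ?_, ?_⟩ <;> rw [← hsum]
  · exact h2
  · exact fun i j hij => by_contra fun hne => h3 i j hne hij

end

/-- The edge of the discrete model of size `n` that contains the points `x` and `y`. -/
def gridEdge (n : ℕ) (p : ℝ × ℝ) : ℤ × ℤ :=
  (min ⌊(n + 1 : ℝ) * p.1⌋ ⌊(n + 1 : ℝ) * p.2⌋, max ⌊(n + 1 : ℝ) * p.1⌋ ⌊(n + 1 : ℝ) * p.2⌋)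

lemma measurable_gridEdge (n : ℕ) : Measurable (gridEdge n) := by
  unfold gridEdge
  have h1 : Measurable fun p : ℝ × ℝ => ⌊(n + 1 : ℝ) * p.1⌋ := by fun_prop
  have h2 : Measurable fun p : ℝ × ℝ => ⌊(n + 1 : ℝ) * p.2⌋ := by fun_prop
  exact (h1.min h2).prodMk (h1.max h2)

lemma uniformLaw_floor {n : ℕ} {i : ℤ} (h0 : 0 ≤ i) (hn : i ≤ n) :
    uniformLaw {x | ⌊(n + 1 : ℝ) * x⌋ = i} = ENNReal.ofReal ((n + 1 : ℝ)⁻¹) := by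
  have hn1 : (0 : ℝ) < n + 1 := by positivity
  have hm : MeasurableSet {x : ℝ | ⌊(n + 1 : ℝ) * x⌋ = i} := by
    have : Measurable fun x : ℝ => ⌊(n + 1 : ℝ) * x⌋ := by fun_prop
    exact this (measurableSet_singleton i)
  have hi0 : (0 : ℝ) ≤ i := by exact_mod_cast h0
  have hin : (i : ℝ) + 1 ≤ n + 1 := by
    have : (i : ℝ) ≤ n := by exact_mod_cast hn
    linarith
  rw [Measure.restrict_apply hm]
  have : {x : ℝ | ⌊(n + 1 : ℝ) * x⌋ = i} ∩ Set.Icc 0 1 =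
      Set.Ico (i / (n + 1 : ℝ)) ((i + 1) / (n + 1 : ℝ)) := by
    ext x
    simp only [Set.mem_inter_iff, Set.mem_ofPred_eq, Int.floor_eq_iff, Set.mem_Icc, Set.mem_Ico,
      div_le_iff₀ hn1, lt_div_iff₀ hn1]
    constructor
    · rintro ⟨⟨h1, h2⟩, -⟩
      exact ⟨by linarith, by linarith⟩
    · rintro ⟨h1, h2⟩
      refine ⟨⟨by linarith, by linarith⟩, ?_, ?_⟩
      · by_contra hx
        nlinarith
      · by_contra hx
        nlinarith
  rw [this, Real.volume_Ico]
  congr 1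
  field_simp
  ring

/-- The factor `2` counts the two orders in which the end points can fall into the two distinct
cells of length `1 / (n + 1)`. -/
lemma prod_uniformLaw_gridEdge {n : ℕ} {e : Edge} (he : e ∈ edges n) :
    (uniformLaw.prod uniformLaw) {p | gridEdge n p = e.1}
      = ENNReal.ofReal (2 * ((n + 1 : ℝ)⁻¹) ^ 2) := by
  obtain ⟨⟨i, j⟩, hij⟩ := e
  rw [mem_edges] at he
  simp only at hij he
  have hset : {p : ℝ × ℝ | gridEdge n p = (i, j)} =
      ({x | ⌊(n + 1 : ℝ) * x⌋ = i} ×ˢ {x | ⌊(n + 1 : ℝ) * x⌋ = j}) ∪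
      ({x | ⌊(n + 1 : ℝ) * x⌋ = j} ×ˢ {x | ⌊(n + 1 : ℝ) * x⌋ = i}) := by
    ext p
    simp only [gridEdge, Set.mem_ofPred_eq, Prod.mk.injEq, Set.mem_union, Set.mem_prod]
    omega
  have hm : ∀ i : ℤ, MeasurableSet {x : ℝ | ⌊(n + 1 : ℝ) * x⌋ = i} := fun i => by
    have : Measurable fun x : ℝ => ⌊(n + 1 : ℝ) * x⌋ := by fun_prop
    exact this (measurableSet_singleton i)
  have hdisj : Disjoint ({x : ℝ | ⌊(n + 1 : ℝ) * x⌋ = i} ×ˢ {x : ℝ | ⌊(n + 1 : ℝ) * x⌋ = j})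
      ({x : ℝ | ⌊(n + 1 : ℝ) * x⌋ = j} ×ˢ {x : ℝ | ⌊(n + 1 : ℝ) * x⌋ = i}) := by
    rw [Set.disjoint_left]
    rintro p ⟨h1, -⟩ ⟨h2, -⟩
    simp only [Set.mem_ofPred_eq] at h1 h2
    omega
  rw [hset, measure_union hdisj ((hm _).prod (hm _)), Measure.prod_prod, Measure.prod_prod,
    uniformLaw_floor he.1 (by omega), uniformLaw_floor (by omega) he.2,
    ← ENNReal.ofReal_mul (by positivity), ← ENNReal.ofReal_add (by positivity) (by positivity)]
  congr 1
  ring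

lemma lintegral_gridEdge {K n : ℕ} {e : Fin (K + 1) → Edge} (he : ∀ k, e k ∈ edges n)
    {g : (Fin (K + 1) → ℝ) → ℝ≥0∞} (hg : Measurable g) :
    ∫⁻ p, {y : Fin (K + 1) → ℝ × ℝ | ∀ k, gridEdge n (y k) = (e k).1}.indicator 1 p.2 * g p.1
        ∂(inputLaw K)
      = ENNReal.ofReal ((2 * ((n + 1 : ℝ)⁻¹) ^ 2) ^ (K + 1)) *
        ∫⁻ w, g w ∂(Measure.pi fun _ : Fin (K + 1) => expMeasure 1) := by
  have hm : MeasurableSet {y : Fin (K + 1) → ℝ × ℝ | ∀ k, gridEdge n (y k) = (e k).1} := by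
    rw [Set.ofPred_forall]
    exact MeasurableSet.iInter fun k =>
      ((measurable_gridEdge n).comp (measurable_pi_apply k)) (measurableSet_singleton _)
  have hset : {y : Fin (K + 1) → ℝ × ℝ | ∀ k, gridEdge n (y k) = (e k).1} =
      Set.univ.pi fun k => {p | gridEdge n p = (e k).1} := by
    ext y; simp
  simp_rw [mul_comm _ (g _)]
  rw [lintegral_prod_mul hg.aemeasurable (measurable_one.indicator hm).aemeasurable,
    lintegral_indicator_one hm, hset, Measure.pi_pi, mul_comm]
  congr 1
  rw [Finset.prod_congr rfl fun k _ => prod_uniformLaw_gridEdge (he k), Finset.prod_const,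
    Finset.card_univ, Fintype.card_fin, ENNReal.ofReal_pow (by positivity)]

section

variable {Ω : Type*} [MeasurableSpace Ω] {P : Measure Ω} {W U V : ℕ → Ω → ℝ}
variable {Ω' : Type*} [MeasurableSpace Ω'] {Q : Measure Ω'} {u : Edge → Ω' → ℝ}

/-- The locations that are realised by injective tuples of edges. -/
def gridTuples (K n : ℕ) : Set (Fin (K + 1) → ℤ × ℤ) :=
  {l | ∃ e ∈ tuples K n, ∀ k, l k = (e k).1}

lemma sum_tuples_indicator {K n : ℕ} (l : Fin (K + 1) → ℤ × ℤ)
    (F : (Fin (K + 1) → ℤ × ℤ) → ℝ≥0∞) :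
    ∑ e ∈ tuples K n, {l : Fin (K + 1) → ℤ × ℤ | ∀ k, l k = (e k).1}.indicator 1 l *
      F (fun k => (e k).1) = (gridTuples K n).indicator F l := by
  by_cases hl : l ∈ gridTuples K n
  · rw [Set.indicator_of_mem hl]
    obtain ⟨e, he, hle⟩ := hl
    rw [Finset.sum_eq_single_of_mem e he]
    · rw [Set.indicator_of_mem (by exact hle), Pi.one_apply, one_mul]
      congr 1
      ext1 k
      exact (hle k).symm
    · intro e' _ hne
      rw [Set.indicator_of_notMem, zero_mul]
      intro h'
      exact hne (funext fun k => Subtype.ext ((h' k).symm.trans (hle k)))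
  · rw [Set.indicator_of_notMem hl]
    refine Finset.sum_eq_zero fun e he => ?_
    rw [Set.indicator_of_notMem, zero_mul]
    exact fun h' => hl ⟨e, he, h'⟩

lemma measurable_gridTerm {K : ℕ} (n : ℕ) (e : Fin (K + 1) → Edge)
    {g : (Fin (K + 1) → ℝ) → ℝ≥0∞} (hg : Measurable g) :
    Measurable fun p : (Fin (K + 1) → ℝ) × (Fin (K + 1) → ℝ × ℝ) =>
      {l : Fin (K + 1) → ℤ × ℤ | ∀ k, l k = (e k).1}.indicator 1 (fun k => gridEdge n (p.2 k)) *
        (densityRatio K n p.1 * g (partialSums p.1)) := by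
  have hgrid : MeasurableSet {y : Fin (K + 1) → ℝ × ℝ | ∀ k, gridEdge n (y k) = (e k).1} := by
    rw [Set.ofPred_forall]
    exact MeasurableSet.iInter fun k =>
      ((measurable_gridEdge n).comp (measurable_pi_apply k)) (measurableSet_singleton _)
  exact ((measurable_one.indicator hgrid).comp measurable_snd).mul
    (((measurable_densityRatio K n).mul (hg.comp measurable_partialSums)).comp measurable_fst)

lemma measurable_indicator_gridTuples (K n : ℕ)
    (Φ : (Fin (K + 1) → ℤ × ℤ) → (Fin (K + 1) → ℝ) → ℝ≥0∞) (hΦ : ∀ l, Measurable (Φ l)) :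
    Measurable fun p : (Fin (K + 1) → ℝ) × (Fin (K + 1) → ℝ × ℝ) =>
      (gridTuples K n).indicator (fun l => densityRatio K n p.1 * Φ l (partialSums p.1))
        (fun k => gridEdge n (p.2 k)) := by
  simp_rw [← sum_tuples_indicator]
  exact Finset.measurable_sum _ fun e _ => measurable_gridTerm n e (hΦ _)

/-- The law of the smallest marks and of their locations, expressed through the continuous
model. -/
lemma sum_lintegral_isTop (hu : IsUniformField Q u) (h : IsContinuousModelInput P W U V)
    {K n : ℕ} (hn : 1 ≤ n) (Φ : (Fin (K + 1) → ℤ × ℤ) → (Fin (K + 1) → ℝ) → ℝ≥0∞)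
    (hΦ : ∀ l, Measurable (Φ l)) :
    ∑ e ∈ tuples K n, ∫⁻ ω, {ω | IsTop n e (u · ω)}.indicator
        (fun ω => Φ (fun k => (e k).1) fun k => numEdges n * u (e k) ω) ω ∂Q
      = ENNReal.ofReal (((n + 1 : ℝ) / n) ^ (K + 1)) *
        ∫⁻ ω, (gridTuples K n).indicator (fun l => densityRatio K n (fun k => W k ω) *
          Φ l (partialSums fun k => W k ω)) (fun k => gridEdge n (U k ω, V k ω)) ∂P := by
  have hn0 : (0 : ℝ) < n := by exact_mod_cast hn
  have hΦp : ∀ l, Measurable fun w : Fin (K + 1) → ℝ => densityRatio K n w * Φ l (partialSums w) :=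
    fun l => (measurable_densityRatio K n).mul ((hΦ l).comp measurable_partialSums)
  have hm := measurable_indicator_gridTuples K n Φ hΦ
  have hlaw := h.hasLaw K
  have h1 : ∫⁻ ω, (gridTuples K n).indicator (fun l => densityRatio K n (fun k => W k ω) *
          Φ l (partialSums fun k => W k ω)) (fun k => gridEdge n (U k ω, V k ω)) ∂P
      = ∫⁻ p, (gridTuples K n).indicator (fun l => densityRatio K n p.1 * Φ l (partialSums p.1))
        (fun k => gridEdge n (p.2 k)) ∂(inputLaw K) := by
    rw [← hlaw.map_eq, lintegral_map' hm.aemeasurable hlaw.aemeasurable]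
  rw [h1]
  simp_rw [← sum_tuples_indicator]
  rw [lintegral_finsetSum _ fun e _ => measurable_gridTerm n e (hΦ _), Finset.mul_sum]
  refine Finset.sum_congr rfl fun e he => ?_
  have he' := (mem_tuples.1 he).1
  have h2 := lintegral_gridEdge he' (hΦp fun k => (e k).1)
  refine Eq.trans ?_ (congrArg _ h2.symm)
  rw [hu.lintegral_isTop_eq hn he (hΦ _), ← mul_assoc,
    ← ENNReal.ofReal_mul (by positivity), ← mul_pow]
  -- The two weights of a single edge compare by `1 / N = ((n + 1) / n) · (2 / (n + 1) ^ 2)`. The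
  -- excess mass on the grid side sits on cells with both points on the same vertex.
  congr 3
  rw [numEdges_eq]
  field_simp

end

/-! ### Convergence of the likelihood ratio -/

lemma tendsto_card_edges : Tendsto (fun n => (edges n).card) atTop atTop := by
  refine tendsto_atTop_mono (fun n => ?_) tendsto_id
  rw [card_edges, Nat.choose_two_right, id, Nat.le_div_iff_mul_le two_pos]
  simp only [Nat.add_sub_cancel]
  rcases n with _ | n
  · simp
  · nlinarith

lemma tendsto_one_sub_div_pow (K : ℕ) (x : ℝ) :
    Tendsto (fun m : ℕ => (1 - x / m) ^ (m - (K + 1))) atTop (𝓝 (Real.exp (-x))) := by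
  have h1 := Real.tendsto_one_add_div_pow_exp (-x)
  have h2 : Tendsto (fun m : ℕ => (1 - x / m) ^ (K + 1)) atTop (𝓝 ((1 - 0) ^ (K + 1))) :=
    (tendsto_const_nhds.sub (tendsto_const_div_atTop_nhds_zero_nat x)).pow _
  have h3 := h1.div h2 (by simp)
  simp only [sub_zero, one_pow, div_one] at h3
  have h4 : Tendsto (fun m : ℕ => 1 - x / m) atTop (𝓝 1) := by
    simpa using (tendsto_const_nhds (x := (1 : ℝ))).sub (tendsto_const_div_atTop_nhds_zero_nat x)
  refine h3.congr' ?_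
  filter_upwards [h4.eventually_ne one_ne_zero, eventually_ge_atTop (K + 1)] with m hm hmK
  simp only [Pi.div_apply]
  rw [neg_div, ← sub_eq_add_neg, ← pow_sub₀ _ hm hmK |>.trans (div_eq_mul_inv _ _).symm]

lemma tendsto_densityRatio {K : ℕ} (w : Fin (K + 1) → ℝ) :
    Tendsto (fun n => densityRatio K n w) atTop (𝓝 1) := by
  set x := partialSums w (Fin.last K) with hx
  have h1 : Tendsto (fun m : ℕ => ENNReal.ofReal (Real.exp x) *
      ENNReal.ofReal ((1 - x / m) ^ (m - (K + 1)))) atTop (𝓝 1) := by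
    have h2 := ENNReal.tendsto_ofReal ((tendsto_one_sub_div_pow K x).const_mul (Real.exp x))
    rw [← Real.exp_add, add_neg_cancel, Real.exp_zero, ENNReal.ofReal_one] at h2
    exact h2.congr fun m => ENNReal.ofReal_mul (Real.exp_pos _).le
  refine (h1.comp tendsto_card_edges).congr' ?_
  have h3 : Tendsto (fun n => numEdges n) atTop atTop :=
    (tendsto_natCast_atTop_atTop.comp tendsto_card_edges).congr fun n => card_edges_eq_numEdges n
  filter_upwards [h3.eventually_ge_atTop x, h3.eventually_gt_atTop 0] with n hn hn0
  rw [densityRatio, Set.indicator_of_mem (by exact hn), Function.comp_apply,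
    ENNReal.ofReal_pow, card_edges_eq_numEdges]
  rw [card_edges_eq_numEdges, sub_nonneg, div_le_one hn0]
  exact hn

/-- By `1 - y ≤ exp (-y)`, and since the exponent `N - (K + 1)` is at least `N / 2`, half of the
growth `exp x` is cancelled. The remaining `exp (x / 2)` is integrable under the exponential law and
serves as the dominating function. -/
lemma densityRatio_le {K n : ℕ} (hn : 2 * (K + 1) ≤ (edges n).card) {w : Fin (K + 1) → ℝ}
    (hw : 0 ≤ partialSums w (Fin.last K)) :
    densityRatio K n w ≤ ENNReal.ofReal (Real.exp (partialSums w (Fin.last K) / 2)) := by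
  set x := partialSums w (Fin.last K) with hx
  have hN : 0 < numEdges n := by
    rw [← card_edges_eq_numEdges]
    exact_mod_cast (by omega : 0 < (edges n).card)
  unfold densityRatio
  refine Set.indicator_apply_le' (fun hmem => ?_) fun _ => zero_le
  have hxN : x ≤ numEdges n := hmem
  have h0 : 0 ≤ 1 - x / numEdges n := by
    rw [sub_nonneg, div_le_one hN]; exact hxN
  rw [← hx, ← ENNReal.ofReal_pow h0, ← ENNReal.ofReal_mul (Real.exp_pos _).le]
  apply ENNReal.ofReal_le_ofReal
  calc Real.exp x * (1 - x / numEdges n) ^ ((edges n).card - (K + 1))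
      ≤ Real.exp x * Real.exp (-(x / numEdges n)) ^ ((edges n).card - (K + 1)) := by
        gcongr
        exact Real.one_sub_le_exp_neg _
    _ = Real.exp (x - x / numEdges n * ((edges n).card - (K + 1) : ℕ)) := by
        rw [← Real.exp_nat_mul, ← Real.exp_add]
        ring_nf
    _ ≤ _ := by
        apply Real.exp_le_exp.2
        have h2 : numEdges n / 2 ≤ ((edges n).card - (K + 1) : ℕ) := by
          rw [Nat.cast_sub (by omega), card_edges_eq_numEdges]
          have : (2 * ((K + 1 : ℕ) : ℝ)) ≤ numEdges n := by
            rw [← card_edges_eq_numEdges]; exact_mod_cast hn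
          linarith
        have h3 : x / numEdges n * (numEdges n / 2) ≤
            x / numEdges n * ((edges n).card - (K + 1) : ℕ) := by
          gcongr
        have h4 : x / numEdges n * (numEdges n / 2) = x / 2 := by
          field_simp
        linarith

lemma lintegral_exp_half_partialSums (K : ℕ) :
    ∫⁻ w, ENNReal.ofReal (Real.exp (partialSums w (Fin.last K) / 2))
      ∂(Measure.pi fun _ : Fin (K + 1) => expMeasure 1) ≠ ∞ := by
  have h1 : ∀ w : Fin (K + 1) → ℝ,
      ENNReal.ofReal (Real.exp (partialSums w (Fin.last K) / 2))
        = ∏ i, ENNReal.ofReal (Real.exp (w i / 2)) := by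
    intro w
    rw [partialSums_last, Finset.sum_div, Real.exp_sum,
      ENNReal.ofReal_prod_of_nonneg fun i _ => (Real.exp_pos _).le]
  simp_rw [h1]
  rw [lintegral_pi_prod _ (fun _ x => ENNReal.ofReal (Real.exp (x / 2))) fun _ => by fun_prop]
  refine ENNReal.prod_ne_top fun _ _ => ?_
  rw [expMeasure_eq, lintegral_withDensity_eq_lintegral_mul _ measurable_exponentialPDF
    (by fun_prop)]
  -- Tilting the rate `1` density by `exp (x / 2)` gives twice the density of rate `1 / 2`, so each
  -- factor integrates to `2`.
  have h2 : ∀ x : ℝ, (exponentialPDF 1 * fun x => ENNReal.ofReal (Real.exp (x / 2))) x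
      = 2 * exponentialPDF (1 / 2) x := by
    intro x
    rw [Pi.mul_apply]
    rcases lt_or_ge x 0 with hx | hx
    · rw [exponentialPDF_of_neg hx, exponentialPDF_of_neg hx]
      simp
    · rw [exponentialPDF_of_nonneg hx, exponentialPDF_of_nonneg hx,
        ← ENNReal.ofReal_mul (by positivity),
        show (2 : ℝ≥0∞) = ENNReal.ofReal 2 by simp, ← ENNReal.ofReal_mul (by norm_num),
        one_mul, ← Real.exp_add, ← mul_assoc]
      congr 1
      rw [mul_one_div_cancel two_ne_zero, one_mul]
      ring_nf
  simp_rw [h2]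
  rw [lintegral_const_mul' _ _ (by simp), lintegral_exponentialPDF_eq_one (by norm_num)]
  simp

/-! ### Convergence of the locations -/

lemma eventually_floor_lt {x y : ℝ} (h : x < y) :
    ∀ᶠ n : ℕ in atTop, ⌊(n + 1 : ℝ) * x⌋ < ⌊(n + 1 : ℝ) * y⌋ := by
  have h1 : Tendsto (fun n : ℕ => (n + 1 : ℝ) * (y - x)) atTop atTop :=
    (tendsto_atTop_add_const_right _ _ tendsto_natCast_atTop_atTop).atTop_mul_const (sub_pos.2 h)
  filter_upwards [h1.eventually_ge_atTop 1] with n hn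
  rw [Int.lt_iff_add_one_le, Int.le_floor]
  push_cast
  have := Int.floor_le ((n + 1 : ℝ) * x)
  nlinarith

lemma floor_mul_le_floor_mul {x y : ℝ} (n : ℕ) (h : x ≤ y) :
    ⌊(n + 1 : ℝ) * x⌋ ≤ ⌊(n + 1 : ℝ) * y⌋ :=
  Int.floor_le_floor (by gcongr)

/-- Ties cause no trouble: monotonicity of the floor settles `x ≤ y` for every `n`, and a strict
inequality is eventually visible on the grid. -/
lemma eventually_floor_le_iff (x y : ℝ) :
    ∀ᶠ n : ℕ in atTop, (⌊(n + 1 : ℝ) * x⌋ ≤ ⌊(n + 1 : ℝ) * y⌋ ↔ x ≤ y) := by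
  rcases le_or_gt x y with h | h
  · exact Eventually.of_forall fun n => iff_of_true (floor_mul_le_floor_mul n h) h
  · filter_upwards [eventually_floor_lt h] with n hn
    exact iff_of_false hn.not_ge h.not_ge

lemma gridEdge_fst (n : ℕ) (p : ℝ × ℝ) : (gridEdge n p).1 = ⌊(n + 1 : ℝ) * min p.1 p.2⌋ := by
  have hm : Monotone fun x : ℝ => ⌊(n + 1 : ℝ) * x⌋ := fun x y h => floor_mul_le_floor_mul n h
  exact (hm.map_min).symm

lemma gridEdge_snd (n : ℕ) (p : ℝ × ℝ) : (gridEdge n p).2 = ⌊(n + 1 : ℝ) * max p.1 p.2⌋ := by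
  have hm : Monotone fun x : ℝ => ⌊(n + 1 : ℝ) * x⌋ := fun x y h => floor_mul_le_floor_mul n h
  exact (hm.map_max).symm

lemma eventually_edgeCompat_iff (U V : ℕ → ℝ) (i j : ℕ) :
    ∀ᶠ n : ℕ in atTop, (EdgeCompat (gridEdge n (U i, V i)) (gridEdge n (U j, V j)) ↔
      Compatible (contEdge U V i) (contEdge U V j)) := by
  filter_upwards [eventually_floor_le_iff (max (U i) (V i)) (min (U j) (V j)),
    eventually_floor_le_iff (max (U j) (V j)) (min (U i) (V i))] with n h1 h2
  simp only [EdgeCompat, Compatible, contEdge, gridEdge_fst, gridEdge_snd, h1, h2]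

lemma eventually_floor_ne {x y : ℝ} (h : x ≠ y) :
    ∀ᶠ n : ℕ in atTop, ⌊(n + 1 : ℝ) * x⌋ ≠ ⌊(n + 1 : ℝ) * y⌋ := by
  rcases lt_or_gt_of_ne h with h | h
  · exact (eventually_floor_lt h).mono fun n hn => hn.ne
  · exact (eventually_floor_lt h).mono fun n hn => hn.ne'

/-- Finitely many distinct points eventually lie in distinct cells. Different left end points
already make the edges different, and coordinates strictly below `1` keep the cells within `{0, …,
n}`. -/
lemma IsGeneric.eventually_mem_gridTuples {W U V : ℕ → ℝ} (h : IsGeneric W U V) (K : ℕ) :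
    ∀ᶠ n : ℕ in atTop, (fun k : Fin (K + 1) => gridEdge n (U k, V k)) ∈ gridTuples K n := by
  obtain ⟨-, hrange, hinj⟩ := h
  have h1 : ∀ᶠ n : ℕ in atTop, ∀ k : Fin (K + 1),
      ⌊(n + 1 : ℝ) * U k⌋ ≠ ⌊(n + 1 : ℝ) * V k⌋ :=
    eventually_all.2 fun k => eventually_floor_ne fun heq => by
      simpa using hinj (a₁ := Sum.inl (k : ℕ)) (a₂ := Sum.inr (k : ℕ)) heq
  have h2 : ∀ᶠ n : ℕ in atTop, ∀ k l : Fin (K + 1), k ≠ l →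
      ⌊(n + 1 : ℝ) * min (U k) (V k)⌋ ≠ ⌊(n + 1 : ℝ) * min (U l) (V l)⌋ := by
    refine eventually_all.2 fun k => eventually_all.2 fun l => ?_
    by_cases hkl : k = l
    · simp [hkl]
    · refine (eventually_floor_ne fun heq => hkl ?_).mono fun n hn _ => hn
      have hkl' : (k : ℕ) = l := by
        rcases min_choice (U k) (V k) with hk | hk <;> rcases min_choice (U l) (V l) with hl | hl <;>
          rw [hk, hl] at heq
        · simpa using hinj (a₁ := Sum.inl (k : ℕ)) (a₂ := Sum.inl (l : ℕ)) heq
        · simpa using hinj (a₁ := Sum.inl (k : ℕ)) (a₂ := Sum.inr (l : ℕ)) heq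
        · simpa using hinj (a₁ := Sum.inr (k : ℕ)) (a₂ := Sum.inl (l : ℕ)) heq
        · simpa using hinj (a₁ := Sum.inr (k : ℕ)) (a₂ := Sum.inr (l : ℕ)) heq
      exact Fin.ext hkl'
  filter_upwards [h1, h2] with n hn1 hn2
  have hlt : ∀ k : Fin (K + 1), (gridEdge n (U k, V k)).1 < (gridEdge n (U k, V k)).2 := fun k => by
    have := hn1 k
    simp only [gridEdge]
    omega
  have hbd : ∀ x : ℝ, 0 ≤ x → x < 1 → 0 ≤ ⌊(n + 1 : ℝ) * x⌋ ∧ ⌊(n + 1 : ℝ) * x⌋ ≤ n := by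
    intro x hx0 hx1
    constructor
    · positivity
    · rw [← Int.lt_add_one_iff, Int.floor_lt]
      push_cast
      nlinarith
  refine ⟨fun k => ⟨gridEdge n (U k, V k), hlt k⟩, mem_tuples.2 ⟨fun k => ?_, fun k l hkl => ?_⟩,
    fun k => rfl⟩
  · have hU := hbd _ (hrange (Sum.inl k)).1 (hrange (Sum.inl k)).2
    have hV := hbd _ (hrange (Sum.inr k)).1 (hrange (Sum.inr k)).2
    simp only [Sum.elim_inl, Sum.elim_inr] at hU hV
    rw [mem_edges]
    simp only [gridEdge]
    omega
  · by_contra hne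
    apply hn2 k l hne
    have := congrArg (fun e : Edge => e.1.1) hkl
    simpa only [gridEdge_fst] using this

/-! ### The maximal weight of finitely many edges -/

/-- The index sets of pairwise compatible edges with indices at least `a`. -/
def blockSets {K : ℕ} (a : ℕ) (c : Fin (K + 1) → Fin (K + 1) → Prop) :
    Finset (Finset (Fin (K + 1))) :=
  open Classical in Finset.univ.filter
    (fun A => (∀ k ∈ A, a ≤ (k : ℕ)) ∧ (A : Set (Fin (K + 1))).Pairwise c)

lemma mem_blockSets {K a : ℕ} {c : Fin (K + 1) → Fin (K + 1) → Prop} {A : Finset (Fin (K + 1))} :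
    A ∈ blockSets a c ↔ (∀ k ∈ A, a ≤ (k : ℕ)) ∧ (A : Set (Fin (K + 1))).Pairwise c := by
  simp [blockSets]

lemma blockSets_nonempty {K : ℕ} (a : ℕ) (c : Fin (K + 1) → Fin (K + 1) → Prop) :
    (blockSets a c).Nonempty := ⟨∅, by simp [mem_blockSets]⟩

/-- The maximal weight of a set of pairwise compatible edges with indices at least `a`. -/
def blockMax {K : ℕ} (a : ℕ) (c : Fin (K + 1) → Fin (K + 1) → Prop) (m : Fin (K + 1) → ℝ) : ℝ :=
  (blockSets a c).sup' (blockSets_nonempty a c) fun A => ∑ k ∈ A, m k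

lemma blockMax_nonneg {K a : ℕ} {c : Fin (K + 1) → Fin (K + 1) → Prop} {m : Fin (K + 1) → ℝ} :
    0 ≤ blockMax a c m := by
  have : (∅ : Finset (Fin (K + 1))) ∈ blockSets a c := by simp [mem_blockSets]
  have := Finset.le_sup' (fun A => ∑ k ∈ A, m k) this
  rw [Finset.sum_empty] at this
  exact this

lemma continuous_blockMax {K : ℕ} (a : ℕ) (c : Fin (K + 1) → Fin (K + 1) → Prop) :
    Continuous (blockMax a c) := by
  unfold blockMax
  exact Continuous.finset_sup'_apply _ fun A _ => by fun_prop

/-! ### The limit of the truncated passage times -/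

section

variable {Ω : Type*} [MeasurableSpace Ω] {P : Measure Ω} {W U V : ℕ → Ω → ℝ}
variable {Ω' : Type*} [MeasurableSpace Ω'] {Q : Measure Ω'} {u : Edge → Ω' → ℝ}

lemma contWeight_eq_partialSums {s : ℝ} {W : ℕ → ℝ} {K : ℕ} (k : Fin (K + 1)) :
    contWeight s W k = partialSums (fun k : Fin (K + 1) => W k) k ^ (-1 / s) := by
  rw [contWeight, partialSums]
  congr 1
  symm
  refine Finset.sum_bij (fun (j : Fin (K + 1)) _ => (j : ℕ)) ?_ ?_ ?_ ?_
  · intro j hj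
    simp only [Finset.mem_Iic, Fin.le_def] at hj
    simp only [Finset.mem_range]
    omega
  · intro i _ j _ hij
    exact Fin.ext hij
  · intro j hj
    simp only [Finset.mem_range] at hj
    exact ⟨⟨j, by omega⟩, by simp only [Finset.mem_Iic, Fin.le_def]; omega, rfl⟩
  · intro j _
    rfl

/-- The truncated continuous passage time, for the indices `a, …, K`. -/
def contBlock (s : ℝ) (a K : ℕ) (W U V : ℕ → ℝ) : ℝ :=
  blockMax (K := K) a (fun i j => Compatible (contEdge U V i) (contEdge U V j))
    (fun k => contWeight s W k)

/-- The truncated discrete passage time of a tuple of edges, for the indices `a, …, K`. -/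
def discBlock {K : ℕ} (a : ℕ) (H : ℝ → ℝ) (l : Fin (K + 1) → ℤ × ℤ) (x : Fin (K + 1) → ℝ) : ℝ :=
  blockMax a (fun i j => EdgeCompat (l i) (l j)) (fun k => H (x k))

lemma measurable_discBlock {K : ℕ} (a : ℕ) {H : ℝ → ℝ} (hH : Measurable H)
    (l : Fin (K + 1) → ℤ × ℤ) : Measurable (discBlock a H l) := by
  unfold discBlock
  exact (continuous_blockMax a _).measurable.comp (by fun_prop)

/-- Finitely many compatibility relations are eventually frozen at their limiting values. What
remains is a fixed maximum of finite sums, continuous in the weights. -/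
lemma IsGeneric.tendsto_discBlock {s : ℝ} {W U V : ℕ → ℝ} (h : IsGeneric W U V) {H : ℕ → ℝ → ℝ}
    (hH : ∀ y, 0 < y → Tendsto (fun n => H n y) atTop (𝓝 (y ^ (-1 / s)))) (a K : ℕ) :
    Tendsto (fun n => discBlock a (H n) (fun k : Fin (K + 1) => gridEdge n (U k, V k))
      (partialSums fun k => W k)) atTop (𝓝 (contBlock s a K W U V)) := by
  have h1 : ∀ᶠ n : ℕ in atTop, ∀ i j : Fin (K + 1),
      (EdgeCompat (gridEdge n (U i, V i)) (gridEdge n (U j, V j)) ↔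
      Compatible (contEdge U V i) (contEdge U V j)) :=
    eventually_all.2 fun i => eventually_all.2 fun j => eventually_edgeCompat_iff U V i j
  have h2 : Tendsto (fun n => fun k : Fin (K + 1) => H n (partialSums (fun k => W k) k)) atTop
      (𝓝 fun k => contWeight s W k) := by
    refine tendsto_pi_nhds.2 fun k => ?_
    rw [contWeight_eq_partialSums]
    exact hH _ (partialSums_pos (fun i => h.1 i) k)
  have h3 := ((continuous_blockMax (K := K) a
    (fun i j : Fin (K + 1) => Compatible (contEdge U V i) (contEdge U V j))).tendsto _).comp h2
  refine h3.congr' ?_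
  filter_upwards [h1] with n hn
  have : (fun i j : Fin (K + 1) => EdgeCompat (gridEdge n (U i, V i)) (gridEdge n (U j, V j)))
      = fun i j : Fin (K + 1) => Compatible (contEdge U V i) (contEdge U V j) := by
    ext i j
    exact hn i j
  simp only [discBlock, Function.comp_apply, this]

lemma tendsto_sum_lintegral_isTop (hu : IsUniformField Q u) (h : IsContinuousModelInput P W U V)
    {s : ℝ} {H : ℕ → ℝ → ℝ} (hHm : ∀ n, Measurable (H n))
    (hH : ∀ y, 0 < y → Tendsto (fun n => H n y) atTop (𝓝 (y ^ (-1 / s)))) (a K : ℕ)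
    {f : ℝ → ℝ≥0∞} (hf : Continuous f) {B : ℝ≥0∞} (hB : B ≠ ∞) (hfB : ∀ x, f x ≤ B) :
    Tendsto (fun n => ∑ e ∈ tuples K n, ∫⁻ ω, {ω | IsTop n e (u · ω)}.indicator
        (fun ω => f (discBlock a (H n) (fun k => (e k).1) fun k => numEdges n * u (e k) ω)) ω ∂Q)
      atTop (𝓝 (∫⁻ ω, f (contBlock s a K (W · ω) (U · ω) (V · ω)) ∂P)) := by
  have hlaw := h.hasLaw K
  have hmain : Tendsto (fun n : ℕ => ∫⁻ ω, (gridTuples K n).indicator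
      (fun l => densityRatio K n (fun k => W k ω) *
          f (discBlock a (H n) l (partialSums fun k => W k ω)))
          (fun k => gridEdge n (U k ω, V k ω)) ∂P) atTop
      (𝓝 (∫⁻ ω, f (contBlock s a K (W · ω) (U · ω) (V · ω)) ∂P)) := by
    refine tendsto_lintegral_filter_of_dominated_convergence'
      (fun ω => ENNReal.ofReal (Real.exp (partialSums (fun k : Fin (K + 1) => W k ω)
        (Fin.last K) / 2)) * B) (Eventually.of_forall fun n => ?_) ?_ ?_ ?_
    · have hΦ : ∀ l : Fin (K + 1) → ℤ × ℤ, Measurable fun x => f (discBlock a (H n) l x) :=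
        fun l => hf.measurable.comp (measurable_discBlock a (hHm n) l)
      have hm := measurable_indicator_gridTuples K n (fun l x => f (discBlock a (H n) l x)) hΦ
      have := hm.comp_aemeasurable hlaw.aemeasurable
      exact this
    · filter_upwards [tendsto_card_edges.eventually_ge_atTop (2 * (K + 1))] with n hn
      filter_upwards [h.ae_isGeneric] with ω hω
      refine Set.indicator_apply_le' (fun _ => ?_) fun _ => zero_le
      gcongr
      · exact densityRatio_le hn (partialSums_pos (fun i => hω.1 i) _).le
      · exact hfB _
    · rw [lintegral_mul_const' _ _ hB]
      refine ENNReal.mul_ne_top ?_ hB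
      have hm : Measurable fun p : (Fin (K + 1) → ℝ) × (Fin (K + 1) → ℝ × ℝ) =>
          ENNReal.ofReal (Real.exp (partialSums p.1 (Fin.last K) / 2)) := by
        have := measurable_partialSums_apply (Fin.last K)
        have h1 : Measurable fun w : Fin (K + 1) → ℝ =>
            ENNReal.ofReal (Real.exp (partialSums w (Fin.last K) / 2)) := by fun_prop
        exact h1.comp measurable_fst
      have h2 := lintegral_map' (μ := P) hm.aemeasurable hlaw.aemeasurable
      rw [hlaw.map_eq, lintegral_prod _ hm.aemeasurable] at h2
      simp only [lintegral_const, measure_univ, mul_one] at h2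
      rw [← h2]
      exact lintegral_exp_half_partialSums K
    · filter_upwards [h.ae_isGeneric] with ω hω
      have h1 := ((hf.tendsto _).comp (hω.tendsto_discBlock hH a K))
      have h2 := ENNReal.Tendsto.mul (tendsto_densityRatio fun k : Fin (K + 1) => W k ω)
        (Or.inl one_ne_zero) h1 (Or.inr ENNReal.one_ne_top)
      rw [one_mul] at h2
      refine h2.congr' ?_
      filter_upwards [hω.eventually_mem_gridTuples K] with n hn
      rw [Set.indicator_of_mem hn]
      rfl
  have hc : Tendsto (fun n : ℕ => ENNReal.ofReal (((n + 1 : ℝ) / n) ^ (K + 1))) atTop (𝓝 1) := by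
    have h1 : Tendsto (fun n : ℕ => (n + 1 : ℝ) / n) atTop (𝓝 1) := by
      have h2 : Tendsto (fun n : ℕ => 1 + 1 / (n : ℝ)) atTop (𝓝 (1 + 0)) :=
        tendsto_const_nhds.add tendsto_one_div_atTop_nhds_zero_nat
      rw [add_zero] at h2
      refine h2.congr' ?_
      filter_upwards [eventually_gt_atTop 0] with n hn
      have : (n : ℝ) ≠ 0 := by exact_mod_cast hn.ne'
      field_simp
    simpa using ENNReal.tendsto_ofReal (h1.pow (K + 1))
  have := ENNReal.Tendsto.mul hc (Or.inl one_ne_zero) hmain (Or.inr ENNReal.one_ne_top)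
  rw [one_mul] at this
  refine this.congr' ?_
  filter_upwards [eventually_ge_atTop 1] with n hn
  exact (sum_lintegral_isTop hu h hn (fun l x => f (discBlock a (H n) l x))
    fun l => hf.measurable.comp (measurable_discBlock a (hHm n) l)).symm

end

/-! ### Regular variation of the tail quantile function -/

/-- The tail quantile function `u ↦ F⁽⁻¹⁾(1 - u)` on `(0, ∞)`, extended by zero. -/
def tailQuantile (F : ℝ → ℝ) (u : ℝ) : ℝ := if 0 < u then generalizedInverse F (1 - u) else 0

/-- If the tail vanished somewhere, the ratio at `t = 1` would be `0 / 0 = 0` from there on, while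
its limit must be `1`. -/
lemma RegularlyVaryingTail.cdf_lt_one {ν : Measure ℝ} {s : ℝ}
    (h : RegularlyVaryingTail (cdf ν) s) (x : ℝ) : cdf ν x < 1 := by
  refine lt_of_le_of_ne (cdf_le_one ν x) fun heq => ?_
  have h1 := h 1 one_pos
  rw [Real.one_rpow] at h1
  have h2 : ∀ᶠ y in atTop, (1 - cdf ν (1 * y)) / (1 - cdf ν y) = 0 := by
    filter_upwards [eventually_ge_atTop x] with y hy
    have : cdf ν y = 1 := le_antisymm (cdf_le_one ν y) (heq ▸ monotone_cdf ν hy)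
    simp [this]
  exact zero_ne_one (tendsto_nhds_unique (tendsto_const_nhds.congr' (h2.mono fun _ h => h.symm)) h1)

section

variable {ν : Measure ℝ} [IsProbabilityMeasure ν]

lemma cdf_eq_zero_of_neg (hν : ∀ᵐ x ∂ν, 0 < x) {x : ℝ} (hx : x ≤ 0) : cdf ν x = 0 := by
  rw [cdf_eq_real, measureReal_def]
  have : ν (Set.Iic x) = 0 := by
    refine measure_mono_null (fun y hy => ?_) hν
    simp only [Set.mem_Iic, Set.mem_compl_iff, Set.mem_ofPred_eq, not_lt] at hy ⊢
    exact hy.trans hx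
  simp [this]

/-- The tail quantile function is the generalized inverse of the tail. -/
lemma lt_tailQuantile_iff (hν : ∀ᵐ x ∂ν, 0 < x) {u x : ℝ} (hu : 0 < u) (hx : 0 ≤ x) :
    x < tailQuantile (cdf ν) u ↔ u < 1 - cdf ν x := by
  rw [tailQuantile, if_pos hu, generalizedInverse]
  rcases le_or_gt 1 u with h1 | h1
  · have huniv : {x : ℝ | 1 - u ≤ cdf ν x} = Set.univ := by
      ext y
      simp only [Set.mem_ofPred_eq, Set.mem_univ, iff_true]
      linarith [cdf_nonneg ν y]
    rw [huniv, Real.sInf_univ]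
    constructor
    · intro h; linarith
    · intro h; linarith [cdf_nonneg ν x]
  · have hne : {x : ℝ | 1 - u ≤ cdf ν x}.Nonempty := by
      have := (tendsto_cdf_atTop ν).eventually (eventually_ge_nhds (by linarith : 1 - u < 1))
      exact this.exists
    have hbdd : BddBelow {x : ℝ | 1 - u ≤ cdf ν x} := by
      refine ⟨0, fun y hy => ?_⟩
      by_contra hy0
      have h2 := cdf_eq_zero_of_neg hν (le_of_lt (not_le.1 hy0))
      simp only [Set.mem_ofPred_eq, h2] at hy
      linarith
    constructor
    · intro h
      by_contra hle
      have : sInf {x : ℝ | 1 - u ≤ cdf ν x} ≤ x := csInf_le hbdd (by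
        simp only [Set.mem_ofPred_eq]; linarith)
      linarith
    · intro h
      have hr : Tendsto (cdf ν) (𝓝[>] x) (𝓝 (cdf ν x)) :=
        ((cdf ν).right_continuous x).mono_left (nhdsWithin_mono _ Set.Ioi_subset_Ici_self)
      have hev := hr.eventually (eventually_lt_nhds (by linarith : cdf ν x < 1 - u))
      obtain ⟨y, hy, hxy⟩ := (hev.and self_mem_nhdsWithin).exists
      refine lt_of_lt_of_le hxy (le_csInf hne fun z hz => ?_)
      by_contra hzy
      have h2 := (monotone_cdf ν) (le_of_lt (not_le.1 hzy))
      simp only [Set.mem_ofPred_eq] at hz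
      linarith

lemma tailQuantile_nonneg (hν : ∀ᵐ x ∂ν, 0 < x) (u : ℝ) : 0 ≤ tailQuantile (cdf ν) u := by
  rcases le_or_gt u 0 with hu | hu
  · rw [tailQuantile, if_neg hu.not_gt]
  · by_contra h
    have h1 := not_le.1 h
    rw [tailQuantile, if_pos hu, generalizedInverse] at h1
    rcases le_or_gt 1 u with h2 | h2
    · have huniv : {x : ℝ | 1 - u ≤ cdf ν x} = Set.univ := by
        ext y
        simp only [Set.mem_ofPred_eq, Set.mem_univ, iff_true]
        linarith [cdf_nonneg ν y]
      rw [huniv, Real.sInf_univ] at h1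
      exact lt_irrefl _ h1
    · refine absurd h1 (Real.sInf_nonneg fun y hy => ?_).not_gt
      by_contra hy0
      have h3 := cdf_eq_zero_of_neg hν (le_of_lt (not_le.1 hy0))
      simp only [Set.mem_ofPred_eq, h3] at hy
      linarith

lemma tailQuantile_antitone (hν : ∀ᵐ x ∂ν, 0 < x) {u u' : ℝ} (hu : 0 < u) (h : u ≤ u') :
    tailQuantile (cdf ν) u' ≤ tailQuantile (cdf ν) u := by
  by_contra hlt
  have h0 := tailQuantile_nonneg hν u
  have h1 := (lt_tailQuantile_iff hν (hu.trans_le h) h0).1 (not_le.1 hlt)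
  exact lt_irrefl _ ((lt_tailQuantile_iff hν hu h0).2 (h.trans_lt h1))

lemma tailQuantile_eq_zero (hν : ∀ᵐ x ∂ν, 0 < x) {u : ℝ} (hu : 1 ≤ u) :
    tailQuantile (cdf ν) u = 0 := by
  refine le_antisymm (not_lt.1 fun h => ?_) (tailQuantile_nonneg hν u)
  have := (lt_tailQuantile_iff hν (by linarith) le_rfl).1 h
  linarith [cdf_nonneg ν 0]

lemma measurable_tailQuantile (hν : ∀ᵐ x ∂ν, 0 < x) : Measurable (tailQuantile (cdf ν)) := by
  refine measurable_of_Ioi fun x => ?_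
  rcases lt_or_ge x 0 with hx | hx
  · have : tailQuantile (cdf ν) ⁻¹' Set.Ioi x = Set.univ := by
      ext u
      simpa using hx.trans_le (tailQuantile_nonneg hν u)
    rw [this]; exact MeasurableSet.univ
  · have : tailQuantile (cdf ν) ⁻¹' Set.Ioi x = Set.Ioo 0 (1 - cdf ν x) := by
      ext u
      simp only [Set.mem_preimage, Set.mem_Ioi, Set.mem_Ioo]
      rcases le_or_gt u 0 with hu | hu
      · rw [tailQuantile, if_neg hu.not_gt]
        exact iff_of_false hx.not_gt fun h => hu.not_gt h.1
      · rw [lt_tailQuantile_iff hν hu hx]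
        exact ⟨fun h => ⟨hu, h⟩, fun h => h.2⟩
    rw [this]; exact measurableSet_Ioo

/-- The tail quantile of a uniform variable has law `ν`. -/
lemma map_tailQuantile (hν : ∀ᵐ x ∂ν, 0 < x) : uniformLaw.map (tailQuantile (cdf ν)) = ν := by
  have hm := measurable_tailQuantile hν
  have : IsProbabilityMeasure (uniformLaw.map (tailQuantile (cdf ν))) :=
    Measure.isProbabilityMeasure_map hm.aemeasurable
  refine Measure.ext_of_Iic _ _ fun x => ?_
  rw [Measure.map_apply hm measurableSet_Iic, ← ofReal_cdf ν x]
  rcases lt_or_ge x 0 with hx | hx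
  · rw [cdf_eq_zero_of_neg hν hx.le]
    have : tailQuantile (cdf ν) ⁻¹' Set.Iic x = ∅ := by
      ext u
      simpa using hx.trans_le (tailQuantile_nonneg hν u)
    rw [this]; simp
  · have h1 : tailQuantile (cdf ν) ⁻¹' Set.Iic x = (Set.Ioo 0 (1 - cdf ν x))ᶜ := by
      ext u
      simp only [Set.mem_preimage, Set.mem_Iic, Set.mem_compl_iff, Set.mem_Ioo, not_and_or]
      rcases le_or_gt u 0 with hu | hu
      · rw [tailQuantile, if_neg hu.not_gt]
        exact iff_of_true hx (Or.inl hu.not_gt)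
      · rw [← not_lt, lt_tailQuantile_iff hν hu hx]
        exact ⟨fun h => Or.inr h, fun h => h.resolve_left (not_not.2 hu)⟩
    rw [h1, prob_compl_eq_one_sub measurableSet_Ioo, Measure.restrict_apply measurableSet_Ioo,
      Set.inter_eq_left.2, Real.volume_Ioo, sub_zero, ← ENNReal.ofReal_one,
      ← ENNReal.ofReal_sub _ (by linarith [cdf_le_one ν x])]
    · congr 1; ring
    · intro u hu
      exact ⟨hu.1.le, by linarith [hu.2, cdf_nonneg ν x]⟩

variable {s : ℝ}

lemma tendsto_tailQuantile (hν : ∀ᵐ x ∂ν, 0 < x) (h : RegularlyVaryingTail (cdf ν) s) :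
    Tendsto (tailQuantile (cdf ν)) (𝓝[>] 0) atTop := by
  rw [tendsto_atTop]
  intro x
  have hpos : 0 < 1 - cdf ν (max x 0) := by linarith [h.cdf_lt_one (max x 0)]
  filter_upwards [Ioo_mem_nhdsGT hpos] with u hu
  exact (le_max_left x 0).trans
    ((lt_tailQuantile_iff hν hu.1 (le_max_right x 0)).2 hu.2).le

lemma rpow_neg_inv_rpow_neg (hs : 0 < s) {y : ℝ} (hy : 0 < y) :
    (y ^ (-1 / s)) ^ (-s) = y := by
  rw [← Real.rpow_mul hy.le]
  have : -1 / s * -s = 1 := by field_simp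
  rw [this, Real.rpow_one]

/-- The tail quantile function is regularly varying at zero. -/
lemma tendsto_tailQuantile_ratio (hν : ∀ᵐ x ∂ν, 0 < x) (hs : 0 < s)
    (h : RegularlyVaryingTail (cdf ν) s) {y : ℝ} (hy : 0 < y) :
    Tendsto (fun u => tailQuantile (cdf ν) (y * u) / tailQuantile (cdf ν) u) (𝓝[>] 0)
      (𝓝 (y ^ (-1 / s))) := by
  have htop := tendsto_tailQuantile hν h
  have hpos : ∀ᶠ u in 𝓝[>] (0 : ℝ), 0 < tailQuantile (cdf ν) u := htop.eventually_gt_atTop 0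
  have hmem : ∀ᶠ u in 𝓝[>] (0 : ℝ), 0 < u := self_mem_nhdsWithin
  have hy' : 0 < y ^ (-1 / s) := Real.rpow_pos_of_pos hy _
  have hS : ∀ x, 0 < 1 - cdf ν x := fun x => by linarith [h.cdf_lt_one x]
  refine tendsto_order.2 ⟨fun t ht => ?_, fun t ht => ?_⟩
  · rcases le_or_gt t 0 with ht0 | ht0
    · have hpos2 : ∀ᶠ u in 𝓝[>] (0 : ℝ), 0 < tailQuantile (cdf ν) (y * u) := by
        refine (htop.comp ?_).eventually_gt_atTop 0
        refine tendsto_nhdsWithin_iff.2 ⟨?_, hmem.mono fun u hu => mul_pos hy hu⟩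
        have : Tendsto (fun u : ℝ => y * u) (𝓝 0) (𝓝 (y * 0)) := tendsto_id.const_mul y
        rw [mul_zero] at this
        exact this.mono_left nhdsWithin_le_nhds
      filter_upwards [hpos, hpos2] with u h1 h2
      exact ht0.trans_lt (div_pos h2 h1)
    · obtain ⟨t', ht1, ht2⟩ := exists_between ht
      have ht'0 : 0 < t' := ht0.trans ht1
      have hyt : y < t' ^ (-s) := by
        rw [← rpow_neg_inv_rpow_neg hs hy]
        exact Real.rpow_lt_rpow_of_neg ht'0 ht2 (by linarith)
      have hev := (h t' ht'0).eventually (eventually_gt_nhds hyt)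
      -- Writing `G` for the tail quantile, regular variation is used at `x = (t / t') G(u)`,
      -- slightly below `G(u)`. Then `u < 1 - F x` and `y (1 - F x) < 1 - F (t' x)` give `y u < 1 -
      -- F (t' x)`, that is, `t G(u) = t' x < G(y u)`.
      have htop2 : Tendsto (fun u => t / t' * tailQuantile (cdf ν) u) (𝓝[>] 0) atTop :=
        htop.const_mul_atTop (by positivity)
      filter_upwards [hpos, hmem, htop2.eventually hev] with u hGu hu hx
      set x := t / t' * tailQuantile (cdf ν) u with hxdef
      have hx0 : 0 ≤ x := by positivity
      have hxlt : x < tailQuantile (cdf ν) u := by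
        rw [hxdef]
        exact mul_lt_of_lt_one_left hGu ((div_lt_one ht'0).2 ht1)
      have h1 := (lt_tailQuantile_iff hν hu hx0).1 hxlt
      have h2 : y * (1 - cdf ν x) < 1 - cdf ν (t' * x) := (lt_div_iff₀ (hS x)).1 hx
      have h3 : y * u < 1 - cdf ν (t' * x) := lt_trans (mul_lt_mul_of_pos_left h1 hy) h2
      have h4 := (lt_tailQuantile_iff hν (mul_pos hy hu) (by positivity)).2 h3
      have h5 : t' * x = t * tailQuantile (cdf ν) u := by
        rw [hxdef]
        field_simp
      rw [h5] at h4
      exact (lt_div_iff₀ hGu).2 h4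
  · obtain ⟨t', ht1, ht2⟩ := exists_between ht
    have ht'0 : 0 < t' := hy'.trans ht1
    have hyt : t' ^ (-s) < y := by
      conv_rhs => rw [← rpow_neg_inv_rpow_neg hs hy]
      exact Real.rpow_lt_rpow_of_neg hy' ht1 (by linarith)
    have hev := (h t' ht'0).eventually (eventually_lt_nhds hyt)
    -- For the upper bound regular variation is used at `G(u)` itself, where `1 - F (G(u)) ≤ u`.
    filter_upwards [hpos, hmem, htop.eventually hev] with u hGu hu hx
    rw [div_lt_iff₀ hGu]
    refine lt_of_le_of_lt ?_ (mul_lt_mul_of_pos_right ht2 hGu)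
    by_contra hlt
    have h1 := (lt_tailQuantile_iff hν (mul_pos hy hu) (by positivity)).1 (not_le.1 hlt)
    have h2 := (div_lt_iff₀ (hS _)).1 hx
    have h3 : 1 - cdf ν (tailQuantile (cdf ν) u) ≤ u := by
      by_contra hlt'
      exact lt_irrefl _ ((lt_tailQuantile_iff hν hu hGu.le).2 (not_le.1 hlt'))
    have h4 := mul_le_mul_of_nonneg_left h3 hy.le
    linarith

end

/-- A uniform upper bound on dyadic ratios of a regularly varying function. -/
lemma dyadic_ratio_le {G : ℝ → ℝ} (hG0 : ∀ u, 0 ≤ G u) (hGanti : ∀ u u', 0 < u → u ≤ u' → G u' ≤ G u)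
    (hG1 : ∀ u, 1 ≤ u → G u = 0) {r u₀ : ℝ} (hr0 : 0 < r) (hr1 : r ≤ 1) (hu₀ : 0 < u₀)
    (hG2 : ∀ u, 0 < u → u ≤ u₀ → G (2 * u) ≤ r * G u) :
    ∃ C, 0 ≤ C ∧ ∀ j : ℕ, ∀ u, 0 < u → u ≤ u₀ → G (2 ^ j * u) ≤ C * r ^ j * G u := by
  -- About `m` doublings lead from `u₀` past `1`, where `G` vanishes. On this range `hG2` is
  -- unavailable, and the constant `r⁻¹ ^ (m + 1)` absorbs the missing contraction.
  obtain ⟨m, hm⟩ := pow_unbounded_of_one_lt (1 / u₀) (one_lt_two (α := ℝ))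
  have hC1 : 1 ≤ r⁻¹ ^ (m + 1) := one_le_pow₀ ((one_le_inv₀ hr0).2 hr1)
  refine ⟨r⁻¹ ^ (m + 1), by positivity, fun j => ?_⟩
  induction j with
  | zero =>
    intro u hu hu'
    simp only [pow_zero, one_mul, mul_one]
    exact le_mul_of_one_le_left (hG0 u) hC1
  | succ j ih =>
    intro u hu hu'
    have hassoc : (2 : ℝ) ^ (j + 1) * u = 2 ^ j * (2 * u) := by ring
    rcases le_or_gt (2 * u) u₀ with h2 | h2
    · calc G (2 ^ (j + 1) * u) = G (2 ^ j * (2 * u)) := by rw [hassoc]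
        _ ≤ r⁻¹ ^ (m + 1) * r ^ j * G (2 * u) := ih (2 * u) (by positivity) h2
        _ ≤ r⁻¹ ^ (m + 1) * r ^ j * (r * G u) := by gcongr; exact hG2 u hu hu'
        _ = _ := by ring
    -- Once `2 u > u₀`, either the argument has reached `1`, or `j ≤ m` and monotonicity of `G` is
    -- enough.
    · rcases le_or_gt 1 ((2 : ℝ) ^ (j + 1) * u) with h1 | h1
      · rw [hG1 _ h1]
        have := hG0 u
        positivity
      · have hjm : j + 1 ≤ m + 1 := by
          by_contra hcon
          have hmj : m ≤ j := by omega
          have h3 : (2 : ℝ) ^ m ≤ 2 ^ j := pow_le_pow_right₀ (by norm_num) hmj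
          have h4 : 1 < 2 ^ m * u₀ := (div_lt_iff₀ hu₀).1 hm
          have h5 : (2 : ℝ) ^ j * u₀ < 2 ^ j * (2 * u) := by gcongr
          rw [← hassoc] at h5
          have h6 : (2 : ℝ) ^ m * u₀ ≤ 2 ^ j * u₀ := by gcongr
          linarith
        have h7 : 1 ≤ r⁻¹ ^ (m + 1) * r ^ (j + 1) := by
          rw [inv_pow, ← div_eq_inv_mul, one_le_div (by positivity)]
          exact pow_le_pow_of_le_one hr0.le hr1 hjm
        calc G (2 ^ (j + 1) * u) ≤ G u := hGanti _ _ hu (by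
              have : (1 : ℝ) ≤ 2 ^ (j + 1) := one_le_pow₀ (by norm_num)
              nlinarith)
          _ ≤ _ := le_mul_of_one_le_left (hG0 u) h7

/-! ### Truncation of the discrete passage time -/

section Deterministic

variable {C r : ℝ} {J a K n : ℕ} {ξ : Edge → ℝ} {e : Fin (K + 1) → Edge} {H : ℝ → ℝ}

/-- Every edge of `A` has at least `a + 1` edges with marks no larger than its own. If at most `a`
marks lie below `2 ^ J / N`, all of `A` is above that level and `tailSum` bounds its weight.
Otherwise the quotient `lowCount / a` already dominates `1`. -/
lemma min_one_sum_le_truncError (hn : 1 ≤ n) (he : e ∈ tuples K n)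
    (hH : ∀ (j : ℕ) y, 2 ^ j < y → H y ≤ C * r ^ j) {A : Finset Edge} (hA : A ∈ compatSets n)
    (hAe : ∀ x ∈ A, ∃ k : Fin (K + 1), a ≤ k ∧ ∀ i ≤ k, ξ (e i) ≤ ξ x) :
    min 1 (∑ x ∈ A, ENNReal.ofReal (H (numEdges n * ξ x))) ≤ truncError C r J a n ξ := by
  classical
  rw [mem_tuples] at he
  have hN := numEdges_pos hn
  by_cases hlow : lowCount J n ξ ≤ a
  · refine (min_le_right _ _).trans (le_trans ?_ le_add_self)
    refine sum_le_tailSum hn (h := fun x => H (numEdges n * ξ x)) hA (fun x hx => ?_)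
      fun x _ j hj => hH j _ hj
    by_contra hle
    obtain ⟨k, hak, hk⟩ := hAe x hx
    have hsub : (Finset.Iic k).image e ⊆
        (edges n).filter (fun y => ξ y ≤ 2 ^ J / numEdges n) := by
      intro y hy
      obtain ⟨i, hi, rfl⟩ := Finset.mem_image.1 hy
      refine Finset.mem_filter.2 ⟨he.1 i, (hk i (Finset.mem_Iic.1 hi)).trans ?_⟩
      rw [le_div_iff₀ hN, mul_comm]
      exact not_lt.1 hle
    have hcard := Finset.card_le_card hsub
    rw [Finset.card_image_of_injective _ he.2, Fin.card_Iic] at hcard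
    have : lowCount J n ξ = ((edges n).filter (fun y => ξ y ≤ 2 ^ J / numEdges n)).card := rfl
    omega
  · refine (min_le_left _ _).trans (le_trans ?_ le_self_add)
    have h1 : (a : ℝ≥0∞) ≤ lowCount J n ξ := by exact_mod_cast (not_le.1 hlow).le
    have h2 : (lowCount J n ξ : ℝ≥0∞) ≠ 0 := by
      have : lowCount J n ξ ≠ 0 := by omega
      exact_mod_cast this
    rw [ENNReal.le_div_iff_mul_le (Or.inr h2) (Or.inl (ENNReal.natCast_ne_top a)), one_mul]
    exact h1

lemma discBlock_image_mem (he : e ∈ tuples K n) {A : Finset (Fin (K + 1))}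
    (hA : A ∈ blockSets a fun i j => EdgeCompat (e i).1 (e j).1) :
    A.map ⟨e, (mem_tuples.1 he).2⟩ ∈ compatSets n := by
  rw [mem_blockSets] at hA
  rw [mem_compatSets]
  constructor
  · intro x hx
    obtain ⟨k, -, rfl⟩ := Finset.mem_map.1 hx
    exact (mem_tuples.1 he).1 k
  · intro x hx y hy hxy
    obtain ⟨i, hi, rfl⟩ := Finset.mem_map.1 (Finset.mem_coe.1 hx)
    obtain ⟨j, hj, rfl⟩ := Finset.mem_map.1 (Finset.mem_coe.1 hy)
    exact hA.2 hi hj fun hij => hxy (by rw [hij])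

lemma exists_discBlock_eq (he : e ∈ tuples K n) (a : ℕ) (H : ℝ → ℝ) (ξ : Edge → ℝ) :
    ∃ A ∈ compatSets n, (∀ x ∈ A, ∃ k : Fin (K + 1), a ≤ k ∧ x = e k) ∧
      discBlock a H (fun k => (e k).1) (fun k => numEdges n * ξ (e k))
        = ∑ x ∈ A, H (numEdges n * ξ x) := by
  obtain ⟨A, hA, hmax⟩ := Finset.exists_mem_eq_sup' (blockSets_nonempty a
    fun i j => EdgeCompat (e i).1 (e j).1) fun A => ∑ k ∈ A, H (numEdges n * ξ (e k))
  refine ⟨A.map ⟨e, (mem_tuples.1 he).2⟩, discBlock_image_mem he hA, ?_, ?_⟩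
  · intro x hx
    obtain ⟨k, hk, rfl⟩ := Finset.mem_map.1 hx
    exact ⟨k, (mem_blockSets.1 hA).1 k hk, rfl⟩
  · rw [Finset.sum_map]
    exact hmax

lemma min_one_discBlock_le (hn : 1 ≤ n) (he : e ∈ tuples K n) (ht : IsTop n e ξ)
    (hH0 : ∀ y, 0 ≤ H y) (hH : ∀ (j : ℕ) y, 2 ^ j < y → H y ≤ C * r ^ j) :
    min 1 (ENNReal.ofReal
      (discBlock a H (fun k => (e k).1) fun k => numEdges n * ξ (e k)))
      ≤ truncError C r J a n ξ := by
  obtain ⟨A, hA, hAe, hsum⟩ := exists_discBlock_eq he a H ξ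
  rw [hsum, ENNReal.ofReal_sum_of_nonneg fun x _ => hH0 _]
  refine min_one_sum_le_truncError hn he hH hA fun x hx => ?_
  obtain ⟨k, hk, rfl⟩ := hAe x hx
  exact ⟨k, hk, fun i hi => ht.1.monotone hi⟩

lemma discBlock_le_passageTime (he : e ∈ tuples K n) (hH0 : ∀ y, 0 ≤ H y) :
    discBlock 0 H (fun k => (e k).1) (fun k => numEdges n * ξ (e k))
      ≤ passageTime (fun x => H (numEdges n * ξ x)) 0 n := by
  obtain ⟨A, hA, -, hsum⟩ := exists_discBlock_eq he 0 H ξ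
  rw [hsum]
  exact sum_le_passageTime (fun _ => hH0 _) hA

/-- Split an optimal set: its edges among the top ones compete in `discBlock`, and the remaining
edges all have larger marks than the top ones, so they only contribute a truncation error. -/
lemma min_one_passageTime_sub_le (hn : 1 ≤ n) (he : e ∈ tuples K n) (ht : IsTop n e ξ)
    (hH0 : ∀ y, 0 ≤ H y) (hH : ∀ (j : ℕ) y, 2 ^ j < y → H y ≤ C * r ^ j) :
    min 1 (ENNReal.ofReal (passageTime (fun x => H (numEdges n * ξ x)) 0 n -
      discBlock 0 H (fun k => (e k).1) fun k => numEdges n * ξ (e k)))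
      ≤ truncError C r J K n ξ := by
  classical
  obtain ⟨A, hA, hAeq⟩ := exists_passageTime_eq (v := fun x => H (numEdges n * ξ x))
    (fun _ => hH0 _) n
  let A' := A.filter (fun x => x ∉ Set.range e)
  let B := (Finset.univ : Finset (Fin (K + 1))).filter (fun k => e k ∈ A)
  have hB : B ∈ blockSets 0 fun i j => EdgeCompat (e i).1 (e j).1 := by
    rw [mem_blockSets]
    refine ⟨fun _ _ => Nat.zero_le _, fun i hi j hj hij => ?_⟩
    exact (mem_compatSets.1 hA).2 (Finset.mem_filter.1 hi).2 (Finset.mem_filter.1 hj).2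
      fun h => hij ((mem_tuples.1 he).2 h)
  have h1 : ∑ x ∈ A.filter (fun x => x ∈ Set.range e), H (numEdges n * ξ x)
      ≤ discBlock 0 H (fun k => (e k).1) fun k => numEdges n * ξ (e k) := by
    have h2 : A.filter (fun x => x ∈ Set.range e) = B.map ⟨e, (mem_tuples.1 he).2⟩ := by
      ext x
      simp only [Finset.mem_filter, Finset.mem_map, B, Finset.mem_univ, true_and,
        Function.Embedding.coeFn_mk, Set.mem_range]
      constructor
      · rintro ⟨hx, k, rfl⟩; exact ⟨k, hx, rfl⟩
      · rintro ⟨k, hk, rfl⟩; exact ⟨hk, k, rfl⟩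
    rw [h2, Finset.sum_map]
    exact Finset.le_sup' (fun A => ∑ k ∈ A, H (numEdges n * ξ (e k))) hB
  have h3 := Finset.sum_filter_add_sum_filter_not A (fun x => x ∈ Set.range e)
    (fun x => H (numEdges n * ξ x))
  have h4 : passageTime (fun x => H (numEdges n * ξ x)) 0 n -
      discBlock 0 H (fun k => (e k).1) (fun k => numEdges n * ξ (e k))
      ≤ ∑ x ∈ A', H (numEdges n * ξ x) := by
    rw [hAeq, ← h3]
    linarith
  refine (min_le_min_left _ (ENNReal.ofReal_le_ofReal h4)).trans ?_
  rw [ENNReal.ofReal_sum_of_nonneg fun x _ => hH0 _]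
  refine min_one_sum_le_truncError hn he hH
    (compatSets_of_subset hA (Finset.filter_subset _ _)) fun x hx => ?_
  obtain ⟨hxA, hxr⟩ := Finset.mem_filter.1 hx
  refine ⟨Fin.last K, by simp, fun i _ => (ht.1.monotone (Fin.le_last i)).trans ?_⟩
  exact (ht.2 x ((mem_compatSets.1 hA).1 hxA) hxr).le

end Deterministic

/-- A quantitative form of bounded Lipschitz continuity for functions with values in `[0, ∞]`. -/
def IsBddLip (c : ℝ≥0∞) (F : ℝ → ℝ≥0∞) : Prop :=
  ∀ x y, x ≤ y → F y ≤ F x + c * min 1 (ENNReal.ofReal (y - x)) ∧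
    F x ≤ F y + c * min 1 (ENNReal.ofReal (y - x))

section

variable {Ω' : Type*} [MeasurableSpace Ω'] {Q : Measure Ω'} {u : Edge → Ω' → ℝ}

lemma IsUniformField.sum_lintegral_isTop_eq (hu : IsUniformField Q u) {K n : ℕ}
    (φ : (Fin (K + 1) → Edge) → (Edge → ℝ) → ℝ≥0∞) (hφ : ∀ e, Measurable (φ e)) :
    ∑ e ∈ tuples K n, ∫⁻ ω, {ω | IsTop n e (u · ω)}.indicator (fun ω => φ e (u · ω)) ω ∂Q
      = ∫⁻ ω, ∑ e ∈ tuples K n,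
          {ω | IsTop n e (u · ω)}.indicator (fun ω => φ e (u · ω)) ω ∂Q := by
  rw [lintegral_finsetSum]
  intro e _
  exact ((hφ e).comp hu.measurable).indicator (hu.measurable (measurableSet_isTop n e))

lemma measurable_discBlock_marks {K : ℕ} (n a : ℕ) {H : ℝ → ℝ} (hH : Measurable H)
    (e : Fin (K + 1) → Edge) : Measurable fun ξ : Edge → ℝ =>
      discBlock a H (fun k => (e k).1) fun k => numEdges n * ξ (e k) :=
  (measurable_discBlock a hH _).comp
    (measurable_pi_lambda _ fun k => (measurable_pi_apply (e k)).const_mul _)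

variable {C r : ℝ} {H : ℝ → ℝ} {n a K : ℕ}

lemma IsUniformField.sum_lintegral_min_le (hu : IsUniformField Q u) (hn : 1 ≤ n)
    (hK : K + 1 ≤ (edges n).card) (hC : 0 ≤ C) (hr : 0 ≤ r) (hHm : Measurable H)
    (hH0 : ∀ y, 0 ≤ H y) (hH : ∀ (j : ℕ) y, 2 ^ j < y → H y ≤ C * r ^ j) (J : ℕ) :
    ∑ e ∈ tuples K n, ∫⁻ ω, {ω | IsTop n e (u · ω)}.indicator (fun ω => min 1 (ENNReal.ofReal
        (discBlock a H (fun k => (e k).1) fun k => numEdges n * u (e k) ω))) ω ∂Q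
      ≤ 2 ^ J / a + tailBound C r J := by
  rw [hu.sum_lintegral_isTop_eq (fun e ξ => min 1 (ENNReal.ofReal
    (discBlock a H (fun k => (e k).1) fun k => numEdges n * ξ (e k)))) fun e =>
      measurable_const.min (measurable_discBlock_marks n a hHm e).ennreal_ofReal]
  refine (lintegral_mono_ae ?_).trans (hu.lintegral_truncError_le hn hC hr J a)
  filter_upwards [hu.ae_sum_indicator hK fun e ω => min 1 (ENNReal.ofReal
    (discBlock a H (fun k => (e k).1) fun k => numEdges n * u (e k) ω))] with ω hω
  obtain ⟨e, he, ht, hsum⟩ := hω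
  rw [hsum]
  exact min_one_discBlock_le (ξ := (u · ω)) hn he ht hH0 hH

lemma IsUniformField.lintegral_passageTime_approx (hu : IsUniformField Q u) (hn : 1 ≤ n)
    (hK : K + 1 ≤ (edges n).card) (hC : 0 ≤ C) (hr : 0 ≤ r) (hHm : Measurable H)
    (hH0 : ∀ y, 0 ≤ H y) (hH : ∀ (j : ℕ) y, 2 ^ j < y → H y ≤ C * r ^ j) (J : ℕ)
    {c : ℝ≥0∞} {F : ℝ → ℝ≥0∞} (hFm : Measurable F) (hF : IsBddLip c F) :
    (∫⁻ ω, F (passageTime (fun x => H (numEdges n * u x ω)) 0 n) ∂Q ≤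
      ∑ e ∈ tuples K n, ∫⁻ ω, {ω | IsTop n e (u · ω)}.indicator (fun ω => F
        (discBlock 0 H (fun k => (e k).1) fun k => numEdges n * u (e k) ω)) ω ∂Q
      + c * (2 ^ J / K + tailBound C r J)) ∧
    (∑ e ∈ tuples K n, ∫⁻ ω, {ω | IsTop n e (u · ω)}.indicator (fun ω => F
        (discBlock 0 H (fun k => (e k).1) fun k => numEdges n * u (e k) ω)) ω ∂Q ≤
      ∫⁻ ω, F (passageTime (fun x => H (numEdges n * u x ω)) 0 n) ∂Q
      + c * (2 ^ J / K + tailBound C r J)) := by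
  rw [hu.sum_lintegral_isTop_eq (fun e ξ => F
    (discBlock 0 H (fun k => (e k).1) fun k => numEdges n * ξ (e k))) fun e =>
      hFm.comp (measurable_discBlock_marks n 0 hHm e)]
  have hmt : Measurable fun ω => truncError C r J K n (u · ω) :=
    (measurable_truncError C r J K n).comp hu.measurable
  have hint : c * ∫⁻ ω, truncError C r J K n (u · ω) ∂Q ≤ c * (2 ^ J / K + tailBound C r J) := by
    gcongr
    exact hu.lintegral_truncError_le hn hC hr J K
  have hae := hu.ae_sum_indicator hK fun e ω => F
    (discBlock 0 H (fun k => (e k).1) fun k => numEdges n * u (e k) ω)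
  constructor
  · refine le_trans ?_ (add_le_add le_rfl hint)
    rw [← lintegral_const_mul _ hmt, ← lintegral_add_right _ (hmt.const_mul c)]
    refine lintegral_mono_ae ?_
    filter_upwards [hae] with ω hω
    obtain ⟨e, he, ht, hsum⟩ := hω
    rw [hsum]
    refine (hF _ _ (discBlock_le_passageTime (ξ := (u · ω)) he hH0)).1.trans ?_
    gcongr
    exact min_one_passageTime_sub_le (ξ := (u · ω)) hn he ht hH0 hH
  · refine le_trans ?_ (add_le_add le_rfl hint)
    rw [← lintegral_const_mul _ hmt, ← lintegral_add_right _ (hmt.const_mul c)]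
    refine lintegral_mono_ae ?_
    filter_upwards [hae] with ω hω
    obtain ⟨e, he, ht, hsum⟩ := hω
    rw [hsum]
    refine (hF _ _ (discBlock_le_passageTime (ξ := (u · ω)) he hH0)).2.trans ?_
    gcongr
    exact min_one_passageTime_sub_le (ξ := (u · ω)) hn he ht hH0 hH

end

/-! ### Truncation of the continuous passage time -/

section Deterministic

variable {s : ℝ} {W U V : ℕ → ℝ}

lemma contWeight_nonneg (hW : ∀ k, 0 < W k) (k : ℕ) : 0 ≤ contWeight s W k :=
  Real.rpow_nonneg (Finset.sum_nonneg fun i _ => (hW i).le) _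

/-- Compatible finite index sets. -/
def IsCompat (U V : ℕ → ℝ) (S : Finset ℕ) : Prop :=
  (S : Set ℕ).Pairwise fun i j => Compatible (contEdge U V i) (contEdge U V j)

lemma sum_le_contBlock {S : Finset ℕ} (hS : IsCompat U V S) {a K : ℕ}
    (hSK : ∀ k ∈ S, a ≤ k ∧ k ≤ K) : ∑ k ∈ S, contWeight s W k ≤ contBlock s a K W U V := by
  classical
  let A : Finset (Fin (K + 1)) := Finset.univ.filter (fun k => (k : ℕ) ∈ S)
  have hA : A ∈ blockSets a (fun i j : Fin (K + 1) =>
      Compatible (contEdge U V i) (contEdge U V j)) := by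
    rw [mem_blockSets]
    refine ⟨fun k hk => (hSK _ (Finset.mem_filter.1 hk).2).1, fun i hi j hj hij => ?_⟩
    exact hS (Finset.mem_filter.1 hi).2 (Finset.mem_filter.1 hj).2 fun h => hij (Fin.ext h)
  have hmap : S = A.map Fin.valEmbedding := by
    ext k
    simp only [Finset.mem_map, A, Finset.mem_filter, Finset.mem_univ, true_and,
      Fin.valEmbedding_apply]
    constructor
    · exact fun hk => ⟨⟨k, Nat.lt_succ_of_le (hSK k hk).2⟩, hk, rfl⟩
    · rintro ⟨i, hi, rfl⟩; exact hi
  rw [hmap, Finset.sum_map]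
  exact Finset.le_sup' (fun A : Finset (Fin (K + 1)) => ∑ k ∈ A, contWeight s W k) hA

lemma exists_contBlock_eq (s : ℝ) (W U V : ℕ → ℝ) (a K : ℕ) :
    ∃ S : Finset ℕ, IsCompat U V S ∧ (∀ k ∈ S, a ≤ k ∧ k ≤ K) ∧
      contBlock s a K W U V = ∑ k ∈ S, contWeight s W k := by
  obtain ⟨A, hA, hmax⟩ := Finset.exists_mem_eq_sup' (blockSets_nonempty a
    (fun i j : Fin (K + 1) => Compatible (contEdge U V i) (contEdge U V j)))
    fun A => ∑ k ∈ A, contWeight s W k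
  rw [mem_blockSets] at hA
  refine ⟨A.map Fin.valEmbedding, ?_, ?_, ?_⟩
  · intro x hx y hy hxy
    obtain ⟨i, hi, rfl⟩ := Finset.mem_map.1 (Finset.mem_coe.1 hx)
    obtain ⟨j, hj, rfl⟩ := Finset.mem_map.1 (Finset.mem_coe.1 hy)
    exact hA.2 hi hj fun h => hxy (by rw [h])
  · intro k hk
    obtain ⟨i, hi, rfl⟩ := Finset.mem_map.1 hk
    exact ⟨hA.1 i hi, Nat.le_of_lt_succ i.2⟩
  · rw [Finset.sum_map]
    exact hmax

lemma contBlock_mono (a : ℕ) {K K' : ℕ} (h : K ≤ K') :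
    contBlock s a K W U V ≤ contBlock s a K' W U V := by
  obtain ⟨S, hS, hSK, heq⟩ := exists_contBlock_eq s W U V a K
  rw [heq]
  exact sum_le_contBlock hS fun k hk => ⟨(hSK k hk).1, (hSK k hk).2.trans h⟩

lemma contBlock_nonneg (a K : ℕ) : 0 ≤ contBlock s a K W U V := blockMax_nonneg

lemma contBlock_split (a K K' : ℕ) :
    contBlock s a K' W U V ≤ contBlock s a K W U V + contBlock s K K' W U V := by
  classical
  obtain ⟨S, hS, hSK, heq⟩ := exists_contBlock_eq s W U V a K'
  rw [heq, ← Finset.sum_filter_add_sum_filter_not S (fun k => k ≤ K)]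
  refine add_le_add ?_ ?_
  · refine sum_le_contBlock (hS.mono (by exact_mod_cast Finset.filter_subset _ _)) fun k hk => ?_
    rw [Finset.mem_filter] at hk
    exact ⟨(hSK k hk.1).1, hk.2⟩
  · refine sum_le_contBlock (hS.mono (by exact_mod_cast Finset.filter_subset _ _)) fun k hk => ?_
    rw [Finset.mem_filter] at hk
    exact ⟨(not_le.1 hk.2).le, (hSK k hk.1).2⟩

/-- A series of nonnegative terms is the supremum of its finite partial sums, and finite subsets of
admissible sets are admissible. The uncountable supremum thus becomes a countable one, which yields
measurability. -/
lemma contPassageTime_eq_iSup (hW : ∀ k, 0 < W k) :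
    contPassageTime s W U V = ⨆ K, ENNReal.ofReal (contBlock s 0 K W U V) := by
  classical
  apply le_antisymm
  · refine iSup₂_le fun A hA => ?_
    rw [ENNReal.tsum_eq_iSup_sum]
    refine iSup_le fun S => ?_
    let S' : Finset ℕ := S.map (Function.Embedding.subtype _)
    have hsum : ∑ i ∈ S, ENNReal.ofReal (contWeight s W i)
        = ENNReal.ofReal (∑ i ∈ S', contWeight s W i) := by
      rw [ENNReal.ofReal_sum_of_nonneg fun i _ => contWeight_nonneg hW i, Finset.sum_map]
      rfl
    rw [hsum]
    refine le_trans ?_ (le_iSup _ (S'.sup id))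
    refine ENNReal.ofReal_le_ofReal (sum_le_contBlock ?_ fun k hk =>
      ⟨Nat.zero_le _, Finset.le_sup (f := id) hk⟩)
    refine Set.Pairwise.mono (fun x hx => ?_) hA
    obtain ⟨i, -, rfl⟩ := Finset.mem_map.1 (Finset.mem_coe.1 hx)
    exact i.2
  · refine iSup_le fun K => ?_
    obtain ⟨S, hS, -, heq⟩ := exists_contBlock_eq s W U V 0 K
    rw [heq, ENNReal.ofReal_sum_of_nonneg fun i _ => contWeight_nonneg hW i]
    have hadm : (S : Set ℕ) ∈ admissible U V := hS
    refine le_trans ?_ (le_iSup₂ (S : Set ℕ) hadm)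
    rw [← Finset.tsum_subtype' S fun k => ENNReal.ofReal (contWeight s W k)]

/-- The contribution of the edges with indices at least `a`. -/
def contTail (s : ℝ) (a : ℕ) (W U V : ℕ → ℝ) : ℝ≥0∞ :=
  ⨆ K, ENNReal.ofReal (contBlock s a K W U V)

lemma contPassageTime_le (hW : ∀ k, 0 < W k) (K : ℕ) :
    contPassageTime s W U V ≤ ENNReal.ofReal (contBlock s 0 K W U V) + contTail s K W U V := by
  rw [contPassageTime_eq_iSup hW]
  refine iSup_le fun K' => ?_
  refine (ENNReal.ofReal_le_ofReal (contBlock_split 0 K K')).trans ?_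
  rw [ENNReal.ofReal_add (contBlock_nonneg _ _) (contBlock_nonneg _ _)]
  gcongr
  exact le_iSup (fun K' => ENNReal.ofReal (contBlock s K K' W U V)) K'

lemma ofReal_contBlock_le (hW : ∀ k, 0 < W k) (K : ℕ) :
    ENNReal.ofReal (contBlock s 0 K W U V) ≤ contPassageTime s W U V := by
  rw [contPassageTime_eq_iSup hW]
  exact le_iSup (fun K => ENNReal.ofReal (contBlock s 0 K W U V)) K

end Deterministic

/-! ### Tail estimates for the continuous passage time -/

/-- The normalised weight functions `H n` converge to `y ↦ y ^ (-1 / s)` and are dominated along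
dyadic points by a geometric sequence of ratio less than `1 / √2`. -/
structure IsScaledWeight (s C r : ℝ) (H : ℕ → ℝ → ℝ) : Prop where
  C_nonneg : 0 ≤ C
  r_nonneg : 0 ≤ r
  r_lt : r * √2 < 1
  meas : ∀ n, Measurable (H n)
  nonneg : ∀ n y, 0 ≤ H n y
  tendsto : ∀ y, 0 < y → Tendsto (fun n => H n y) atTop (𝓝 (y ^ (-1 / s)))
  bound : ∀ᶠ n in atTop, ∀ (j : ℕ) y, 2 ^ j < y → H n y ≤ C * r ^ j

lemma exists_bound_le {C r : ℝ} (hC : 0 ≤ C) (hr : 0 ≤ r) (hr2 : r * √2 < 1) {ε : ℝ≥0∞}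
    (hε : 0 < ε) : ∃ J K : ℕ, 2 ^ J / (K : ℝ≥0∞) + tailBound C r J ≤ ε := by
  have hε2 : 0 < ε / 2 := ENNReal.half_pos hε.ne'
  -- The level `J` is fixed first to make the geometric tail small; only then is `K` taken large
  -- compared with `2 ^ J`.
  obtain ⟨J, hJ⟩ := ((tendsto_tailBound hC hr hr2).eventually (eventually_le_nhds hε2)).exists
  have h1 : Tendsto (fun K : ℕ => (2 ^ J : ℝ≥0∞) / (K : ℝ≥0∞)) atTop (𝓝 0) := by
    have := ENNReal.Tendsto.const_div (a := 2 ^ J) ENNReal.tendsto_nat_nhds_top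
      (Or.inr (ENNReal.pow_ne_top (by simp)))
    simpa using this
  obtain ⟨K, hK⟩ := (h1.eventually (eventually_le_nhds hε2)).exists
  exact ⟨J, K, (add_le_add hK hJ).trans (ENNReal.add_halves ε).le⟩

section

variable {Ω : Type*} [MeasurableSpace Ω] {P : Measure Ω} {W U V : ℕ → Ω → ℝ} {s : ℝ}

lemma measurable_contWeight (s : ℝ) (k : ℕ) :
    Measurable fun z : (ℕ → ℝ) => contWeight s z k := by
  unfold contWeight
  fun_prop

lemma measurableSet_compatible (i j : ℕ) :
    MeasurableSet {z : (ℕ → ℝ) × (ℕ → ℝ) × (ℕ → ℝ) |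
      Compatible (contEdge z.2.1 z.2.2 i) (contEdge z.2.1 z.2.2 j)} := by
  have h1 : ∀ k, Measurable fun z : (ℕ → ℝ) × (ℕ → ℝ) × (ℕ → ℝ) =>
      (contEdge z.2.1 z.2.2 k).1 := fun k => by
    simp only [contEdge]; fun_prop
  have h2 : ∀ k, Measurable fun z : (ℕ → ℝ) × (ℕ → ℝ) × (ℕ → ℝ) =>
      (contEdge z.2.1 z.2.2 k).2 := fun k => by
    simp only [contEdge]; fun_prop
  have := (measurableSet_le (h2 i) (h1 j)).union (measurableSet_le (h2 j) (h1 i))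
  exact this

lemma measurable_contBlock (s : ℝ) (a K : ℕ) :
    Measurable fun z : (ℕ → ℝ) × (ℕ → ℝ) × (ℕ → ℝ) => contBlock s a K z.1 z.2.1 z.2.2 := by
  classical
  let c : (ℕ → ℝ) × (ℕ → ℝ) × (ℕ → ℝ) → Fin (K + 1) → Fin (K + 1) → Prop :=
    fun z i j => Compatible (contEdge z.2.1 z.2.2 i) (contEdge z.2.1 z.2.2 j)
  have hset : ∀ A : Finset (Fin (K + 1)), MeasurableSet {z | A ∈ blockSets a (c z)} := by
    intro A
    have : {z | A ∈ blockSets a (c z)} = {z | ∀ k ∈ A, a ≤ (k : ℕ)} ∩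
        ⋂ i ∈ A, ⋂ j ∈ A, {z | i ≠ j → c z i j} := by
      ext z
      simp only [Set.mem_ofPred_eq, mem_blockSets, Set.mem_inter_iff, Set.mem_iInter,
        Set.Pairwise, Finset.mem_coe]
    rw [this]
    refine (MeasurableSet.const _).inter (Finset.measurableSet_biInter _ fun i _ =>
      Finset.measurableSet_biInter _ fun j _ => ?_)
    by_cases hij : i = j
    · simp [hij]
    · simp only [ne_eq, hij, not_false_eq_true, forall_const]
      exact measurableSet_compatible i j
  have hne : (Finset.univ : Finset (Finset (Fin (K + 1)))).Nonempty := Finset.univ_nonempty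
  have heq : (fun z : (ℕ → ℝ) × (ℕ → ℝ) × (ℕ → ℝ) => contBlock s a K z.1 z.2.1 z.2.2)
      = Finset.univ.sup' hne fun (A : Finset (Fin (K + 1))) z =>
        if z ∈ {z | A ∈ blockSets a (c z)} then ∑ k ∈ A, contWeight s z.1 k else 0 := by
    ext z
    rw [Finset.sup'_apply]
    apply le_antisymm
    · refine Finset.sup'_le (blockSets_nonempty a (c z)) _ fun A hA => ?_
      refine le_trans ?_ (Finset.le_sup' _ (Finset.mem_univ A))
      rw [if_pos (by exact hA)]
    · refine Finset.sup'_le _ _ fun A _ => ?_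
      split_ifs with hA
      · exact Finset.le_sup' (fun A : Finset (Fin (K + 1)) => ∑ k ∈ A, contWeight s z.1 k) hA
      · exact contBlock_nonneg a K
  rw [heq]
  refine Finset.measurable_sup' hne fun A _ => Measurable.ite (hset A) ?_ measurable_const
  exact Finset.measurable_sum _ fun k _ => (measurable_contWeight s k).comp measurable_fst

lemma IsContinuousModelInput.aemeasurable_contBlock (h : IsContinuousModelInput P W U V)
    (s : ℝ) (a K : ℕ) :
    AEMeasurable (fun ω => contBlock s a K (W · ω) (U · ω) (V · ω)) P := by
  have hw : AEMeasurable (fun ω k => W k ω) P :=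
    aemeasurable_pi_lambda _ fun k => (h.law_W k).aemeasurable
  have hu : AEMeasurable (fun ω k => U k ω) P :=
    aemeasurable_pi_lambda _ fun k => (h.law_U k).aemeasurable
  have hv : AEMeasurable (fun ω k => V k ω) P :=
    aemeasurable_pi_lambda _ fun k => (h.law_V k).aemeasurable
  have hp : AEMeasurable (fun ω => ((fun k => W k ω), (fun k => U k ω), fun k => V k ω)) P :=
    hw.prodMk (hu.prodMk hv)
  have := Measurable.comp_aemeasurable
    (g := fun z : (ℕ → ℝ) × (ℕ → ℝ) × (ℕ → ℝ) => contBlock s a K z.1 z.2.1 z.2.2)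
    (measurable_contBlock s a K) hp
  exact this

lemma IsContinuousModelInput.aemeasurable_contPassageTime (h : IsContinuousModelInput P W U V)
    (s : ℝ) : AEMeasurable (fun ω => contPassageTime s (W · ω) (U · ω) (V · ω)) P := by
  have h1 : AEMeasurable (fun ω => ⨆ K, ENNReal.ofReal (contBlock s 0 K (W · ω) (U · ω) (V · ω)))
      P := AEMeasurable.iSup fun K => (h.aemeasurable_contBlock s 0 K).ennreal_ofReal
  refine h1.congr ?_
  filter_upwards [h.ae_isGeneric] with ω hω
  exact (contPassageTime_eq_iSup hω.1).symm

variable {Ω' : Type*} [MeasurableSpace Ω'] {Q : Measure Ω'} {u : Edge → Ω' → ℝ}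
variable {C r : ℝ} {H : ℕ → ℝ → ℝ}

/-- The discrete bound is uniform in both `n` and `K`: it passes to each finite block by the head
convergence, then to the whole tail by monotone convergence. Truncating at `1` supplies the bounded
test function. -/
lemma lintegral_min_contTail_le (hu : IsUniformField Q u) (h : IsContinuousModelInput P W U V)
    (hH : IsScaledWeight s C r H) (a J : ℕ) :
    ∫⁻ ω, min 1 (contTail s a (W · ω) (U · ω) (V · ω)) ∂P ≤ 2 ^ J / a + tailBound C r J := by
  have hK : ∀ K, ∫⁻ ω, min 1 (ENNReal.ofReal (contBlock s a K (W · ω) (U · ω) (V · ω))) ∂P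
      ≤ 2 ^ J / a + tailBound C r J := by
    intro K
    have hcont : Continuous fun x : ℝ => min 1 (ENNReal.ofReal x) :=
      continuous_const.min ENNReal.continuous_ofReal
    refine le_of_tendsto (tendsto_sum_lintegral_isTop hu h hH.meas hH.tendsto a K hcont
      ENNReal.one_ne_top fun x => min_le_left _ _) ?_
    filter_upwards [hH.bound, eventually_ge_atTop 1,
      tendsto_card_edges.eventually_ge_atTop (K + 1)] with n h1 h2 h3
    exact hu.sum_lintegral_min_le h2 h3 hH.C_nonneg hH.r_nonneg (hH.meas n) (hH.nonneg n) h1 J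
  have heq : ∀ ω, min 1 (contTail s a (W · ω) (U · ω) (V · ω))
      = ⨆ K, min 1 (ENNReal.ofReal (contBlock s a K (W · ω) (U · ω) (V · ω))) := fun ω => by
    rw [contTail, inf_iSup_eq]
  simp_rw [heq]
  rw [lintegral_iSup' (fun K => aemeasurable_const.min
    (h.aemeasurable_contBlock s a K).ennreal_ofReal)
    (Eventually.of_forall fun ω K K' hKK' => min_le_min_left _
      (ENNReal.ofReal_le_ofReal (contBlock_mono a hKK')))]
  exact iSup_le hK

/-- A finite block has finite weight, so an infinite passage time forces every tail to be infinite.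
By Markov's inequality this has probability at most the tail bound, which can be made arbitrarily
small. -/
lemma ae_contPassageTime_lt_top (hu : IsUniformField Q u) (h : IsContinuousModelInput P W U V)
    (hH : IsScaledWeight s C r H) :
    ∀ᵐ ω ∂P, contPassageTime s (W · ω) (U · ω) (V · ω) < ∞ := by
  have h0 : P {ω | contPassageTime s (W · ω) (U · ω) (V · ω) = ∞} = 0 := by
    refine le_antisymm (le_of_forall_gt_imp_ge_of_dense fun ε hε => ?_) zero_le
    obtain ⟨J, K, hJK⟩ := exists_bound_le hH.C_nonneg hH.r_nonneg hH.r_lt hε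
    refine le_trans ?_ ((lintegral_min_contTail_le hu h hH K J).trans hJK)
    have hae : {ω | contPassageTime s (W · ω) (U · ω) (V · ω) = ∞} ≤ᵐ[P]
        {ω | 1 ≤ min 1 (contTail s K (W · ω) (U · ω) (V · ω))} := by
      filter_upwards [h.ae_isGeneric] with ω hω hmem
      have h1 := contPassageTime_le (s := s) (U := (U · ω)) (V := (V · ω)) hω.1 K
      have hmem' : contPassageTime s (W · ω) (U · ω) (V · ω) = ∞ := hmem
      rw [hmem', top_le_iff, ENNReal.add_eq_top] at h1
      have h2 := h1.resolve_left ENNReal.ofReal_ne_top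
      change 1 ≤ min 1 (contTail s K (W · ω) (U · ω) (V · ω))
      rw [h2]
      simp
    refine (measure_mono_ae hae).trans ?_
    have hm : AEMeasurable (fun ω => min 1 (contTail s K (W · ω) (U · ω) (V · ω))) P :=
      aemeasurable_const.min (AEMeasurable.iSup fun K' =>
        (h.aemeasurable_contBlock s K K').ennreal_ofReal)
    simpa using mul_meas_ge_le_lintegral₀ hm 1
  rw [ae_iff]
  simpa [not_lt, top_le_iff] using h0

/-- Convergence of the expectations of bounded Lipschitz functions of the passage times. -/
lemma tendsto_lintegral_passageTime (hu : IsUniformField Q u) (h : IsContinuousModelInput P W U V)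
    (hH : IsScaledWeight s C r H) {c B : ℝ≥0∞} (hc : c ≠ ∞) {F : ℝ → ℝ≥0∞} (hFc : Continuous F)
    (hB : B ≠ ∞) (hFB : ∀ x, F x ≤ B) (hF : IsBddLip c F) :
    Tendsto (fun n : ℕ => ∫⁻ ω, F (passageTime (fun x => H n (numEdges n * u x ω)) 0 n) ∂Q) atTop
      (𝓝 (∫⁻ ω, F (contPassageTime s (W · ω) (U · ω) (V · ω)).toReal ∂P)) := by
  have hprob : IsProbabilityMeasure P := h.indep.isProbabilityMeasure
  have hfin : ∫⁻ ω, F (contPassageTime s (W · ω) (U · ω) (V · ω)).toReal ∂P ≠ ∞ := by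
    refine ne_top_of_le_ne_top hB ((lintegral_mono fun ω => hFB _).trans ?_)
    simp
  rw [ENNReal.tendsto_nhds hfin]
  intro ε hε
  -- Three errors are budgeted: truncating the continuous model, convergence of the truncated
  -- quantities, and truncating the discrete model.
  obtain ⟨δ, hδ, hδε⟩ : ∃ δ : ℝ≥0∞, 0 < δ ∧ c * δ + δ + c * δ ≤ ε := by
    have h1 : Tendsto (fun δ : ℝ≥0∞ => c * δ + δ + c * δ) (𝓝 0) (𝓝 (c * 0 + 0 + c * 0)) := by
      have h2 : Tendsto (fun δ : ℝ≥0∞ => c * δ) (𝓝 0) (𝓝 (c * 0)) :=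
        ENNReal.Tendsto.const_mul tendsto_id (Or.inr hc)
      exact (h2.add tendsto_id).add h2
    simp only [mul_zero, add_zero] at h1
    have h3 := (h1.mono_left (nhdsWithin_le_nhds (s := Set.Ioi 0))).eventually
      (eventually_le_nhds hε)
    obtain ⟨δ, h4, h5⟩ := (h3.and self_mem_nhdsWithin).exists
    exact ⟨δ, h5, h4⟩
  obtain ⟨J, K, hJK⟩ := exists_bound_le hH.C_nonneg hH.r_nonneg hH.r_lt hδ
  set A := ∫⁻ ω, F (contPassageTime s (W · ω) (U · ω) (V · ω)).toReal ∂P with hA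
  set BK := ∫⁻ ω, F (contBlock s 0 K (W · ω) (U · ω) (V · ω)) ∂P with hBK
  have hBKfin : BK ≠ ∞ := by
    refine ne_top_of_le_ne_top hB ((lintegral_mono fun ω => hFB _).trans ?_)
    simp
  have hlim := tendsto_sum_lintegral_isTop hu h hH.meas hH.tendsto 0 K hFc hB hFB
  rw [← hBK] at hlim
  rw [ENNReal.tendsto_nhds hBKfin] at hlim
  have htail : c * ∫⁻ ω, min 1 (contTail s K (W · ω) (U · ω) (V · ω)) ∂P ≤ c * δ := by
    gcongr
    exact (lintegral_min_contTail_le hu h hH K J).trans hJK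
  have hm : AEMeasurable (fun ω => min 1 (contTail s K (W · ω) (U · ω) (V · ω))) P :=
    aemeasurable_const.min (AEMeasurable.iSup fun K' =>
      (h.aemeasurable_contBlock s K K').ennreal_ofReal)
  have hpt : ∀ᵐ ω ∂P, contBlock s 0 K (W · ω) (U · ω) (V · ω) ≤
      (contPassageTime s (W · ω) (U · ω) (V · ω)).toReal ∧
      ENNReal.ofReal ((contPassageTime s (W · ω) (U · ω) (V · ω)).toReal -
        contBlock s 0 K (W · ω) (U · ω) (V · ω)) ≤ contTail s K (W · ω) (U · ω) (V · ω) := by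
    filter_upwards [h.ae_isGeneric, ae_contPassageTime_lt_top hu h hH] with ω hω hlt
    constructor
    · rw [← ENNReal.ofReal_le_iff_le_toReal hlt.ne]
      exact ofReal_contBlock_le hω.1 K
    · rw [ENNReal.ofReal_sub _ (contBlock_nonneg _ _), ENNReal.ofReal_toReal hlt.ne,
        tsub_le_iff_left]
      exact contPassageTime_le hω.1 K
  have hAB : A ≤ BK + c * δ := by
    refine le_trans ?_ (add_le_add le_rfl htail)
    rw [← lintegral_const_mul'' _ hm, ← lintegral_add_right' _ (hm.const_mul c)]
    refine lintegral_mono_ae (hpt.mono fun ω hω => (hF _ _ hω.1).1.trans ?_)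
    gcongr
    exact hω.2
  have hBA : BK ≤ A + c * δ := by
    refine le_trans ?_ (add_le_add le_rfl htail)
    rw [← lintegral_const_mul'' _ hm, ← lintegral_add_right' _ (hm.const_mul c)]
    refine lintegral_mono_ae (hpt.mono fun ω hω => (hF _ _ hω.1).2.trans ?_)
    gcongr
    exact hω.2
  filter_upwards [hlim δ hδ, hH.bound, eventually_ge_atTop 1,
      tendsto_card_edges.eventually_ge_atTop (K + 1)] with n hn h1 h2 h3
  obtain ⟨h4, h5⟩ := hu.lintegral_passageTime_approx h2 h3 hH.C_nonneg hH.r_nonneg (hH.meas n)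
    (hH.nonneg n) h1 J hFc.measurable hF
  have hcJK : c * (2 ^ J / (K : ℝ≥0∞) + tailBound C r J) ≤ c * δ := by gcongr
  constructor
  · rw [tsub_le_iff_right]
    calc A ≤ BK + c * δ := hAB
      _ ≤ _ + δ + c * δ := by
          gcongr
          exact tsub_le_iff_right.1 hn.1
      _ ≤ _ + c * δ + δ + c * δ := by
          gcongr
          exact h5.trans (add_le_add le_rfl hcJK)
      _ = _ + (c * δ + δ + c * δ) := by ring
      _ ≤ _ := by gcongr
  · calc _ ≤ _ + c * δ := h4.trans (add_le_add le_rfl hcJK)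
      _ ≤ BK + δ + c * δ := by
          gcongr
          exact hn.2
      _ ≤ A + c * δ + δ + c * δ := by gcongr
      _ = A + (c * δ + δ + c * δ) := by ring
      _ ≤ _ := by gcongr

end

/-! ### The limit theorem -/

/-- This is where `s < 2` enters: the weights decay by `2 ^ (-1 / s)` per dyadic scale, faster than
the number of usable edges grows, which is by `√2`. -/
lemma rpow_neg_one_div_mul_sqrt_lt {s : ℝ} (hs0 : 0 < s) (hs2 : s < 2) :
    (2 : ℝ) ^ (-1 / s) * √2 < 1 := by
  rw [Real.sqrt_eq_rpow, ← Real.rpow_add two_pos]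
  refine Real.rpow_lt_one_of_one_lt_of_neg one_lt_two ?_
  have : 1 / 2 < 1 / s := one_div_lt_one_div_of_lt hs0 hs2
  rw [neg_div]
  linarith

lemma isScaledWeight_rpow {s : ℝ} (hs0 : 0 < s) (hs2 : s < 2) :
    IsScaledWeight s 1 (2 ^ (-1 / s)) fun _ y => if 0 < y then y ^ (-1 / s) else 0 where
  C_nonneg := zero_le_one
  r_nonneg := by positivity
  r_lt := rpow_neg_one_div_mul_sqrt_lt hs0 hs2
  meas _ := Measurable.ite measurableSet_Ioi (by fun_prop) measurable_const
  nonneg _ y := by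
    split_ifs with h
    · positivity
    · exact le_rfl
  tendsto y hy := by simp [hy]
  bound := Eventually.of_forall fun n j y hy => by
    have h2 : (0 : ℝ) < 2 ^ j := by positivity
    rw [if_pos (h2.trans hy), one_mul, ← Real.rpow_natCast, ← Real.rpow_mul zero_le_two,
      mul_comm, Real.rpow_mul zero_le_two, Real.rpow_natCast]
    exact Real.rpow_le_rpow_of_nonpos h2 hy.le (div_nonpos_of_nonpos_of_nonneg (by norm_num) hs0.le)

lemma tendsto_numEdges : Tendsto numEdges atTop atTop :=
  (tendsto_natCast_atTop_atTop.comp tendsto_card_edges).congr fun n => card_edges_eq_numEdges n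

lemma tendsto_inv_numEdges : Tendsto (fun n => (numEdges n)⁻¹) atTop (𝓝[>] 0) :=
  tendsto_inv_atTop_nhdsGT_zero.comp tendsto_numEdges

/-- The weight of an edge with mark `y / N`, in units of `F⁽⁻¹⁾(1 - 1 / N)`. -/
def scaledTailQuantile (F : ℝ → ℝ) (n : ℕ) (y : ℝ) : ℝ :=
  tailQuantile F (y * (numEdges n)⁻¹) / tailQuantile F (numEdges n)⁻¹

lemma exists_isScaledWeight {ν : Measure ℝ} [IsProbabilityMeasure ν] (hν : ∀ᵐ x ∂ν, 0 < x) {s : ℝ}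
    (hs0 : 0 < s) (hs2 : s < 2) (h : RegularlyVaryingTail (cdf ν) s) :
    ∃ C r, IsScaledWeight s C r (scaledTailQuantile (cdf ν)) := by
  have h2 : (0 : ℝ) < √2 := by positivity
  -- The ratio of the tail quantile at `2 u` and `u` only tends to `2 ^ (-1 / s)`, so room above
  -- this value is needed for a bound valid near zero.
  obtain ⟨r, hr, hr'⟩ : ∃ r, (2 : ℝ) ^ (-1 / s) < r ∧ r < 1 / √2 :=
    exists_between ((lt_div_iff₀ h2).2 (rpow_neg_one_div_mul_sqrt_lt hs0 hs2))
  have hr0 : 0 < r := lt_trans (by positivity) hr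
  have hr2 : r * √2 < 1 := (lt_div_iff₀ h2).1 hr'
  have hr1 : r ≤ 1 := by
    have : (1 : ℝ) ≤ √2 := Real.one_le_sqrt.2 one_le_two
    nlinarith
  have hpos := (tendsto_tailQuantile hν h).eventually_gt_atTop 0
  have hev := ((tendsto_tailQuantile_ratio hν hs0 h two_pos).eventually
    (eventually_lt_nhds hr)).and hpos
  obtain ⟨u₀, hu₀, hu⟩ := mem_nhdsGT_iff_exists_Ioc_subset.1 hev
  obtain ⟨C, hC, hbound⟩ := dyadic_ratio_le (tailQuantile_nonneg hν)
    (fun u u' => tailQuantile_antitone hν) (fun u => tailQuantile_eq_zero hν) hr0 hr1 hu₀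
    (fun u h1 h3 => ((div_lt_iff₀ (hu ⟨h1, h3⟩).2).1 (hu ⟨h1, h3⟩).1).le)
  refine ⟨C, r, hC, hr0.le, hr2, fun n => ?_, fun n y => ?_, fun y hy => ?_, ?_⟩
  · exact ((measurable_tailQuantile hν).comp (measurable_id.mul_const _)).div_const _
  · exact div_nonneg (tailQuantile_nonneg hν _) (tailQuantile_nonneg hν _)
  · exact (tendsto_tailQuantile_ratio hν hs0 h hy).comp tendsto_inv_numEdges
  · filter_upwards [tendsto_inv_numEdges.eventually (Ioc_mem_nhdsGT hu₀)] with n hn j y hy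
    have h2j : (0 : ℝ) < 2 ^ j := by positivity
    rw [scaledTailQuantile, div_le_iff₀ (hu hn).2]
    refine le_trans (tailQuantile_antitone hν (mul_pos h2j hn.1) ?_) (hbound j _ hn.1 hn.2)
    exact mul_le_mul_of_nonneg_right hy.le hn.1.le

lemma passageTime_div (v : Edge → ℝ) (a b : ℤ) {c : ℝ} (hc : 0 ≤ c) :
    passageTime v a b / c = passageTime (fun e => v e / c) a b := by
  simp only [passageTime, IncreasingPath.weight, ← Finset.sum_div]
  simp_rw [div_eq_mul_inv]
  exact Real.iSup_mul_of_nonneg (inv_nonneg.2 hc) _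

lemma scale_eq {ν : Measure ℝ} {n : ℕ} (hn : 1 ≤ n) :
    scale (cdf ν) n = tailQuantile (cdf ν) (numEdges n)⁻¹ := by
  rw [tailQuantile, if_pos (inv_pos.2 (numEdges_pos hn)), scale, one_div, numEdges]

lemma passageTime_div_scale {ν : Measure ℝ} (hν : ∀ᵐ x ∂ν, 0 < x) [IsProbabilityMeasure ν] {n : ℕ}
    (hn : 1 ≤ n) (ξ : Edge → ℝ) (a b : ℤ) :
    passageTime (fun e => tailQuantile (cdf ν) (ξ e)) a b / scale (cdf ν) n =
      passageTime (fun e => scaledTailQuantile (cdf ν) n (numEdges n * ξ e)) a b := by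
  rw [scale_eq hn, passageTime_div _ _ _ (tailQuantile_nonneg hν _)]
  congr 1
  ext e
  rw [scaledTailQuantile, mul_comm, inv_mul_cancel_left₀ (numEdges_pos hn).ne']

lemma exists_isUniformField : ∃ (Ω : Type) (_ : MeasurableSpace Ω) (Q : Measure Ω)
    (u : Edge → Ω → ℝ), IsUniformField Q u := by
  obtain ⟨Ω, m, Q, u, h1, h2, h3, -⟩ := exists_iid Edge uniformLaw
  exact ⟨Ω, m, Q, u, h1, h2, h3⟩

section

variable {Ω₁ Ω₂ : Type*} [MeasurableSpace Ω₁] [MeasurableSpace Ω₂] {Q : Measure Ω₁} {P : Measure Ω₂}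

/-- Functionals of i.i.d. edge weights can be computed on a uniform field. -/
lemma IsUniformField.lintegral_eq {u : Edge → Ω₂ → ℝ} (hu : IsUniformField P u) {ν : Measure ℝ}
    [IsProbabilityMeasure ν] (hν : ∀ᵐ x ∂ν, 0 < x) {v : Edge → Ω₁ → ℝ}
    (hv : ∀ e, HasLaw (v e) ν Q) (hvi : iIndepFun v Q) {Φ : (Edge → ℝ) → ℝ≥0∞}
    (hΦ : Measurable Φ) :
    ∫⁻ ω, Φ (v · ω) ∂Q = ∫⁻ ω, Φ (fun e => tailQuantile (cdf ν) (u e ω)) ∂P := by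
  have hm := measurable_tailQuantile hν
  have hlaw : ∀ e, HasLaw (fun ω => tailQuantile (cdf ν) (u e ω)) ν P := fun e =>
    { aemeasurable := (hm.comp (hu.meas e)).aemeasurable
      map_eq := by
        have h1 := Measure.map_map (μ := P) hm (hu.meas e)
        rw [(hu.law e).map_eq, map_tailQuantile hν] at h1
        exact h1.symm }
  have hind : iIndepFun (fun e ω => tailQuantile (cdf ν) (u e ω)) P :=
    hu.indep.comp (fun _ => tailQuantile (cdf ν)) fun _ => hm
  have hm1 : AEMeasurable (fun ω e => v e ω) Q :=
    aemeasurable_pi_lambda _ fun e => (hv e).aemeasurable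
  have hm2 : AEMeasurable (fun ω e => tailQuantile (cdf ν) (u e ω)) P :=
    aemeasurable_pi_lambda _ fun e => (hlaw e).aemeasurable
  have e1 := (hvi.hasLaw_infinitePi hv hm1).map_eq
  have e2 := (hind.hasLaw_infinitePi hlaw hm2).map_eq
  rw [← lintegral_map' hΦ.aemeasurable hm1, ← lintegral_map' hΦ.aemeasurable hm2, e1, e2]

end

/-! ### From bounded Lipschitz test functions to convergence in distribution -/

lemma LipschitzWith.isBddLip {g : ℝ → ℝ} {C : ℝ} {L : NNReal} (hC : ∀ x y, dist (g x) (g y) ≤ C)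
    (hL : LipschitzWith L g) :
    IsBddLip (ENNReal.ofReal (max C L)) fun x => ENNReal.ofReal (g x) := by
  have key : ∀ x y d, dist x y ≤ d → ENNReal.ofReal (g y) ≤
      ENNReal.ofReal (g x) + ENNReal.ofReal (max C L) * min 1 (ENNReal.ofReal d) := by
    intro x y d hd
    have hM : 0 ≤ max C (L : ℝ) := le_max_of_le_right L.2
    have hd0 : 0 ≤ d := dist_nonneg.trans hd
    rw [← ENNReal.ofReal_one, ← ENNReal.ofReal_min, ← ENNReal.ofReal_mul hM]
    refine le_trans (ENNReal.ofReal_le_ofReal ?_) ENNReal.ofReal_add_le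
    have h1 : g y - g x ≤ dist (g x) (g y) := by
      rw [dist_comm]; exact le_abs_self _
    have h2 : dist (g x) (g y) ≤ L * d := (hL.dist_le_mul x y).trans (by gcongr)
    rcases min_cases (1 : ℝ) d with ⟨h3, -⟩ | ⟨h3, -⟩ <;> rw [h3]
    · linarith [hC x y, le_max_left C (L : ℝ)]
    · linarith [mul_le_mul_of_nonneg_right (le_max_right C (L : ℝ)) hd0]
  intro x y hxy
  have hd : dist x y = y - x := by rw [dist_comm, Real.dist_eq, abs_of_nonneg (sub_nonneg.2 hxy)]
  exact ⟨key x y _ hd.le, key y x _ ((dist_comm y x).trans hd).le⟩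

lemma integral_map_eq_lintegral_ofReal {Ω : Type*} [MeasurableSpace Ω] {μ : Measure Ω}
    [IsProbabilityMeasure μ] {f : ℝ → ℝ} (hf : Continuous f) {c B : ℝ} (h0 : ∀ x, 0 ≤ f x - c)
    (hB : ∀ x, f x - c ≤ B) {Y : Ω → ℝ} (hY : AEMeasurable Y μ) :
    ∫ x, f x ∂(μ.map Y) = (∫⁻ ω, ENNReal.ofReal (f (Y ω) - c) ∂μ).toReal + c := by
  have hm : AEStronglyMeasurable (fun ω => f (Y ω) - c) μ :=
    ((hf.measurable.comp_aemeasurable hY).sub_const c).aestronglyMeasurable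
  have hi : Integrable (fun ω => f (Y ω) - c) μ :=
    Integrable.of_bound hm B (Eventually.of_forall fun ω => by
      rw [Real.norm_eq_abs, abs_of_nonneg (h0 _)]; exact hB _)
  rw [integral_map hY hf.aestronglyMeasurable,
    ← integral_eq_lintegral_of_nonneg_ae (Eventually.of_forall fun ω => h0 _) hm]
  have : ∀ ω, f (Y ω) = (f (Y ω) - c) + c := fun ω => by ring
  rw [integral_congr_ae (Eventually.of_forall this), integral_add hi (integrable_const _)]
  simp

lemma tendstoInDistribution_of_tendsto_lintegral {Ω₁ Ω₂ : Type*} [MeasurableSpace Ω₁]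
    [MeasurableSpace Ω₂] {Q : Measure Ω₁} [IsProbabilityMeasure Q] {P : Measure Ω₂}
    [IsProbabilityMeasure P] {X : ℕ → Ω₁ → ℝ} {Z : Ω₂ → ℝ} (hX : ∀ n, AEMeasurable (X n) Q)
    (hZ : AEMeasurable Z P)
    (h : ∀ (c B : ℝ≥0∞) (F : ℝ → ℝ≥0∞), c ≠ ∞ → B ≠ ∞ → Continuous F → (∀ x, F x ≤ B) →
      IsBddLip c F → Tendsto (fun n => ∫⁻ ω, F (X n ω) ∂Q) atTop (𝓝 (∫⁻ ω, F (Z ω) ∂P))) :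
    TendstoInDistribution X atTop Z (fun _ => Q) P where
  forall_aemeasurable := hX
  aemeasurable_limit := hZ
  tendsto := by
    refine tendsto_iff_forall_lipschitz_integral_tendsto.2 ?_
    rintro f ⟨C, hC⟩ ⟨L, hL⟩
    have hfc : Continuous f := hL.continuous
    -- Since `f` oscillates by at most `C`, this shift takes values in `[0, 2 C]`, so that integrals
    -- can be computed as lower Lebesgue integrals.
    set g : ℝ → ℝ := fun x => f x - (f 0 - C) with hg
    have hgc : Continuous g := by fun_prop
    have hfx : ∀ x, |f x - f 0| ≤ C := fun x => hC x 0
    have hg0 : ∀ x, 0 ≤ g x := fun x => by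
      have := (abs_le.1 (hfx x)).1
      simp only [hg]; linarith
    have hgB : ∀ x, g x ≤ 2 * C := fun x => by
      have := (abs_le.1 (hfx x)).2
      simp only [hg]; linarith
    have hgC : ∀ x y, dist (g x) (g y) ≤ C := fun x y => by
      simpa only [hg, dist_sub_right] using hC x y
    have hgL : LipschitzWith L g := LipschitzWith.of_dist_le_mul fun x y => by
      simpa only [hg, dist_sub_right] using hL.dist_le_mul x y
    have hlim := h _ (ENNReal.ofReal (2 * C)) _ ENNReal.ofReal_ne_top ENNReal.ofReal_ne_top
      (ENNReal.continuous_ofReal.comp hgc) (fun x => ENNReal.ofReal_le_ofReal (hgB x))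
      (LipschitzWith.isBddLip hgC hgL)
    have hfin : ∫⁻ ω, ENNReal.ofReal (g (Z ω)) ∂P ≠ ∞ := by
      refine ne_top_of_le_ne_top (b := ENNReal.ofReal (2 * C)) ENNReal.ofReal_ne_top
        ((lintegral_mono fun ω => ENNReal.ofReal_le_ofReal (hgB _)).trans ?_)
      simp
    have hint := fun n => integral_map_eq_lintegral_ofReal hfc hg0 hgB (hX n)
    have hint' := integral_map_eq_lintegral_ofReal hfc hg0 hgB hZ
    have := ((ENNReal.tendsto_toReal hfin).comp hlim).add_const (f 0 - C)
    rw [← hint'] at this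
    exact this.congr fun n => (hint n).symm

end LongRangeLPP

end

theorem theorem4 {Ω : Type*} [MeasurableSpace Ω] (P : Measure Ω) [IsProbabilityMeasure P]
    (s : ℝ) (hs0 : 0 < s) (hs2 : s < 2)
    (W U V : ℕ → Ω → ℝ) (hWUV : LongRangeLPP.IsContinuousModelInput P W U V) :
    (∀ᵐ ω ∂P, LongRangeLPP.contPassageTime s (W · ω) (U · ω) (V · ω) < ∞) ∧
    ∀ (ν : Measure ℝ) [IsProbabilityMeasure ν], (∀ᵐ x ∂ν, 0 < x) →
      LongRangeLPP.RegularlyVaryingTail (cdf ν) s →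
      ∀ {Ω' : Type*} [MeasurableSpace Ω'] (Q : Measure Ω') [IsProbabilityMeasure Q]
        (v : LongRangeLPP.Edge → Ω' → ℝ), (∀ e, HasLaw (v e) ν Q) → iIndepFun v Q →
        TendstoInDistribution
          (fun (n : ℕ) (ω' : Ω') =>
            LongRangeLPP.passageTime (v · ω') 0 n / LongRangeLPP.scale (cdf ν) n)
          atTop
          (fun ω : Ω => (LongRangeLPP.contPassageTime s (W · ω) (U · ω) (V · ω)).toReal)
          (fun _ => Q) P := by
  obtain ⟨Ω₀, _, Q₀, u, hu⟩ := LongRangeLPP.exists_isUniformField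
  -- Finiteness involves no weight distribution, so the discrete comparison model may use the pure
  -- power `y ^ (-1 / s)` for every `n`.
  refine ⟨LongRangeLPP.ae_contPassageTime_lt_top hu hWUV
    (LongRangeLPP.isScaledWeight_rpow hs0 hs2), fun ν _ hν hreg Ω' _ Q _ v hv hvi => ?_⟩
  obtain ⟨C, r, hH⟩ := LongRangeLPP.exists_isScaledWeight hν hs0 hs2 hreg
  have hvm : AEMeasurable (fun ω e => v e ω) Q :=
    aemeasurable_pi_lambda _ fun e => (hv e).aemeasurable
  refine LongRangeLPP.tendstoInDistribution_of_tendsto_lintegral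
    (fun n => ((LongRangeLPP.measurable_passageTime 0 n).comp_aemeasurable hvm).div_const _)
    (hWUV.aemeasurable_contPassageTime s).ennreal_toReal fun c B F hc hB hFc hFB hF => ?_
  refine (LongRangeLPP.tendsto_lintegral_passageTime hu hWUV hH hc hFc hB hFB hF).congr' ?_
  -- Rescaling the marks by the number of edges requires `n ≥ 1`, as there are no edges for `n = 0`.
  filter_upwards [eventually_ge_atTop 1] with n hn
  rw [hu.lintegral_eq hν hv hvi (Φ := fun ξ => F (LongRangeLPP.passageTime ξ 0 n /
    LongRangeLPP.scale (cdf ν) n))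
    (hFc.measurable.comp ((LongRangeLPP.measurable_passageTime 0 n).div_const _))]
  simp_rw [LongRangeLPP.passageTime_div_scale hν hn]
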